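/- **Setting.** Let $\mathcal K\subseteq\mathbb R^d$ be a convex set of (Euclidean) diameter $1$ and let $T\ge 2$. In each round $t=1,\dots,T$ a learner plays a finitely supported distribution $\mathbf x_t$ on $\mathcal K$; then a loss $\ell_t:\mathcal K\to\mathbb R$ from a class $\mathcal L$ is revealed. Write $\ell(\mathbf x)=\mathbb E_{s\sim\mathbf x}\ell(s)$ and let $\phi(\mathbf x)$ be the push-forward of $\mathbf x$ under $\phi$. The full swap regret is $$\mathsf{FullSwapReg}=\sup_{\phi:\mathcal K\to\mathcal K}\ \sum_{t=1}^T\big(\ell_t(\mathbf x_t)-\ell_t(\phi(\mathbf x_t))\big).$$ All losses are $L$-Lipschitz on $\mathcal K$, $L>0$. A loss is *$\beta$-smooth* ($\beta\ge0$) if for each $x\in\mathcal K$ there is $g$ with $\ell(y)-\ell(x)-\langle g,y-x\rangle\le\frac\beta2\|y-x\|^2$ for all $y\in\mathcal K$; *$\alpha$-strongly convex* ($\alpha>0$) has the usual meaning. **Discretizations.** Let $S\subset\mathcal K$ be finite, $N=|S|$. * $S$ is an *$\varepsilon$-net* if each $x\in\mathcal K$ is within $\varepsilon$ of a point of $S$.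 * $S$ is a *polytope approximation* with parameter $\varepsilon$ if $S$ is the vertex set of a polytope that has distance at most $\varepsilon^2$ from each point of $\mathcal K$. * $S$, with maps $x\mapsto x_\perp$ and $y\mapsto S(y)\subseteq S$, is an *$\varepsilon$-triangulation* if for each $x\in\mathcal K$: $x_\perp\in\mathrm{conv}(S)$, $\|x-x_\perp\|\le\varepsilon^2$, and $S(x_\perp)$ consists of at most $d+1$ affinely independent points within distance $\varepsilon$ of $x_\perp$ whose convex hull contains $x_\perp$. (In particular this holds, with $x_\perp$ the Euclidean projection of $x$ to $\mathrm{conv}(S)$, if $\mathrm{conv}(S)$ is within $\varepsilon^2$ of every point of $\mathcal K$ and every $y\in\mathrm{conv}(S)$ has such a set $S(y)$.) **Algorithms.** One copy of an external regret subroutine is kept for each $s\in S$. In round $t$ copy $s$ gives a distribution $Q_t[s]$ on $S$, the learner plays a stationary distribution $\mathbf x_t$ of the row-stochastic matrix $Q_t$, and copy $s$ is updated with $\ell_t$ and the scale $\mathbf x_t[s]$. * (BM–MWU) $Q_t[s][s']\propto\exp\big(-\eta\sum_{\tau<t}\mathbf x_\tau[s]\,\ell_\tau(s')\big)$ with $\eta=\frac1L\sqrt{N\log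 N/T}$. * (BM–OGD; $\mathcal K$ closed) Copy $s$ holds a point $q_{s,t}\in\mathcal K$, with arbitrary $q_{s,1}\in\mathcal K$, and $q_{s,t+1}=\Pi_{\mathcal K}\big(q_{s,t}-\eta_t\,\mathbf x_t[s]\,\nabla\ell_t(q_{s,t})\big)$, where $\eta_t=1/(\alpha\max(1,\sum_{\tau\le t}\mathbf x_\tau[s]))$ and $\nabla\ell_t(q)$ is any subgradient of norm at most $L$ (such subgradients exist). $Q_t[s]=H(q_{s,t})$ for a rounding map $H$: either *nearest point* of $S$, or *barycentric*: the distribution on $S(q_\perp)$ with mean $q_\perp$. **Theorem.** In each row below, with the indicated $\varepsilon$: (a) there are discretizations of the indicated kind with $N\le c_d\cdot(\text{size})$, where $c_d$ depends only on $d$, and with $N\le\mathrm{poly}(d,T)$ (in row 4 whenever the loss class is nonempty); (b) for each $c$ there is a constant $C$, depending only on $d$ and $c$, such that for every discretization of the indicated kind with $N\le c\cdot(\text{size})$, all losses from the class, and every run of the algorithm, $\mathsf{FullSwapReg}\le C\cdot(\text{rate})$. | losses ($L$-Lipschitz and) | algorithm | discretization | $\varepsilon$ | size | rate | |---|---|---|---|---|---|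 | no assumption | BM–MWU | $\varepsilon$-net | $T^{-1/(d+2)}$ | $\varepsilon^{-d}$ | $L\,T^{(d+1)/(d+2)}\log T$ | | $\beta$-smooth | BM–MWU | $\varepsilon$-triangulation | $T^{-1/(d+4)}$ | $\varepsilon^{-d}$ | $(L+\beta)\,T^{(d+2)/(d+4)}\log T$ | | concave | BM–MWU | polytope approximation | $T^{-1/(d+3)}$ | $\varepsilon^{-(d-1)}$ | $L\,T^{(d+1)/(d+3)}\log T$ | | $\alpha$-strongly convex | BM–OGD, nearest point | $\varepsilon$-net | $(L/\alpha)^{1/(d+1)}T^{-1/(d+1)}$ | $\max(1,\varepsilon^{-d})$ | $L(L/\alpha)^{1/(d+1)}\,T^{d/(d+1)}\log T$ | | $\alpha$-strongly convex and $\beta$-smooth | BM–OGD, barycentric | $\varepsilon$-triangulation | $T^{-1/(d+2)}$ | $\varepsilon^{-d}$ | $L(\beta/L+L/\alpha)\,T^{d/(d+2)}\log T$ | Moreover the three algorithms are carried out by fixed programs (the same for all $d$, $\mathcal K$, $S$, $T$ and losses) of a real random access machine with unit-cost arithmetic, comparisons and exponentials, in at most $\mathrm{poly}(d,N)$ steps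 per round, with absolute constants. The input is $d$, $N$, the points of $S$, and $\eta$ or $\alpha$ and the starting points; the programs can query, at a cost proportional to the length of query and answer, values of past losses (BM–MWU), or subgradients of past losses and $\Pi_{\mathcal K}$ (BM–OGD), and, for barycentric rounding, $x\mapsto x_\perp$ and $y\mapsto S(y)$. -/

import Mathlib

open scoped NNReal

noncomputable section

namespace FullSwap

/-- Points of Euclidean `d`-space. -/
abbrev Pt (d : ℕ) := EuclideanSpace ℝ (Fin d)

/-! ### Losses and full swap regret -/

/-- `β`-smoothness on `K`: a quadratic upper bound around every point of `K`. -/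
def IsSmoothOn {d : ℕ} (K : Set (Pt d)) (β : ℝ) (l : Pt d → ℝ) : Prop :=
  ∀ x ∈ K, ∃ g : Pt d, ∀ y ∈ K, l y - l x - inner ℝ g (y - x) ≤ β / 2 * ‖y - x‖ ^ 2

/-- `g` selects, at every point of `K`, a subgradient of `l` relative to `K` of norm at most `L`. -/
def IsSubgradientMap {d : ℕ} (K : Set (Pt d)) (L : ℝ≥0) (l : Pt d → ℝ) (g : Pt d → Pt d) : Prop :=
  ∀ x ∈ K, ‖g x‖ ≤ L ∧ ∀ y ∈ K, 0 ≤ l y - l x - inner ℝ (g x) (y - x)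

/-- The expected loss of a finitely supported distribution. -/
def expLoss {d : ℕ} (l : Pt d → ℝ) (p : Pt d →₀ ℝ) : ℝ := p.sum fun s w => w * l s

/-- Full swap regret over the first `T` rounds: the supremum over all swap functions from `K` to
`K`; the image of a distribution under the swap function is its push-forward. -/
def fullSwapReg {d : ℕ} (K : Set (Pt d)) (T : ℕ) (x : ℕ → Pt d →₀ ℝ) (l : ℕ → Pt d → ℝ) : EReal :=
  ⨆ φ : {φ : Pt d → Pt d // Set.MapsTo φ K K},
    ((∑ t ∈ Finset.range T,
      (expLoss (l t) (x t) - expLoss (l t) (Finsupp.mapDomain φ.1 (x t))) : ℝ) : EReal)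

/-- The distribution on the points `pts i` with weights `w i`. -/
def mixture {d N : ℕ} (pts : Fin N → Pt d) (w : Fin N → ℝ) : Pt d →₀ ℝ :=
  ∑ i, Finsupp.single (pts i) (w i)

/-! ### Discretizations, enumerated without repetition by `pts` -/

/-- A Euclidean projection of `z` to `K` (unique if `K` is nonempty, closed and convex). -/
def proj {d : ℕ} (K : Set (Pt d)) (z : Pt d) : Pt d :=
  Classical.epsilon fun p => p ∈ K ∧ ∀ y ∈ K, dist z p ≤ dist z y

/-- `ε`-nets. -/
structure IsNet {d N : ℕ} (ε : ℝ) (K : Set (Pt d)) (pts : Fin N → Pt d) : Prop where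
  inj : Function.Injective pts
  mem : ∀ i, pts i ∈ K
  near : ∀ x ∈ K, ∃ i, dist x (pts i) ≤ ε

/-- `pts` lists the vertices of a polytope inside `K` at distance at most `δ` from each point
of `K`. -/
structure IsPolytopeApprox {d N : ℕ} (δ : ℝ) (K : Set (Pt d)) (pts : Fin N → Pt d) : Prop where
  inj : Function.Injective pts
  vertices : ConvexIndependent ℝ pts
  mem : ∀ i, pts i ∈ K
  near : ∀ x ∈ K, ∃ y ∈ convexHull ℝ (Set.range pts), dist x y ≤ δ

/-- The vertices with indices in `c` span a simplex that contains `y`, and all of them are within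
distance `ε` of `y`. -/
structure IsCell {d N : ℕ} (ε : ℝ) (pts : Fin N → Pt d) (y : Pt d) (c : Finset (Fin N)) :
    Prop where
  card_le : c.card ≤ d + 1
  simplex : AffineIndependent ℝ fun i : c => pts i
  mem_hull : y ∈ convexHull ℝ (pts '' c)
  near : ∀ i ∈ c, dist y (pts i) ≤ ε

/-- `ε`-triangulations in the strict sense: every point of the convex hull has a cell. -/
structure IsStrictTriangulation {d N : ℕ} (ε : ℝ) (K : Set (Pt d)) (pts : Fin N → Pt d)
    (cell : Pt d → Finset (Fin N)) : Prop where
  inj : Function.Injective pts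
  mem : ∀ i, pts i ∈ K
  near : ∀ x ∈ K, ∃ y ∈ convexHull ℝ (Set.range pts), dist x y ≤ ε ^ 2
  isCell : ∀ y ∈ convexHull ℝ (Set.range pts), IsCell ε pts y (cell y)

/-- `ε`-triangulations with a map `perp` that moves each point of `K` by at most `ε ^ 2` to a
point of the convex hull that has a cell. For a strict `ε`-triangulation, `perp` can be taken to
be the Euclidean projection to the convex hull, see `IsStrictTriangulation.isTriangulation`. -/
structure IsTriangulation {d N : ℕ} (ε : ℝ) (K : Set (Pt d)) (pts : Fin N → Pt d)
    (perp : Pt d → Pt d) (cell : Pt d → Finset (Fin N)) : Prop where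
  inj : Function.Injective pts
  mem : ∀ i, pts i ∈ K
  perp_mem : ∀ x ∈ K, perp x ∈ convexHull ℝ (Set.range pts)
  near : ∀ x ∈ K, dist x (perp x) ≤ ε ^ 2
  isCell : ∀ x ∈ K, IsCell ε pts (perp x) (cell (perp x))

theorem IsStrictTriangulation.isTriangulation {d N : ℕ} {ε : ℝ} {K : Set (Pt d)}
    {pts : Fin N → Pt d} {cell : Pt d → Finset (Fin N)}
    (h : IsStrictTriangulation ε K pts cell) :
    IsTriangulation ε K pts (proj (convexHull ℝ (Set.range pts))) cell := by
  have key : ∀ x ∈ K, proj (convexHull ℝ (Set.range pts)) x ∈ convexHull ℝ (Set.range pts) ∧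
      ∀ y ∈ convexHull ℝ (Set.range pts),
        dist x (proj (convexHull ℝ (Set.range pts)) x) ≤ dist x y := by
    intro x hx
    obtain ⟨y, hy, -⟩ := h.near x hx
    obtain ⟨p, hp, hpd⟩ :=
      ((Set.finite_range pts).isCompact_convexHull (𝕜 := ℝ)).exists_infDist_eq_dist ⟨y, hy⟩ x
    exact Classical.epsilon_spec (p := fun p => p ∈ convexHull ℝ (Set.range pts) ∧
      ∀ y ∈ convexHull ℝ (Set.range pts), dist x p ≤ dist x y)
      ⟨p, hp, fun z hz => hpd ▸ Metric.infDist_le_dist_of_mem hz⟩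
  refine ⟨h.inj, h.mem, fun x hx => (key x hx).1, fun x hx => ?_,
    fun x hx => h.isCell _ (key x hx).1⟩
  obtain ⟨y, hy, hxy⟩ := h.near x hx
  exact ((key x hx).2 y hy).trans hxy

/-! ### Rounding -/

/-- Rounding to a nearest point of the discretization (ties broken arbitrarily). -/
def NearestRounding {d N : ℕ} (pts : Fin N → Pt d) (q : Pt d) (z : Fin N → ℝ) : Prop :=
  ∃ i, (∀ j, dist q (pts i) ≤ dist q (pts j)) ∧ z = Pi.single i 1

/-- Rounding in a triangulation: move `q` to `perp q`, then write it in barycentric coordinates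
with respect to its cell. -/
def BarycentricRounding {d N : ℕ} (pts : Fin N → Pt d) (perp : Pt d → Pt d)
    (cell : Pt d → Finset (Fin N)) (q : Pt d) (z : Fin N → ℝ) : Prop :=
  z ∈ stdSimplex ℝ (Fin N) ∧ (∀ i ∉ cell (perp q), z i = 0) ∧ ∑ i, z i • pts i = perp q

/-! ### External regret subroutines (they see a list of pairs: feedback, scale) -/

/-- Multiplicative weights over the discretization, with learning rate `η`. -/
def mwu {d N : ℕ} (η : ℝ) (pts : Fin N → Pt d) (h : List ((Pt d → ℝ) × ℝ)) (j : Fin N) : ℝ :=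
  Real.exp (-η * (h.map fun a => a.2 * a.1 (pts j)).sum) /
    ∑ i, Real.exp (-η * (h.map fun a => a.2 * a.1 (pts i)).sum)

/-- The learning rate of multiplicative weights for `N` points, horizon `T` and `L`-Lipschitz
losses on a set of diameter 1. -/
def mwuRate (L : ℝ≥0) (T N : ℕ) : ℝ := √(N * Real.log N / T) / L

/-- Step size of online gradient descent for `α`-strongly convex losses. -/
def ogdRate (α G : ℝ) : ℝ := if G ≤ 1 then 1 / α else 1 / (α * G)

/-- One step of scaled online gradient descent; the state is the current point together with the
sum of the scales so far. -/
def ogdStep {d : ℕ} (K : Set (Pt d)) (α : ℝ) (st : Pt d × ℝ) (a : (Pt d → Pt d) × ℝ) :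
    Pt d × ℝ :=
  (proj K (st.1 - (ogdRate α (st.2 + a.2) * a.2) • a.1 st.1), st.2 + a.2)

/-- Online gradient descent started at `q₁`; the feedback is the subgradient map of the loss. -/
def ogd {d : ℕ} (K : Set (Pt d)) (α : ℝ) (q₁ : Pt d) (h : List ((Pt d → Pt d) × ℝ)) : Pt d :=
  (h.foldl (ogdStep K α) (q₁, 0)).1

/-! ### The two Blum–Mansour templates -/

/-- What the copy of the subroutine at the point number `s` has seen before round `t`. -/
def history {F : Type} {N : ℕ} (f : ℕ → F) (x : ℕ → Fin N → ℝ) (s : Fin N) (t : ℕ) :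
    List (F × ℝ) :=
  (List.range t).map fun τ => (f τ, x τ s)

def IsStationary {N : ℕ} (Q : Matrix (Fin N) (Fin N) ℝ) (x : Fin N → ℝ) : Prop :=
  x ∈ stdSimplex ℝ (Fin N) ∧ Matrix.vecMul x Q = x

/-- `x` is a possible play in rounds `0, …, T - 1` of Blum–Mansour with a subroutine `A` that
recommends distributions on the discretization. -/
def IsRunNonconvex {F : Type} {N : ℕ} (A : List (F × ℝ) → Fin N → ℝ) (f : ℕ → F) (T : ℕ)
    (x : ℕ → Fin N → ℝ) : Prop :=
  ∀ t < T, IsStationary (Matrix.of fun s => A (history f x s t)) (x t)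

/-- `x` is a possible play in rounds `0, …, T - 1` of Blum–Mansour with subroutines `A s` that
recommend points of the action set, and with the rounding procedure `H` (as a relation between a
point and its admissible roundings). -/
def IsRunConvex {F : Type} {d N : ℕ} (A : Fin N → List (F × ℝ) → Pt d)
    (H : Pt d → (Fin N → ℝ) → Prop) (f : ℕ → F) (T : ℕ) (x : ℕ → Fin N → ℝ) : Prop :=
  ∀ t < T, ∃ Q : Fin N → Fin N → ℝ,
    (∀ s, H (A s (history f x s t)) (Q s)) ∧ IsStationary (Matrix.of Q) (x t)

/-! ### A real random access machine

Programs of a structured language with natural-number variables and two-dimensional arrays of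
reals. Every arithmetic operation, exponential, comparison, memory access, assignment and loop
iteration costs one step; an oracle call is charged for reading the query and writing the answer. -/

structure State where
  nat : ℕ → ℕ
  arr : ℕ → ℕ → ℕ → ℝ

inductive NExp where
  | const (k : ℕ)
  | var (v : ℕ)
  | add (a b : NExp)
  | sub (a b : NExp)

def NExp.eval (σ : State) : NExp → ℕ
  | .const k => k
  | .var v => σ.nat v
  | .add a b => a.eval σ + b.eval σ
  | .sub a b => a.eval σ - b.eval σ

def NExp.cost : NExp → ℕ
  | .const _ => 1
  | .var _ => 1
  | .add a b => a.cost + b.cost + 1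
  | .sub a b => a.cost + b.cost + 1

inductive RExp where
  | ofNat (e : NExp)
  | cell (a : ℕ) (i j : NExp)
  | add (x y : RExp)
  | sub (x y : RExp)
  | mul (x y : RExp)
  | div (x y : RExp)
  | exp (x : RExp)

def RExp.eval (σ : State) : RExp → ℝ
  | .ofNat e => (e.eval σ : ℝ)
  | .cell a i j => σ.arr a (i.eval σ) (j.eval σ)
  | .add x y => x.eval σ + y.eval σ
  | .sub x y => x.eval σ - y.eval σ
  | .mul x y => x.eval σ * y.eval σ
  | .div x y => x.eval σ / y.eval σ
  | .exp x => Real.exp (x.eval σ)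

def RExp.cost : RExp → ℕ
  | .ofNat e => e.cost + 1
  | .cell _ i j => i.cost + j.cost + 1
  | .add x y => x.cost + y.cost + 1
  | .sub x y => x.cost + y.cost + 1
  | .mul x y => x.cost + y.cost + 1
  | .div x y => x.cost + y.cost + 1
  | .exp x => x.cost + 1

inductive Cmd where
  | skip
  | setN (v : ℕ) (e : NExp)
  | setR (a : ℕ) (i j : NExp) (e : RExp)
  | seq (c₁ c₂ : Cmd)
  | ifLe (x y : RExp) (c₁ c₂ : Cmd)
  /-- for `v = 0, …, n - 1` do `c`; the bound is evaluated once -/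
  | loop (v : ℕ) (n : NExp) (c : Cmd)
  /-- ask oracle `o` about the point in row `i` of array `a`; the answer goes to row `j` of
  array `b` -/
  | query (o a : ℕ) (i : NExp) (b : ℕ) (j : NExp)

/-- Oracles, numbered; an oracle maps a point to a list of reals. -/
abbrev Oracles (d : ℕ) := ℕ → Pt d → List ℝ

def State.setNat (σ : State) (v k : ℕ) : State :=
  { σ with nat := fun w => if w = v then k else σ.nat w }

def State.setArr (σ : State) (a i j : ℕ) (r : ℝ) : State :=
  { σ with arr := fun a' i' j' => if a' = a ∧ i' = i ∧ j' = j then r else σ.arr a' i' j' }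

def State.setRow (σ : State) (a i : ℕ) (r : List ℝ) : State :=
  { σ with arr := fun a' i' j' =>
      if a' = a ∧ i' = i then r.getD j' (σ.arr a' i' j') else σ.arr a' i' j' }

def State.point (σ : State) (d a i : ℕ) : Pt d := WithLp.toLp 2 fun k : Fin d => σ.arr a i k

/-- The state after the execution of a program, and the number of steps. -/
def Cmd.exec {d : ℕ} (O : Oracles d) : Cmd → State → State × ℕ
  | .skip, σ => (σ, 1)
  | .setN v e, σ => (σ.setNat v (e.eval σ), e.cost + 1)
  | .setR a i j e, σ =>
      (σ.setArr a (i.eval σ) (j.eval σ) (e.eval σ), i.cost + j.cost + e.cost + 1)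
  | .seq c₁ c₂, σ =>
      let r₁ := c₁.exec O σ
      let r₂ := c₂.exec O r₁.1
      (r₂.1, r₁.2 + r₂.2)
  | .ifLe x y c₁ c₂, σ =>
      let r := if x.eval σ ≤ y.eval σ then c₁.exec O σ else c₂.exec O σ
      (r.1, r.2 + x.cost + y.cost + 1)
  | .loop v n c, σ =>
      (List.range (n.eval σ)).foldl
        (fun p k =>
          let r := c.exec O (p.1.setNat v k)
          (r.1, p.2 + r.2 + 1))
        (σ, n.cost + 1)
  | .query o a i b j, σ =>
      let ans := O o (σ.point d a (i.eval σ))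
      (σ.setRow b (j.eval σ) ans, i.cost + j.cost + d + ans.length + 1)

/-- A program for online learning: in each round `act` computes the play, then the loss is
revealed through oracles and `update` is executed. -/
structure OnlineProgram where
  act : Cmd
  update : Cmd

/-- The input: variables 0 and 1 hold `d` and `N`, array 0 the discretization, array 1 the starting
points, and cell (0,0) of array 2 a real parameter; everything else is zero. -/
def inputState {d N : ℕ} (pts start : Fin N → Pt d) (param : ℝ) : State where
  nat v := if v = 0 then d else if v = 1 then N else 0
  arr a i j :=
    if a = 2 then (if i = 0 ∧ j = 0 then param else 0)
    else if h : i < N ∧ j < d then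
      (if a = 0 then pts ⟨i, h.1⟩ ⟨j, h.2⟩ else if a = 1 then start ⟨i, h.1⟩ ⟨j, h.2⟩ else 0)
    else 0

/-- The state before round `t`, when `O` are the oracles of the `act` phases and `O' τ` those
of the `update` phase of round `τ`. -/
def OnlineProgram.state {d : ℕ} (P : OnlineProgram) (O : Oracles d) (O' : ℕ → Oracles d)
    (σ : State) : ℕ → State
  | 0 => σ
  | t + 1 => (P.update.exec (O' t) (P.act.exec O (P.state O O' σ t)).1).1

/-- The play in round `t`: the first `N` entries of row 0 of array 3 after the `act` phase. -/
def OnlineProgram.play {d : ℕ} (P : OnlineProgram) (O : Oracles d) (O' : ℕ → Oracles d)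
    (σ : State) (N t : ℕ) (i : Fin N) : ℝ :=
  (P.act.exec O (P.state O O' σ t)).1.arr 3 0 i

/-- The number of steps in round `t`. -/
def OnlineProgram.time {d : ℕ} (P : OnlineProgram) (O : Oracles d) (O' : ℕ → Oracles d)
    (σ : State) (t : ℕ) : ℕ :=
  let r := P.act.exec O (P.state O O' σ t)
  r.2 + (P.update.exec (O' t) r.1).2

/-! ### Oracles -/

def noOracle (d : ℕ) : Oracles d := fun _ _ => []

/-- Both families of oracles (used for families with different numbers). -/
def Oracles.join {d : ℕ} (O O' : Oracles d) : Oracles d := fun o x => O o x ++ O' o x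

/-- Oracle 0: values of the loss. -/
def valueOracle {d : ℕ} (l : Pt d → ℝ) : Oracles d := fun o x => if o = 0 then [l x] else []

/-- Oracle 1: subgradients of the loss. -/
def gradOracle {d : ℕ} (g : Pt d → Pt d) : Oracles d :=
  fun o x => if o = 1 then List.ofFn (g x).ofLp else []

/-- Oracle 2: projection to the action set. -/
def projOracle {d : ℕ} (K : Set (Pt d)) : Oracles d :=
  fun o x => if o = 2 then List.ofFn (proj K x).ofLp else []

/-- Oracles 3 and 4: the map `perp` and the cells of a triangulation (as indicator vectors). -/
def cellOracle {d N : ℕ} (perp : Pt d → Pt d) (cell : Pt d → Finset (Fin N)) : Oracles d :=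
  fun o x =>
    if o = 3 then List.ofFn (perp x).ofLp
    else if o = 4 then List.ofFn fun i : Fin N => if i ∈ cell x then (1 : ℝ) else 0
    else []

/-! ### Guarantees -/

/-- Blum–Mansour with multiplicative weights on the discretization `pts` has full swap regret at
most `B` over `T` rounds with losses from `𝓛`, and the program `P`, with access to values of the
losses, runs this algorithm in at most `k * (d + N) ^ k` steps per round. -/
def GuaranteeMWU {d N : ℕ} (P : OnlineProgram) (k : ℕ) (K : Set (Pt d)) (L : ℝ≥0) (T : ℕ)
    (pts : Fin N → Pt d) (𝓛 : Set (Pt d → ℝ)) (B : ℝ) : Prop :=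
  ∀ l : ℕ → Pt d → ℝ, (∀ t < T, l t ∈ 𝓛) →
    (∀ x : ℕ → Fin N → ℝ, IsRunNonconvex (mwu (mwuRate L T N) pts) l T x →
      fullSwapReg K T (fun t => mixture pts (x t)) l ≤ (B : EReal)) ∧
    let O' := fun t => valueOracle (l t)
    let σ := inputState pts (fun _ => 0) (mwuRate L T N)
    IsRunNonconvex (mwu (mwuRate L T N) pts) l T (P.play (noOracle d) O' σ N) ∧
    ∀ t < T, P.time (noOracle d) O' σ t ≤ k * (d + N) ^ k

/-- Blum–Mansour with online gradient descent and the rounding `H`, on the discretization `pts`,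
has full swap regret at most `B` over `T` rounds with losses from `𝓛`, for any choice of the
starting points and of subgradients bounded by `L`, which always exist; and the program `P`, with
access to subgradients, to the projection to `K` and to the oracles `O`, runs this algorithm in at
most `k * (d + N) ^ k` steps per round. -/
def GuaranteeOGD {d N : ℕ} (P : OnlineProgram) (k : ℕ) (K : Set (Pt d)) (L : ℝ≥0) (α : ℝ) (T : ℕ)
    (pts : Fin N → Pt d) (H : Pt d → (Fin N → ℝ) → Prop) (O : Oracles d)
    (𝓛 : Set (Pt d → ℝ)) (B : ℝ) : Prop :=
  (∀ l ∈ 𝓛, ∃ g, IsSubgradientMap K L l g) ∧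
  ∀ (l : ℕ → Pt d → ℝ) (g : ℕ → Pt d → Pt d) (q₁ : Fin N → Pt d),
    (∀ t < T, l t ∈ 𝓛 ∧ IsSubgradientMap K L (l t) (g t)) → (∀ s, q₁ s ∈ K) →
    (∀ x : ℕ → Fin N → ℝ, IsRunConvex (fun s => ogd K α (q₁ s)) H g T x →
      fullSwapReg K T (fun t => mixture pts (x t)) l ≤ (B : EReal)) ∧
    let O₀ := (projOracle K).join O
    let O' := fun t => O₀.join (gradOracle (g t))
    let σ := inputState pts q₁ α
    IsRunConvex (fun s => ogd K α (q₁ s)) H g T (P.play O₀ O' σ N) ∧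
    ∀ t < T, P.time O₀ O' σ t ≤ k * (d + N) ^ k

end FullSwap

end

open scoped NNReal

noncomputable section

namespace FullSwap

/-! Regret. Stationarity of `x t` rewrites the learner's loss as a sum over `s` of `x t s` times the
loss of the distribution recommended by copy `s`, and a swap function enters only through its values
at the points of the discretization. So the full swap regret is at most the sum of the external
regrets of the `N` copies, each against an arbitrary point of `K` (`fullSwapReg_le`). The scales of
one round add up to 1, so error terms linear in the scale add up to `T` over all copies, not to `N *
T`.

Multiplicative weights costs `log N / η` per copy plus `η * L ^ 2 / 2` times the total scale; over
all copies this is of order `L * √(T * N * log N)`. A comparator off the discretization is replaced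
by a distribution on it that is fixed over the rounds and loses at most `δ` per round
(`fullSwapReg_mwu_le`). For a net `δ = L * ε`; with barycentric weights and smooth losses the
first-order term averages out and `δ = (L + β / 2) * ε ^ 2`; for concave losses Jensen's inequality
on the hull gives `δ = L * ε ^ 2`. Gradient descent with strongly convex losses has regret of order
`L ^ 2 / α * log T` per copy against all of `K`, and only its own rounding costs `δ` per round
(`fullSwapReg_ogd_le`). The prescribed `ε` balances the two contributions.

Discretizations. Maximal separated sets are nets, and comparing volumes bounds their size. For
polytopes, a net of a sphere around `K` is projected to `K`: projection has a second-order stability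
in the normal direction (`proj_near_normal`), so an `ε`-net gives error `ε ^ 2`, and the sphere
saves one power of `ε`. For triangulations a net of a surrounding ball is projected, the support
estimate is localized near each point, and Carathéodory's theorem yields the cells. Sizes are
polynomial in `d` and `T` because a single center serves when `ε` is close to 1 (`exists_center`),
while otherwise factors like `40 ^ d` are absorbed by powers of `ε⁻¹` (`mul_pow_le_pow`).

Programs. Stationary distributions and barycentric coordinates both come from Gram–Schmidt without
pivoting: the last row of a matrix is projected to the orthogonal complement of the others
(`run_orthCmd`). For the first, absolute values of a left fixed vector of a stochastic matrix are
again fixed (`run_statCmd`); for the second, the affine system is homogenized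
(`barycentric_of_orthogonal`). Step counts follow from bounds on all variables, one polynomial
factor for each level of loops (`Cmd.exec_bounds`). -/

/-! ### Reasoning about programs -/

/-- The state after the execution of a program. -/
def Cmd.run {d : ℕ} (O : Oracles d) (c : Cmd) (σ : State) : State := (c.exec O σ).1

section run

variable {d : ℕ} (O : Oracles d)

@[simp] lemma run_skip (σ : State) : Cmd.skip.run O σ = σ := rfl

@[simp] lemma run_setN (v : ℕ) (e : NExp) (σ : State) :
    (Cmd.setN v e).run O σ = σ.setNat v (e.eval σ) := rfl

@[simp] lemma run_setR (a : ℕ) (i j : NExp) (e : RExp) (σ : State) :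
    (Cmd.setR a i j e).run O σ = σ.setArr a (i.eval σ) (j.eval σ) (e.eval σ) := rfl

@[simp] lemma run_seq (c₁ c₂ : Cmd) (σ : State) :
    (Cmd.seq c₁ c₂).run O σ = c₂.run O (c₁.run O σ) := rfl

lemma run_ifLe (x y : RExp) (c₁ c₂ : Cmd) (σ : State) :
    (Cmd.ifLe x y c₁ c₂).run O σ = if x.eval σ ≤ y.eval σ then c₁.run O σ else c₂.run O σ := by
  simp only [Cmd.run, Cmd.exec]; split_ifs <;> rfl

@[simp] lemma run_query (o a : ℕ) (i : NExp) (b : ℕ) (j : NExp) (σ : State) :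
    (Cmd.query o a i b j).run O σ =
      σ.setRow b (j.eval σ) (O o (σ.point d a (i.eval σ))) := rfl

lemma run_loop (v : ℕ) (n : NExp) (c : Cmd) (σ : State) :
    (Cmd.loop v n c).run O σ =
      (List.range (n.eval σ)).foldl (fun s k => c.run O (s.setNat v k)) σ := by
  simp only [Cmd.run, Cmd.exec]
  generalize n.cost + 1 = b
  generalize List.range (n.eval σ) = l
  induction l generalizing σ b with
  | nil => rfl
  | cons k l ih => simpa only [List.foldl_cons] using ih _ _

/-- Loop invariants. -/
lemma run_loop_induct {v : ℕ} {n : NExp} {c : Cmd} {σ : State} (I : ℕ → State → Prop)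
    (h0 : I 0 σ)
    (hs : ∀ k < n.eval σ, ∀ s, I k s → I (k + 1) (c.run O (s.setNat v k))) :
    I (n.eval σ) ((Cmd.loop v n c).run O σ) := by
  rw [run_loop]
  revert hs
  generalize n.eval σ = m
  intro hs
  induction m with
  | zero => simpa using h0
  | succ m ih =>
    rw [List.range_succ, List.foldl_append]
    exact hs m (Nat.lt_succ_self m) _ (ih fun k hk => hs k (hk.trans (Nat.lt_succ_self m)))

end run

/-- Whether a program may change the variable `w`. -/
def Cmd.writesN (w : ℕ) : Cmd → Bool
  | .skip => false
  | .setN v _ => v == w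
  | .setR _ _ _ _ => false
  | .seq c₁ c₂ => c₁.writesN w || c₂.writesN w
  | .ifLe _ _ c₁ c₂ => c₁.writesN w || c₂.writesN w
  | .loop v _ c => v == w || c.writesN w
  | .query _ _ _ _ _ => false

/-- Whether a program may change the array `w`. -/
def Cmd.writesA (w : ℕ) : Cmd → Bool
  | .skip => false
  | .setN _ _ => false
  | .setR a _ _ _ => a == w
  | .seq c₁ c₂ => c₁.writesA w || c₂.writesA w
  | .ifLe _ _ c₁ c₂ => c₁.writesA w || c₂.writesA w
  | .loop _ _ c => c.writesA w
  | .query _ _ _ b _ => b == w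

/-- A frame rule. `writesN` and `writesA` are computable, so for concrete programs the side
condition is settled by `rfl` or `simp`. -/
lemma Cmd.run_nat_of_not_writes {d : ℕ} (O : Oracles d) (w : ℕ) (c : Cmd) :
    ∀ σ : State, c.writesN w = false → (c.run O σ).nat w = σ.nat w := by
  induction c with
  | skip => intros; rfl
  | setN v e =>
    intro σ h
    have : v ≠ w := by simpa [Cmd.writesN] using h
    simp [State.setNat, this.symm]
  | setR a i j e => intros; rfl
  | seq c₁ c₂ h₁ h₂ =>
    intro σ h
    simp only [Cmd.writesN, Bool.or_eq_false_iff] at h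
    rw [run_seq, h₂ _ h.2, h₁ _ h.1]
  | ifLe x y c₁ c₂ h₁ h₂ =>
    intro σ h
    simp only [Cmd.writesN, Bool.or_eq_false_iff] at h
    rw [run_ifLe]
    split_ifs
    exacts [h₁ _ h.1, h₂ _ h.2]
  | loop v n c ih =>
    intro σ h
    simp only [Cmd.writesN, Bool.or_eq_false_iff, beq_eq_false_iff_ne] at h
    refine run_loop_induct O (fun _ s => s.nat w = σ.nat w) rfl fun k _ s hs => ?_
    rw [ih _ h.2, ← hs]
    simp [State.setNat, h.1.symm]
  | query o a i b j => intros; rfl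

lemma Cmd.run_arr_of_not_writes {d : ℕ} (O : Oracles d) (w : ℕ) (c : Cmd) :
    ∀ σ : State, c.writesA w = false → (c.run O σ).arr w = σ.arr w := by
  induction c with
  | skip => intros; rfl
  | setN v e => intros; rfl
  | setR a i j e =>
    intro σ h
    have : a ≠ w := by simpa [Cmd.writesA] using h
    ext i' j'
    simp [State.setArr, this.symm]
  | seq c₁ c₂ h₁ h₂ =>
    intro σ h
    simp only [Cmd.writesA, Bool.or_eq_false_iff] at h
    rw [run_seq, h₂ _ h.2, h₁ _ h.1]
  | ifLe x y c₁ c₂ h₁ h₂ =>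
    intro σ h
    simp only [Cmd.writesA, Bool.or_eq_false_iff] at h
    rw [run_ifLe]
    split_ifs
    exacts [h₁ _ h.1, h₂ _ h.2]
  | loop v n c ih =>
    intro σ h
    refine run_loop_induct O (fun _ s => s.arr w = σ.arr w) rfl fun k _ s hs => ?_
    rw [ih _ h, ← hs]
    rfl
  | query o a i b j =>
    intro σ h
    have : b ≠ w := by simpa [Cmd.writesA] using h
    ext i' j'
    simp [State.setRow, this.symm]

/-! ### Step counts -/

/-- The value of an index expression if every variable has its maximal value. -/
def NExp.ub (env : ℕ → ℕ) : NExp → ℕ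
  | .const k => k
  | .var v => env v
  | .add a b => a.ub env + b.ub env
  | .sub a _ => a.ub env

lemma NExp.eval_le_ub {env : ℕ → ℕ} {σ : State} (h : ∀ v, σ.nat v ≤ env v) :
    ∀ e : NExp, e.eval σ ≤ e.ub env
  | .const _ => le_rfl
  | .var v => h v
  | .add a b => add_le_add (a.eval_le_ub h) (b.eval_le_ub h)
  | .sub a _ => (Nat.sub_le _ _).trans (a.eval_le_ub h)

/-- The bounds `env` on the variables are preserved by the program. -/
def Cmd.Fits (env : ℕ → ℕ) : Cmd → Prop
  | .skip => True
  | .setN v e => e.ub env ≤ env v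
  | .setR _ _ _ _ => True
  | .seq c₁ c₂ => c₁.Fits env ∧ c₂.Fits env
  | .ifLe _ _ c₁ c₂ => c₁.Fits env ∧ c₂.Fits env
  | .loop v n c => n.ub env ≤ env v + 1 ∧ c.Fits env
  | .query _ _ _ _ _ => True

/-- Number of steps, up to a factor for each level of nested loops. -/
def Cmd.size : Cmd → ℕ
  | .skip => 1
  | .setN _ e => e.cost + 1
  | .setR _ i j e => i.cost + j.cost + e.cost + 1
  | .seq c₁ c₂ => c₁.size + c₂.size
  | .ifLe x y c₁ c₂ => c₁.size + c₂.size + x.cost + y.cost + 1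
  | .loop _ n c => n.cost + 1 + (c.size + 1)
  | .query _ _ i _ j => i.cost + j.cost + 2

/-- Depth of nested loops. -/
def Cmd.depth : Cmd → ℕ
  | .skip => 1
  | .setN _ _ => 1
  | .setR _ _ _ _ => 1
  | .seq c₁ c₂ => max c₁.depth c₂.depth
  | .ifLe _ _ c₁ c₂ => max c₁.depth c₂.depth
  | .loop _ _ c => c.depth + 1
  | .query _ _ _ _ _ => 1

/-- Loop bounds are read from variables, so time and variable bounds are proved together. The loop
variable ends at the bound minus one, hence the `+ 1` in `Fits`; each loop makes at most `M`
iterations and so contributes one factor `M`. -/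
lemma Cmd.exec_bounds {d M : ℕ} {O : Oracles d} {env : ℕ → ℕ} (hM : 1 ≤ M)
    (henv : ∀ v, env v + 1 ≤ M) (hO : ∀ o x, d + (O o x).length ≤ M) (c : Cmd)
    (hc : c.Fits env) :
    ∀ σ : State, (∀ v, σ.nat v ≤ env v) →
      (∀ v, (c.run O σ).nat v ≤ env v) ∧ (c.exec O σ).2 ≤ c.size * M ^ c.depth := by
  have hpow : ∀ {k n m : ℕ}, n ≤ m → k * M ^ n ≤ k * M ^ m := fun h =>
    Nat.mul_le_mul_left _ (Nat.pow_le_pow_right hM h)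
  have hone : ∀ k n : ℕ, k ≤ k * M ^ n := fun k n =>
    Nat.le_mul_of_pos_right _ (Nat.pow_pos hM)
  induction c with
  | skip => exact fun σ h => ⟨h, by simpa [Cmd.exec, Cmd.size, Cmd.depth] using hM⟩
  | setN v e =>
    refine fun σ h => ⟨fun w => ?_, hone _ _⟩
    rw [run_setN]
    simp only [State.setNat]
    split_ifs with hw
    · exact hw ▸ (NExp.eval_le_ub h e).trans hc
    · exact h w
  | setR a i j e => exact fun σ h => ⟨h, hone _ _⟩
  | seq c₁ c₂ h₁ h₂ =>
    intro σ h
    obtain ⟨h₁n, h₁t⟩ := h₁ hc.1 σ h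
    obtain ⟨h₂n, h₂t⟩ := h₂ hc.2 _ h₁n
    refine ⟨h₂n, ?_⟩
    simp only [Cmd.exec, Cmd.size, Cmd.depth, add_mul]
    exact add_le_add (h₁t.trans (hpow (le_max_left _ _))) (h₂t.trans (hpow (le_max_right _ _)))
  | ifLe x y c₁ c₂ h₁ h₂ =>
    intro σ h
    obtain ⟨h₁n, h₁t⟩ := h₁ hc.1 σ h
    obtain ⟨h₂n, h₂t⟩ := h₂ hc.2 σ h
    have e₁ := h₁t.trans (hpow (le_max_left c₁.depth c₂.depth))
    have e₂ := h₂t.trans (hpow (le_max_right c₁.depth c₂.depth))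
    refine ⟨fun v => ?_, ?_⟩
    · rw [run_ifLe]
      split_ifs
      exacts [h₁n v, h₂n v]
    · simp only [Cmd.exec, Cmd.size, Cmd.depth, add_mul]
      have e₃ := hone x.cost (max c₁.depth c₂.depth)
      have e₄ := hone y.cost (max c₁.depth c₂.depth)
      have e₅ := hone 1 (max c₁.depth c₂.depth)
      split_ifs <;> omega
  | loop v n c ih =>
    intro σ h
    have hn : n.eval σ ≤ env v + 1 := (NExp.eval_le_ub h n).trans hc.1
    have step : ∀ m ≤ n.eval σ,
        let p := (List.range m).foldl (fun p k =>
          let r := c.exec O (p.1.setNat v k)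
          (r.1, p.2 + r.2 + 1)) (σ, n.cost + 1)
        (∀ w, p.1.nat w ≤ env w) ∧ p.2 ≤ n.cost + 1 + m * (c.size * M ^ c.depth + 1) := by
      intro m
      induction m with
      | zero => exact fun _ => ⟨h, by simp⟩
      | succ m ihm =>
        intro hm
        obtain ⟨hw, ht⟩ := ihm (Nat.le_of_succ_le hm)
        rw [List.range_succ, List.foldl_append]
        simp only [List.foldl_cons, List.foldl_nil]
        set p := (List.range m).foldl (fun p k =>
          let r := c.exec O (p.1.setNat v k)
          (r.1, p.2 + r.2 + 1)) (σ, n.cost + 1)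
        have hp : ∀ w, (p.1.setNat v m).nat w ≤ env w := by
          intro w
          simp only [State.setNat]
          split_ifs with e
          · rw [e]; omega
          · exact hw w
        obtain ⟨h₁, h₂⟩ := ih hc.2 _ hp
        refine ⟨h₁, ?_⟩
        rw [Nat.succ_mul]
        omega
    obtain ⟨h₁, h₂⟩ := step _ le_rfl
    refine ⟨h₁, h₂.trans ?_⟩
    simp only [Cmd.size, Cmd.depth]
    have hnM : n.eval σ ≤ M := hn.trans (henv v)
    calc n.cost + 1 + n.eval σ * (c.size * M ^ c.depth + 1)
        ≤ (n.cost + 1) * M ^ (c.depth + 1) + M * (c.size * M ^ c.depth + M ^ c.depth) :=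
          add_le_add (hone _ _) (Nat.mul_le_mul hnM
            (Nat.add_le_add_left (Nat.one_le_pow _ _ hM) _))
      _ = (n.cost + 1 + (c.size + 1)) * M ^ (c.depth + 1) := by ring
  | query o a i b j =>
    intro σ h
    refine ⟨h, ?_⟩
    simp only [Cmd.exec, Cmd.size, Cmd.depth, pow_one]
    have := hO o (σ.point d a (i.eval σ))
    nlinarith

/-! ### Sums and assignments to rows -/

/-- Store `∑ k < n, e` in row `r` of the scratch array, where `k` is the variable `v`. -/
def sumCmd (r v : ℕ) (n : NExp) (e : RExp) : Cmd :=
  .seq (.setR 20 (.const r) (.const 0) (.ofNat (.const 0)))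
    (.loop v n (.setR 20 (.const r) (.const 0) (.add (.cell 20 (.const r) (.const 0)) e)))

/-- `hf` lets the state in which `e` is evaluated differ from `σ` only in the loop variable and in
the scratch array 20, where the partial sum lives. -/
lemma run_sumCmd {d : ℕ} (O : Oracles d) {r v : ℕ} {n : NExp} {e : RExp} {σ : State} (m : ℕ)
    (f : ℕ → ℝ) (hn : ∀ s : State, s.nat = σ.nat → n.eval s = m)
    (hf : ∀ k < m, ∀ s : State, (∀ w, w ≠ v → s.nat w = σ.nat w) → s.nat v = k →
      (∀ a, a ≠ 20 → s.arr a = σ.arr a) → e.eval s = f k) :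
    ((sumCmd r v n e).run O σ).arr = (σ.setArr 20 r 0 (∑ k ∈ Finset.range m, f k)).arr := by
  have hn' := hn ((Cmd.setR 20 (.const r) (.const 0) (.ofNat (.const 0))).run O σ) rfl
  have key := run_loop_induct O (v := v) (n := n)
    (c := .setR 20 (.const r) (.const 0) (.add (.cell 20 (.const r) (.const 0)) e))
    (σ := (Cmd.setR 20 (.const r) (.const 0) (.ofNat (.const 0))).run O σ)
    (fun k s => (∀ w, w ≠ v → s.nat w = σ.nat w) ∧
      s.arr = (σ.setArr 20 r 0 (∑ k ∈ Finset.range k, f k)).arr)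
    ⟨fun w _ => rfl, by simp [RExp.eval, NExp.eval, State.setArr]⟩ ?_
  · rw [hn'] at key
    exact key.2
  · rw [hn']
    rintro k hk s ⟨h₁, h₂⟩
    have he := hf k hk (s.setNat v k) (fun w hw => by simp [State.setNat, hw, h₁])
      (by simp [State.setNat]) (fun a ha => by
        ext i j
        simp [State.setNat, h₂, State.setArr, ha])
    refine ⟨fun w hw => by simp [State.setArr, State.setNat, hw, h₁], ?_⟩
    ext a i j
    simp only [run_setR, RExp.eval, NExp.eval, he, Finset.sum_range_succ]
    simp only [State.setArr, State.setNat, h₂]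
    split_ifs <;> simp_all

/-- Assign `e` to the entries of row `i` of the array `a`; the column is the variable `v < n`. -/
def rowCmd (v : ℕ) (n : NExp) (a : ℕ) (i : NExp) (e : RExp) : Cmd :=
  .loop v n (.setR a i (.var v) e)

/-- When column `k` is written, the columns from `k` on still hold their old values; the condition
`k ≤ j'` records this, so that `e` may read the very entry it overwrites. In-place updates depend on
it. -/
lemma run_rowCmd {d : ℕ} (O : Oracles d) {v a : ℕ} {n i : NExp} {e : RExp} {σ : State} (m i₀ : ℕ)
    (f : ℕ → ℝ) (hn : n.eval σ = m)
    (hi : ∀ s : State, (∀ w, w ≠ v → s.nat w = σ.nat w) → i.eval s = i₀)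
    (hf : ∀ k < m, ∀ s : State, (∀ w, w ≠ v → s.nat w = σ.nat w) → s.nat v = k →
      (∀ a' i' j', (a' ≠ a ∨ i' ≠ i₀ ∨ k ≤ j') → s.arr a' i' j' = σ.arr a' i' j') →
        e.eval s = f k) :
    ((rowCmd v n a i e).run O σ).arr =
      fun a' i' j' => if a' = a ∧ i' = i₀ ∧ j' < m then f j' else σ.arr a' i' j' := by
  have key := run_loop_induct O (v := v) (n := n) (c := .setR a i (.var v) e) (σ := σ)
    (fun k s => (∀ w, w ≠ v → s.nat w = σ.nat w) ∧
      s.arr = fun a' i' j' => if a' = a ∧ i' = i₀ ∧ j' < k then f j' else σ.arr a' i' j')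
    ⟨fun w _ => rfl, by simp⟩ ?_
  · rw [hn] at key
    exact key.2
  · rw [hn]
    rintro k hk s ⟨h₁, h₂⟩
    have hn₁ : ∀ w, w ≠ v → (s.setNat v k).nat w = σ.nat w := fun w hw => by
      simp [State.setNat, hw, h₁]
    have he := hf k hk (s.setNat v k) hn₁
      (by simp [State.setNat]) (fun a' i' j' h => by
        simp only [State.setNat, h₂]
        rw [if_neg]
        rintro ⟨rfl, rfl, h'⟩
        simp at h
        omega)
    refine ⟨fun w hw => by simp [State.setArr, State.setNat, hw, h₁], ?_⟩
    ext a' i' j'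
    simp only [run_setR, NExp.eval, he, hi _ hn₁]
    simp only [State.setArr, State.setNat, h₂, if_true]
    by_cases ha : a' = a <;> by_cases hi' : i' = i₀ <;> simp [ha, hi']
    by_cases hj : j' = k
    · simp [hj]
    · have : j' ≤ k ↔ j' < k := by omega
      simp [hj, this]

/-! ### Gram–Schmidt orthogonalization -/

/-- The inner product of the first `m` entries. -/
def dot (m : ℕ) (u v : ℕ → ℝ) : ℝ := ∑ k ∈ Finset.range m, u k * v k

lemma dot_comm (m : ℕ) (u v : ℕ → ℝ) : dot m u v = dot m v u := by
  simp only [dot, mul_comm]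

lemma dot_congr {m : ℕ} {u u' : ℕ → ℝ} (v : ℕ → ℝ) (h : ∀ k < m, u k = u' k) :
    dot m u v = dot m u' v :=
  Finset.sum_congr rfl fun k hk => by rw [h k (Finset.mem_range.1 hk)]

lemma dot_sub_mul (m : ℕ) (c : ℝ) (u w v : ℕ → ℝ) :
    dot m (fun k => u k - c * w k) v = dot m u v - c * dot m w v := by
  simp only [dot, Finset.mul_sum, ← Finset.sum_sub_distrib]
  exact Finset.sum_congr rfl fun _ _ => by ring

lemma dot_eq_zero_of_self {m : ℕ} {u : ℕ → ℝ} (h : dot m u u = 0) (v : ℕ → ℝ) : dot m u v = 0 := by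
  refine Finset.sum_eq_zero fun k hk => ?_
  have := (Finset.sum_eq_zero_iff_of_nonneg fun k _ => mul_self_nonneg (u k)).1 h k hk
  rw [mul_self_eq_zero.1 this, zero_mul]

/-- For a null row `w` the quotient is 0 by the convention for division, and the inner product
vanishes as well. This is why Gram–Schmidt here needs no pivoting and no test for dependent rows. -/
lemma dot_sub_proj {m : ℕ} (u w : ℕ → ℝ) : dot m u w - dot m u w / dot m w w * dot m w w = 0 := by
  by_cases h : dot m w w = 0
  · rw [dot_comm m u w, dot_eq_zero_of_self h]; simp
  · field_simp
    ring

/-- `W j` is the component of `V j` orthogonal to `V 0, …, V (j - 1)`. -/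
def IsOrthPart (m : ℕ) (V W : ℕ → ℕ → ℝ) (j : ℕ) : Prop :=
  (∀ i < j, dot m (W j) (V i) = 0) ∧
    ∀ κ : ℕ → ℝ, (∀ i < j, dot m (V i) κ = 0) → dot m (W j) κ = dot m (V j) κ

/-- `IsOrthPart` expresses "congruent to `V j` modulo the earlier rows" by pairing with vectors
orthogonal to those rows, instead of by spans. By strong induction, old and new rows then have the
same orthogonal complement. -/
lemma dot_eq_zero_iff_of_isOrthPart {m j : ℕ} {V W : ℕ → ℕ → ℝ} (h : ∀ i < j, IsOrthPart m V W i)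
    (κ : ℕ → ℝ) : (∀ i < j, dot m (W i) κ = 0) ↔ ∀ i < j, dot m (V i) κ = 0 := by
  constructor
  · intro hκ i
    induction i using Nat.strong_induction_on with
    | _ i ih =>
      intro hi
      rw [← (h i hi).2 κ fun i' hi' => ih i' hi' (hi'.trans hi)]
      exact hκ i hi
  · intro hκ i hi
    rw [(h i hi).2 κ fun i' hi' => hκ i' (hi'.trans hi)]
    exact hκ i hi

lemma dot_eq_zero_of_isOrthPart {m i j : ℕ} {V W : ℕ → ℕ → ℝ} (hi : IsOrthPart m V W i)
    (hj : IsOrthPart m V W j) (hij : i < j) : dot m (W i) (W j) = 0 := by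
  rw [hi.2 (W j) fun i' hi' => by rw [dot_comm]; exact hj.1 i' (hi'.trans hij), dot_comm]
  exact hj.1 i hij

/-- Subtract from row `j` (variable 2) of array 7 its projection to row `i` (variable 3). -/
def orthStep (m : NExp) : Cmd :=
  .seq (sumCmd 0 4 m (.mul (.cell 7 (.var 2) (.var 4)) (.cell 7 (.var 3) (.var 4))))
    (.seq (sumCmd 1 4 m (.mul (.cell 7 (.var 3) (.var 4)) (.cell 7 (.var 3) (.var 4))))
      (rowCmd 4 m 7 (.var 2) (.sub (.cell 7 (.var 2) (.var 4))
        (.mul (.div (.cell 20 (.const 0) (.const 0)) (.cell 20 (.const 1) (.const 0)))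
          (.cell 7 (.var 3) (.var 4))))))

/-- Gram–Schmidt orthogonalization, in place, of the first `R` rows of array 7, of length `m`. -/
def orthCmd (R m : NExp) : Cmd := .loop 2 R (.loop 3 (.var 2) (orthStep m))

/-- An index expression that depends only on `d` and `N`, with its value. -/
def NExp.IsConst (e : NExp) (σ : State) (k : ℕ) : Prop :=
  ∀ s : State, s.nat 0 = σ.nat 0 → s.nat 1 = σ.nat 1 → e.eval s = k

lemma run_orthStep {d : ℕ} (O : Oracles d) {m : NExp} {M i j : ℕ} {σ : State}
    (hm : m.IsConst σ M) (hj : σ.nat 2 = j) (hi : σ.nat 3 = i) :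
    let c := dot M (σ.arr 7 j) (σ.arr 7 i) / dot M (σ.arr 7 i) (σ.arr 7 i)
    ((orthStep m).run O σ).arr 7 = fun i' k => if i' = j ∧ k < M then
      σ.arr 7 j k - c * σ.arr 7 i k else σ.arr 7 i' k := by
  intro c
  simp only [orthStep, run_seq]
  set σ₁ := (sumCmd 0 4 m (.mul (.cell 7 (.var 2) (.var 4)) (.cell 7 (.var 3) (.var 4)))).run O σ
    with hσ₁
  have a₁ : σ₁.arr = (σ.setArr 20 0 0 (dot M (σ.arr 7 j) (σ.arr 7 i))).arr := by
    refine run_sumCmd O M _ (fun s hs => hm s (by rw [hs]) (by rw [hs])) fun k _ s h₁ h₂ h₃ => ?_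
    simp [RExp.eval, NExp.eval, h₁, h₂, h₃, hi, hj]
  have n₁ : ∀ w, w ≠ 4 → σ₁.nat w = σ.nat w := fun w hw =>
    Cmd.run_nat_of_not_writes O w _ _ (by simp [sumCmd, Cmd.writesN, hw.symm])
  set σ₂ := (sumCmd 1 4 m (.mul (.cell 7 (.var 3) (.var 4)) (.cell 7 (.var 3) (.var 4)))).run O σ₁
    with hσ₂
  have a₂ : σ₂.arr = (σ₁.setArr 20 1 0 (dot M (σ.arr 7 i) (σ.arr 7 i))).arr := by
    refine run_sumCmd O M _ (fun s hs => hm s (by rw [hs, n₁ 0 (by simp)])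
      (by rw [hs, n₁ 1 (by simp)])) fun k _ s h₁ h₂ h₃ => ?_
    simp [RExp.eval, NExp.eval, h₁, h₂, h₃, n₁, hi, a₁, State.setArr]
  have n₂ : ∀ w, w ≠ 4 → σ₂.nat w = σ.nat w := fun w hw =>
    (Cmd.run_nat_of_not_writes O w _ _ (by simp [sumCmd, Cmd.writesN, hw.symm])).trans (n₁ w hw)
  have a₃ := run_rowCmd O (v := 4) (a := 7) (n := m) (i := .var 2)
    (e := .sub (.cell 7 (.var 2) (.var 4))
        (.mul (.div (.cell 20 (.const 0) (.const 0)) (.cell 20 (.const 1) (.const 0)))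
          (.cell 7 (.var 3) (.var 4)))) (σ := σ₂) M j
    (fun k => σ.arr 7 j k - c * σ.arr 7 i k) (hm _ (n₂ 0 (by simp)) (n₂ 1 (by simp)))
    (fun s hs => by simp [NExp.eval, hs, n₂, hj]) ?_
  · rw [a₃]
    ext i' k
    simp [a₂, a₁, State.setArr]
  · intro k hk s h₁ h₂ h₃
    simp only [RExp.eval, NExp.eval, h₂, h₁ 2 (by simp), h₁ 3 (by simp), n₂ 2 (by simp),
      n₂ 3 (by simp), hi, hj]
    rw [h₃ 7 j k (by simp), h₃ 20 0 0 (by simp), h₃ 20 1 0 (by simp), h₃ 7 i k (by simp)]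
    simp [a₂, a₁, State.setArr, c]

/-- Modified Gram–Schmidt: the coefficient comes from the partially reduced row. The earlier rows
are already mutually orthogonal, so removing the component along one of them preserves orthogonality
to those treated before. -/
lemma run_orthRow {d : ℕ} (O : Oracles d) {m : NExp} {M j : ℕ} {σ : State}
    (hm : m.IsConst σ M) (hj : σ.nat 2 = j)
    (ho : ∀ i' < j, ∀ i < i', dot M (σ.arr 7 i) (σ.arr 7 i') = 0) :
    let σ' := (Cmd.loop 3 (.var 2) (orthStep m)).run O σ
    (∀ i, i ≠ j → σ'.arr 7 i = σ.arr 7 i) ∧ (∀ i < j, dot M (σ'.arr 7 j) (σ.arr 7 i) = 0) ∧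
      ∀ κ : ℕ → ℝ, (∀ i < j, dot M (σ.arr 7 i) κ = 0) →
        dot M (σ'.arr 7 j) κ = dot M (σ.arr 7 j) κ := by
  have key := run_loop_induct O (v := 3) (n := .var 2) (c := orthStep m) (σ := σ)
    (fun k s => (∀ w, w ≠ 3 → w ≠ 4 → s.nat w = σ.nat w) ∧ (∀ i, i ≠ j → s.arr 7 i = σ.arr 7 i) ∧
      (∀ i < k, dot M (s.arr 7 j) (σ.arr 7 i) = 0) ∧
      ∀ κ : ℕ → ℝ, (∀ i < k, dot M (σ.arr 7 i) κ = 0) →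
        dot M (s.arr 7 j) κ = dot M (σ.arr 7 j) κ)
    ⟨fun _ _ _ => rfl, fun _ _ => rfl, by simp, fun _ _ => rfl⟩ ?_
  · simp only [NExp.eval, hj] at key
    exact key.2
  · simp only [NExp.eval, hj]
    rintro k hk s ⟨h₁, h₂, h₃, h₄⟩
    have n₁ : ∀ w, w ≠ 3 → w ≠ 4 → (s.setNat 3 k).nat w = σ.nat w := fun w hw hw' => by
      simp [State.setNat, hw, h₁ w hw hw']
    have hm' : m.IsConst (s.setNat 3 k) M := fun s' h h' =>
      hm s' (h.trans (n₁ 0 (by simp) (by simp))) (h'.trans (n₁ 1 (by simp) (by simp)))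
    have st := run_orthStep O hm' ((n₁ 2 (by simp) (by simp)).trans hj)
      (show (s.setNat 3 k).nat 3 = k by simp [State.setNat])
    simp only [show (s.setNat 3 k).arr = s.arr from rfl, h₂ k hk.ne] at st
    set c := dot M (s.arr 7 j) (σ.arr 7 k) / dot M (σ.arr 7 k) (σ.arr 7 k) with hc
    have hd : ∀ κ, dot M (((orthStep m).run O (s.setNat 3 k)).arr 7 j) κ =
        dot M (s.arr 7 j) κ - c * dot M (σ.arr 7 k) κ := by
      intro κ
      rw [← dot_sub_mul]
      refine dot_congr _ fun k' hk' => ?_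
      simp [st, hk']
    refine ⟨fun w hw hw' => ?_, fun i hi => ?_, fun i hi => ?_, fun κ hκ => ?_⟩
    · rw [Cmd.run_nat_of_not_writes O w _ _ (by
        simp [orthStep, sumCmd, rowCmd, Cmd.writesN, hw'.symm]), n₁ w hw hw']
    · ext k'
      simp [st, hi, h₂ i hi]
    · rw [hd]
      rcases Nat.lt_succ_iff_lt_or_eq.1 hi with hi | rfl
      · rw [h₃ i hi, dot_comm, ho k hk i hi, mul_zero, sub_zero]
      · exact dot_sub_proj _ _
    · rw [hd, hκ k (Nat.lt_succ_self k), mul_zero, sub_zero]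
      exact h₄ κ fun i hi => hκ i (hi.trans (Nat.lt_succ_self k))

lemma run_orthCmd {d : ℕ} (O : Oracles d) {R m : NExp} {M r : ℕ} {σ : State}
    (hR : R.eval σ = r + 1) (hm : m.IsConst σ M) :
    IsOrthPart M (σ.arr 7) (((orthCmd R m).run O σ).arr 7) r := by
  have key := run_loop_induct O (v := 2) (n := R) (c := .loop 3 (.var 2) (orthStep m)) (σ := σ)
    (fun k s => (∀ w < 2, s.nat w = σ.nat w) ∧
      (∀ i, k ≤ i → s.arr 7 i = σ.arr 7 i) ∧ ∀ i < k, IsOrthPart M (σ.arr 7) (s.arr 7) i)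
    ⟨fun _ _ => rfl, fun _ _ => rfl, by simp⟩ ?_
  · rw [hR] at key
    exact key.2.2 r (Nat.lt_succ_self r)
  · rintro k - s ⟨h₁, h₂, h₃⟩
    have n₁ : ∀ w < 2, (s.setNat 2 k).nat w = σ.nat w := fun w hw => by
      simp [State.setNat, hw.ne, h₁ w hw]
    have hm' : m.IsConst (s.setNat 2 k) M := fun s' h h' =>
      hm s' (h.trans (n₁ 0 (by simp))) (h'.trans (n₁ 1 (by simp)))
    obtain ⟨r₁, r₂, r₃⟩ := run_orthRow O hm' (show (s.setNat 2 k).nat 2 = k by simp [State.setNat])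
      (fun i' hi' i hi => dot_eq_zero_of_isOrthPart (h₃ i (hi.trans hi')) (h₃ i' hi') hi)
    simp only [show (s.setNat 2 k).arr = s.arr from rfl] at r₁ r₂ r₃
    refine ⟨fun w hw => ?_, fun i hi => ?_, fun i hi => ?_⟩
    · rw [Cmd.run_nat_of_not_writes O w _ _ (by
        simp [orthStep, sumCmd, rowCmd, Cmd.writesN]; omega), n₁ w hw]
    · rw [r₁ i (by omega), h₂ i (by omega)]
    · rcases Nat.lt_succ_iff_lt_or_eq.1 hi with hi | rfl
      · have := h₃ i hi
        simpa only [IsOrthPart, r₁ i hi.ne] using this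
      · refine ⟨fun i' hi' => ?_, fun κ hκ => ?_⟩
        · rw [dot_comm]
          refine (dot_eq_zero_iff_of_isOrthPart h₃ _).1 (fun i'' hi'' => ?_) i' hi'
          rw [dot_comm]
          exact r₂ i'' hi''
        · rw [r₃ κ ((dot_eq_zero_iff_of_isOrthPart h₃ κ).2 hκ), h₂ _ le_rfl]

/-! ### Stationary distributions -/

/-- The triangle inequality gives `|y| ≤ |y| Q` in every entry, and both sides have the same total
because the rows of `Q` sum to 1; so all these inequalities are equalities. -/
lemma vecMul_abs_of_vecMul_eq {N : ℕ} {Q : Matrix (Fin N) (Fin N) ℝ} (h0 : ∀ i j, 0 ≤ Q i j)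
    (h1 : ∀ i, ∑ j, Q i j = 1) {y : Fin N → ℝ} (hy : Matrix.vecMul y Q = y) :
    Matrix.vecMul (fun i => |y i|) Q = fun i => |y i| := by
  have hle : ∀ j ∈ Finset.univ, |y j| ≤ ∑ i, |y i| * Q i j := by
    intro j _
    calc |y j| = |∑ i, y i * Q i j| := by
          rw [← congrFun hy j]; rfl
      _ ≤ ∑ i, |y i * Q i j| := Finset.abs_sum_le_sum_abs _ _
      _ = ∑ i, |y i| * Q i j := by simp only [abs_mul, abs_of_nonneg (h0 _ _)]
  have hsum : ∑ j, |y j| = ∑ j, ∑ i, |y i| * Q i j := by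
    rw [Finset.sum_comm]
    simp only [← Finset.mul_sum, h1, mul_one]
  ext j
  exact ((Finset.sum_eq_sum_iff_of_le hle).1 hsum j (Finset.mem_univ j)).symm

/-- The all-ones vector is a right null vector of `Q - 1`, so this matrix is singular and has a left
null vector too. -/
lemma exists_vecMul_eq_of_stochastic {N : ℕ} (hN : 0 < N) {Q : Matrix (Fin N) (Fin N) ℝ}
    (h1 : ∀ i, ∑ j, Q i j = 1) : ∃ y : Fin N → ℝ, y ≠ 0 ∧ Matrix.vecMul y Q = y := by
  have hdet : (Q - 1).det = 0 := by
    refine Matrix.exists_mulVec_eq_zero_iff.1 ⟨fun _ => 1, ?_, ?_⟩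
    · intro h
      exact one_ne_zero (congrFun h ⟨0, hN⟩)
    · ext i
      rw [Matrix.sub_mulVec, Matrix.one_mulVec]
      simp [Matrix.mulVec, dotProduct, h1]
  obtain ⟨y, hy, h⟩ := Matrix.exists_vecMul_eq_zero_iff.2 hdet
  refine ⟨y, hy, ?_⟩
  rwa [Matrix.vecMul_sub, Matrix.vecMul_one, sub_eq_zero] at h

/-- Write the transpose of `Q - 1` to array 7, where `Q` is in array 6. -/
def transposeCmd : Cmd :=
  .loop 5 (.var 1) (.seq (rowCmd 4 (.var 1) 7 (.var 5) (.cell 6 (.var 4) (.var 5)))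
    (.setR 7 (.var 5) (.var 5) (.sub (.cell 7 (.var 5) (.var 5)) (.ofNat (.const 1)))))

/-- Write the absolute values of row `N` of array 7 to row 0 of array 3. -/
def absCmd : Cmd :=
  .loop 4 (.var 1) (.ifLe (.ofNat (.const 0)) (.cell 7 (.var 1) (.var 4))
    (.setR 3 (.const 0) (.var 4) (.cell 7 (.var 1) (.var 4)))
    (.setR 3 (.const 0) (.var 4) (.sub (.ofNat (.const 0)) (.cell 7 (.var 1) (.var 4)))))

/-- Write a stationary distribution of the stochastic matrix in array 6 to row 0 of array 3. -/
def statCmd : Cmd :=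
  .seq transposeCmd <| .seq (rowCmd 4 (.var 1) 7 (.var 1) (.ofNat (.const 1))) <|
  .seq (orthCmd (.add (.var 1) (.const 1)) (.var 1)) <| .seq absCmd <|
  .seq (sumCmd 0 4 (.var 1) (.cell 3 (.const 0) (.var 4)))
    (rowCmd 4 (.var 1) 3 (.const 0)
      (.div (.cell 3 (.const 0) (.var 4)) (.cell 20 (.const 0) (.const 0))))

lemma run_transposeCmd {d : ℕ} (O : Oracles d) {σ : State} {N : ℕ} (hN : σ.nat 1 = N) :
    ∀ j < N, ∀ i < N, (transposeCmd.run O σ).arr 7 j i =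
      σ.arr 6 i j - if i = j then 1 else 0 := by
  have key := run_loop_induct O (v := 5) (n := .var 1)
    (c := .seq (rowCmd 4 (.var 1) 7 (.var 5) (.cell 6 (.var 4) (.var 5)))
      (.setR 7 (.var 5) (.var 5) (.sub (.cell 7 (.var 5) (.var 5)) (.ofNat (.const 1)))))
    (σ := σ)
    (fun k s => s.nat 1 = N ∧ s.arr 6 = σ.arr 6 ∧
      ∀ j < k, ∀ i < N, s.arr 7 j i = σ.arr 6 i j - if i = j then 1 else 0)
    ⟨hN, rfl, by simp⟩ ?_
  · simp only [NExp.eval, hN] at key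
    exact key.2.2
  · rintro k - s ⟨h₁, h₂, h₃⟩
    have a₁ := run_rowCmd O (v := 4) (a := 7) (n := .var 1) (i := .var 5)
      (e := .cell 6 (.var 4) (.var 5)) (σ := s.setNat 5 k) N k (fun i => σ.arr 6 i k)
      (by simp [NExp.eval, State.setNat, h₁])
      (fun s hs => by simp [NExp.eval, hs, State.setNat]) (fun i _ s' e₁ e₂ e₃ => by
        simp only [RExp.eval, NExp.eval, e₂, e₁ 5 (by simp)]
        rw [e₃ _ _ _ (by simp)]
        simp [State.setNat, h₂])
    rw [run_seq]
    set s₁ := (rowCmd 4 (.var 1) 7 (.var 5) (.cell 6 (.var 4) (.var 5))).run O (s.setNat 5 k)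
      with hs₁
    have n₁ : ∀ w, w ≠ 4 → s₁.nat w = (s.setNat 5 k).nat w := fun w hw =>
      Cmd.run_nat_of_not_writes O w _ _ (by simp [rowCmd, Cmd.writesN, hw.symm])
    have n5 : s₁.nat 5 = k := by rw [n₁ 5 (by simp)]; simp [State.setNat]
    refine ⟨?_, ?_, fun j hj i hi => ?_⟩
    · simp [State.setArr, n₁ 1, State.setNat, h₁]
    · ext i j
      simp [State.setArr, a₁, State.setNat, h₂]
    · simp only [run_setR, NExp.eval, RExp.eval, n5, State.setArr, a₁]
      rcases Nat.lt_succ_iff_lt_or_eq.1 hj with hj | rfl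
      · simp [hj.ne, State.setNat, h₃ j hj i hi]
      · by_cases hij : i = j
        · subst hij
          simp [hi]
        · simp [hij, hi]

lemma run_absCmd {d : ℕ} (O : Oracles d) {σ : State} {N : ℕ} (hN : σ.nat 1 = N) :
    ∀ i < N, (absCmd.run O σ).arr 3 0 i = |σ.arr 7 N i| := by
  have key := run_loop_induct O (v := 4) (n := .var 1)
    (c := .ifLe (.ofNat (.const 0)) (.cell 7 (.var 1) (.var 4))
      (.setR 3 (.const 0) (.var 4) (.cell 7 (.var 1) (.var 4)))
      (.setR 3 (.const 0) (.var 4) (.sub (.ofNat (.const 0)) (.cell 7 (.var 1) (.var 4)))))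
    (σ := σ)
    (fun k s => s.nat 1 = N ∧ s.arr 7 = σ.arr 7 ∧ ∀ i < k, s.arr 3 0 i = |σ.arr 7 N i|)
    ⟨hN, rfl, by simp⟩ ?_
  · simp only [NExp.eval, hN] at key
    exact key.2.2
  · rintro k - s ⟨h₁, h₂, h₃⟩
    refine ⟨?_, ?_, fun i hi => ?_⟩
    · rw [Cmd.run_nat_of_not_writes O 1 _ _ rfl]
      simpa [State.setNat] using h₁
    · rw [Cmd.run_arr_of_not_writes O 7 _ _ rfl, ← h₂]
      rfl
    · rw [run_ifLe]
      have e₁ : (s.setNat 4 k).nat 1 = N := h₁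
      have e₂ : (s.setNat 4 k).nat 4 = k := rfl
      have e₃ : (s.setNat 4 k).arr = s.arr := rfl
      simp only [run_setR, NExp.eval, RExp.eval, e₁, e₂, e₃, h₂, Nat.cast_zero, zero_sub]
      rcases Nat.lt_succ_iff_lt_or_eq.1 hi with hi | rfl
      · split_ifs <;> simp [State.setArr, e₃, hi.ne, h₃ i hi]
      · split_ifs with hs
        · simp [State.setArr, abs_of_nonneg hs]
        · simp [State.setArr, abs_of_neg (not_le.1 hs)]

/-- The columns of `Q - 1` followed by the all-ones vector are orthogonalized; the last row becomes
the projection `y` of the all-ones vector to the left kernel of `Q - 1`. It is nonzero: pairing it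
with `|z|`, for a nonzero fixed vector `z`, gives the same as pairing the all-ones vector with
`|z|`, which is positive. Normalizing `|y|` gives a stationary distribution. -/
lemma run_statCmd {d : ℕ} (O : Oracles d) {σ : State} {N : ℕ} (hN : σ.nat 1 = N) (hpos : 0 < N)
    {Q : Matrix (Fin N) (Fin N) ℝ} (hQ : ∀ i j : Fin N, σ.arr 6 i j = Q i j)
    (h0 : ∀ i j, 0 ≤ Q i j) (h1 : ∀ i, ∑ j, Q i j = 1) :
    IsStationary Q fun i => (statCmd.run O σ).arr 3 0 i := by
  simp only [statCmd, run_seq]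
  set σ₁ := transposeCmd.run O σ with hσ₁
  have a₁ := run_transposeCmd O hN
  rw [← hσ₁] at a₁
  have n₁ : σ₁.nat 1 = N := (Cmd.run_nat_of_not_writes O 1 _ _ rfl).trans hN
  set σ₂ := (rowCmd 4 (.var 1) 7 (.var 1) (.ofNat (.const 1))).run O σ₁ with hσ₂
  have n₂ : σ₂.nat 1 = N := (Cmd.run_nat_of_not_writes O 1 _ _ rfl).trans n₁
  have a₂ : σ₂.arr = _ := run_rowCmd O N N (fun _ => 1) n₁
    (fun s hs => by simp [NExp.eval, hs, n₁]) (fun i _ s' e₁ e₂ e₃ => by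
      simp [RExp.eval, NExp.eval])
  have r₂ : ∀ j < N, ∀ i < N, σ₂.arr 7 j i = σ.arr 6 i j - if i = j then 1 else 0 := by
    intro j hj i hi
    rw [a₂, ← a₁ j hj i hi]
    simp [hj.ne]
  have r₂' : ∀ i < N, σ₂.arr 7 N i = 1 := by
    intro i hi
    rw [a₂]
    simp [hi]
  set σ₃ := (orthCmd (.add (.var 1) (.const 1)) (.var 1)).run O σ₂ with hσ₃
  have n₃ : σ₃.nat 1 = N := (Cmd.run_nat_of_not_writes O 1 _ _ rfl).trans n₂
  obtain ⟨o₁, o₂⟩ : IsOrthPart N (σ₂.arr 7) (σ₃.arr 7) N :=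
    run_orthCmd O (by simp [NExp.eval, n₂]) (fun s _ hs => by simp [NExp.eval, hs, n₂])
  set y : Fin N → ℝ := fun i => σ₃.arr 7 N i with hy
  have hyQ : Matrix.vecMul y Q = y := by
    ext j
    have := o₁ j j.2
    rw [dot, Finset.sum_range] at this
    simp only [r₂ j j.2 _ (Fin.is_lt _), hQ, mul_sub, Finset.sum_sub_distrib] at this
    simp only [← Fin.ext_iff, mul_ite, mul_one, mul_zero, Finset.sum_ite_eq', Finset.mem_univ,
      if_true] at this
    exact sub_eq_zero.1 this
  have habs := vecMul_abs_of_vecMul_eq h0 h1 hyQ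
  have hpos' : 0 < ∑ i, |y i| := by
    obtain ⟨z, hz, hzQ⟩ := exists_vecMul_eq_of_stochastic hpos h1
    have hz' := vecMul_abs_of_vecMul_eq h0 h1 hzQ
    have hs : 0 < ∑ i, |z i| := by
      obtain ⟨i, hi⟩ := Function.ne_iff.1 hz
      exact Finset.sum_pos' (fun _ _ => abs_nonneg _) ⟨i, Finset.mem_univ i, abs_pos.2 hi⟩
    have ho := o₂ (fun i => if h : i < N then |z ⟨i, h⟩| else 0) ?_
    · rw [dot, dot, Finset.sum_range, Finset.sum_range] at ho
      simp only [Fin.is_lt, dif_pos, r₂' _ (Fin.is_lt _), one_mul, Fin.eta] at ho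
      refine (Finset.sum_nonneg fun _ _ => abs_nonneg _).lt_of_ne fun h => ?_
      have hy0 : ∀ i, y i = 0 := fun i => abs_eq_zero.1
        ((Finset.sum_eq_zero_iff_of_nonneg fun _ _ => abs_nonneg _).1 h.symm i (Finset.mem_univ i))
      rw [← ho, Finset.sum_eq_zero fun i _ => by rw [show σ₃.arr 7 N i = 0 from hy0 i, zero_mul]]
        at hs
      exact hs.false
    · intro j hj
      rw [dot, Finset.sum_range]
      have := congrFun hz' ⟨j, hj⟩
      simp only [Fin.is_lt, dif_pos, r₂ j hj _ (Fin.is_lt _), Fin.eta, sub_mul,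
        Finset.sum_sub_distrib]
      have hQ' : ∀ i : Fin N, σ.arr 6 i j = Q i ⟨j, hj⟩ := fun i => hQ i ⟨j, hj⟩
      have hij : ∀ i : Fin N, (i : ℕ) = j ↔ i = ⟨j, hj⟩ := fun i => by rw [Fin.ext_iff]
      simp only [hQ', hij, ite_mul, one_mul, zero_mul, Finset.sum_ite_eq', Finset.mem_univ,
        if_true]
      rw [sub_eq_zero, ← this]
      simp [Matrix.vecMul, dotProduct, mul_comm]
  set σ₄ := absCmd.run O σ₃ with hσ₄
  have n₄ : σ₄.nat 1 = N := (Cmd.run_nat_of_not_writes O 1 _ _ rfl).trans n₃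
  have a₄ : ∀ i : Fin N, σ₄.arr 3 0 i = |y i| := fun i => run_absCmd O n₃ i i.2
  set σ₅ := (sumCmd 0 4 (.var 1) (.cell 3 (.const 0) (.var 4))).run O σ₄ with hσ₅
  have n₅ : σ₅.nat 1 = N := (Cmd.run_nat_of_not_writes O 1 _ _ rfl).trans n₄
  have a₅ : σ₅.arr = (σ₄.setArr 20 0 0 (∑ i, |y i|)).arr := by
    simp only [← a₄]
    rw [← Finset.sum_range fun i => σ₄.arr 3 0 i]
    refine run_sumCmd O N _ (fun s hs => by simp [NExp.eval, hs, n₄]) fun k _ s _ e₂ e₃ => ?_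
    simp [RExp.eval, NExp.eval, e₂, e₃]
  have a₆ := run_rowCmd O (v := 4) (a := 3) (n := .var 1) (i := .const 0)
    (e := .div (.cell 3 (.const 0) (.var 4)) (.cell 20 (.const 0) (.const 0))) (σ := σ₅) N 0
    (fun i => σ₄.arr 3 0 i / ∑ i, |y i|) n₅ (fun _ _ => rfl) (fun k _ s _ e₂ e₃ => by
      simp only [RExp.eval, NExp.eval, e₂]
      rw [e₃ _ _ _ (by simp), e₃ _ _ _ (by simp), a₅]
      simp [State.setArr])
  have hx : (fun i : Fin N => ((rowCmd 4 (.var 1) 3 (.const 0)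
      (.div (.cell 3 (.const 0) (.var 4)) (.cell 20 (.const 0) (.const 0)))).run O σ₅).arr 3 0 i) =
      (∑ i, |y i|)⁻¹ • fun i => |y i| := by
    ext i
    rw [a₆]
    simp [a₄, div_eq_inv_mul]
  rw [hx]
  refine ⟨⟨fun i => mul_nonneg (inv_nonneg.2 hpos'.le) (abs_nonneg _), ?_⟩, ?_⟩
  · simp only [Pi.smul_apply, smul_eq_mul, ← Finset.mul_sum]
    exact inv_mul_cancel₀ hpos'.ne'
  · rw [Matrix.smul_vecMul, habs]

/-! ### Programs for the rows of the transition matrix -/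

/-- A loop over the rows `s < N` whose body changes, in the arrays `b` with `B b`, only
row `s`. -/
lemma run_rows {d : ℕ} (O : Oracles d) {c : Cmd} {σ : State} {N : ℕ} (hN : σ.nat 1 = N)
    (B : ℕ → Prop) (P : ℕ → ℕ → (ℕ → ℝ) → Prop) (h0 : c.writesN 0 = false)
    (h1 : c.writesN 1 = false)
    (hc : ∀ s < N, ∀ τ : State, τ.nat 0 = σ.nat 0 → τ.nat 1 = N → τ.nat 6 = s →
      (∀ a, c.writesA a = false → τ.arr a = σ.arr a) → (∀ b, B b → τ.arr b s = σ.arr b s) →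
      ∀ b, B b → P s b ((c.run O τ).arr b s) ∧ ∀ s', s' ≠ s → (c.run O τ).arr b s' = τ.arr b s') :
    ∀ s < N, ∀ b, B b → P s b (((Cmd.loop 6 (.var 1) c).run O σ).arr b s) := by
  have key := run_loop_induct O (v := 6) (n := .var 1) (c := c) (σ := σ)
    (fun k s => s.nat 0 = σ.nat 0 ∧ s.nat 1 = N ∧
      (∀ a, c.writesA a = false → s.arr a = σ.arr a) ∧
      ∀ b, B b → (∀ i, k ≤ i → s.arr b i = σ.arr b i) ∧ ∀ i < k, P i b (s.arr b i))
    ⟨rfl, hN, fun _ _ => rfl, fun _ _ => ⟨fun _ _ => rfl, by simp⟩⟩ ?_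
  · simp only [NExp.eval, hN] at key
    exact fun s hs b hb => (key.2.2.2 b hb).2 s hs
  · simp only [NExp.eval, hN]
    rintro k hk s ⟨g₀, g₁, g₂, g₃⟩
    have := hc k hk (s.setNat 6 k) (by simpa [State.setNat]) (by simpa [State.setNat])
      (by simp [State.setNat]) g₂ (fun b hb => (g₃ b hb).1 k le_rfl)
    refine ⟨?_, ?_, fun a ha => ?_, fun b hb => ⟨fun i hi => ?_, fun i hi => ?_⟩⟩
    · rw [Cmd.run_nat_of_not_writes O _ _ _ h0]; simpa [State.setNat]
    · rw [Cmd.run_nat_of_not_writes O _ _ _ h1]; simpa [State.setNat]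
    · rw [Cmd.run_arr_of_not_writes O _ _ _ ha]; exact g₂ a ha
    · rw [(this b hb).2 i (by omega)]; exact (g₃ b hb).1 i (by omega)
    · rcases Nat.lt_succ_iff_lt_or_eq.1 hi with hi | rfl
      · rw [(this b hb).2 i hi.ne]; exact (g₃ b hb).2 i hi
      · exact (this b hb).1

/-- Multiplicative weights of the copy number 6 (as a variable), from the cumulative losses in
array 4. -/
def expRow : Cmd :=
  .seq (rowCmd 4 (.var 1) 6 (.var 6)
    (.exp (.sub (.ofNat (.const 0)) (.mul (.cell 2 (.const 0) (.const 0))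
      (.cell 4 (.var 6) (.var 4)))))) <|
  .seq (sumCmd 0 4 (.var 1) (.cell 6 (.var 6) (.var 4)))
    (rowCmd 4 (.var 1) 6 (.var 6)
      (.div (.cell 6 (.var 6) (.var 4)) (.cell 20 (.const 0) (.const 0))))

lemma run_expRow {d : ℕ} (O : Oracles d) {σ : State} {N s : ℕ} (hN : σ.nat 1 = N)
    (hs : σ.nat 6 = s) :
    (expRow.run O σ).arr 6 = fun i j => if i = s ∧ j < N then
      Real.exp (-σ.arr 2 0 0 * σ.arr 4 s j) /
        ∑ k ∈ Finset.range N, Real.exp (-σ.arr 2 0 0 * σ.arr 4 s k)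
      else σ.arr 6 i j := by
  simp only [expRow, run_seq]
  set σ₁ := (rowCmd 4 (.var 1) 6 (.var 6)
    (.exp (.sub (.ofNat (.const 0)) (.mul (.cell 2 (.const 0) (.const 0))
      (.cell 4 (.var 6) (.var 4)))))).run O σ with hσ₁
  have a₁ : σ₁.arr = _ := run_rowCmd O N s (fun j => Real.exp (-σ.arr 2 0 0 * σ.arr 4 s j))
    hN (fun τ hτ => by simp [NExp.eval, hτ, hs]) (fun k _ τ e₁ e₂ e₃ => by
      simp only [RExp.eval, NExp.eval, e₂, e₁ 6 (by simp), hs]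
      rw [e₃ _ _ _ (by simp), e₃ _ _ _ (by simp)]
      simp)
  have n₁ : ∀ w, w ≠ 4 → σ₁.nat w = σ.nat w := fun w hw =>
    Cmd.run_nat_of_not_writes O w _ _ (by simp [rowCmd, Cmd.writesN, hw.symm])
  set σ₂ := (sumCmd 0 4 (.var 1) (.cell 6 (.var 6) (.var 4))).run O σ₁ with hσ₂
  have n₂ : ∀ w, w ≠ 4 → σ₂.nat w = σ.nat w := fun w hw =>
    (Cmd.run_nat_of_not_writes O w _ _ (by simp [sumCmd, Cmd.writesN, hw.symm])).trans (n₁ w hw)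
  have a₂ : σ₂.arr = _ := run_sumCmd O N (fun k => Real.exp (-σ.arr 2 0 0 * σ.arr 4 s k))
    (fun τ hτ => by simp [NExp.eval, hτ, n₁, hN]) (fun k hk τ e₁ e₂ e₃ => by
      simp only [RExp.eval, NExp.eval, e₂, e₁ 6 (by simp), n₁ 6 (by simp), hs, e₃ 6 (by simp), a₁]
      simp [hk])
  have a₃ := run_rowCmd O (v := 4) (a := 6) (n := .var 1) (i := .var 6)
    (e := .div (.cell 6 (.var 6) (.var 4)) (.cell 20 (.const 0) (.const 0))) (σ := σ₂) N s
    (fun j => Real.exp (-σ.arr 2 0 0 * σ.arr 4 s j) /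
        ∑ k ∈ Finset.range N, Real.exp (-σ.arr 2 0 0 * σ.arr 4 s k))
    (by simp [NExp.eval, n₂, hN]) (fun τ hτ => by simp [NExp.eval, hτ, n₂, hs])
    (fun k hk τ e₁ e₂ e₃ => by
      simp only [RExp.eval, NExp.eval, e₂, e₁ 6 (by simp), n₂ 6 (by simp), hs]
      rw [e₃ _ _ _ (by simp), e₃ _ _ _ (by simp), a₂]
      simp [State.setArr, a₁, hk])
  rw [a₃]
  ext i j
  by_cases h : i = s ∧ j < N
  · simp [h]
  · simp [h, a₂, State.setArr, a₁]

/-- The squared distance of row `s` (variable 6) of array 1 to row `v` of array 0. -/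
def distCmd (r v : ℕ) : Cmd :=
  sumCmd r 4 (.var 0) (.mul (.sub (.cell 1 (.var 6) (.var 4)) (.cell 0 (.var v) (.var 4)))
    (.sub (.cell 1 (.var 6) (.var 4)) (.cell 0 (.var v) (.var 4))))

/-- Find the number of a nearest point (as the variable 9) and write the unit vector to row `s`
(variable 6) of array 6. -/
def nearestRow : Cmd :=
  .seq (.setN 9 (.const 0)) <|
  .seq (.loop 8 (.var 1) <| .seq (distCmd 0 8) <| .seq (distCmd 1 9) <|
    .ifLe (.cell 20 (.const 1) (.const 0)) (.cell 20 (.const 0) (.const 0)) .skip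
      (.setN 9 (.var 8))) <|
  .seq (rowCmd 4 (.var 1) 6 (.var 6) (.ofNat (.const 0)))
    (.setR 6 (.var 6) (.var 9) (.ofNat (.const 1)))

/-- The squared distance of row `s` of array 1 to row `j` of array 0. -/
def State.sqDist (σ : State) (d s j : ℕ) : ℝ :=
  ∑ k ∈ Finset.range d, (σ.arr 1 s k - σ.arr 0 j k) * (σ.arr 1 s k - σ.arr 0 j k)

lemma run_distCmd {d : ℕ} (O : Oracles d) {σ : State} {s : ℕ} (r v : ℕ) (hd : σ.nat 0 = d)
    (hs : σ.nat 6 = s) (hv : v ≠ 4) :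
    ((distCmd r v).run O σ).arr = (σ.setArr 20 r 0 (σ.sqDist d s (σ.nat v))).arr := by
  refine run_sumCmd O d _ (fun τ hτ => by simp [NExp.eval, hτ, hd]) fun k _ τ e₁ e₂ e₃ => ?_
  simp [RExp.eval, NExp.eval, e₁, e₂, e₃, hs, hv]

/-- The machine has no square roots, so squared distances are compared. The candidate starts at
index 0, which is valid because `N` is positive. -/
lemma run_nearestRow {d : ℕ} (O : Oracles d) {σ : State} {N s : ℕ} (hd : σ.nat 0 = d)
    (hN : σ.nat 1 = N) (hs : σ.nat 6 = s) (hpos : 0 < N) :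
    ∃ b < N, (∀ j < N, σ.sqDist d s b ≤ σ.sqDist d s j) ∧
      (nearestRow.run O σ).arr 6 = fun i j => if i = s ∧ (j < N ∨ j = b) then
        (if j = b then 1 else 0) else σ.arr 6 i j := by
  simp only [nearestRow, run_seq]
  set σ₁ := (Cmd.setN 9 (.const 0)).run O σ with hσ₁
  set σ₂ := (Cmd.loop 8 (.var 1) <| .seq (distCmd 0 8) <| .seq (distCmd 1 9) <|
    .ifLe (.cell 20 (.const 1) (.const 0)) (.cell 20 (.const 0) (.const 0)) .skip
      (.setN 9 (.var 8))).run O σ₁ with hσ₂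
  have hN' : σ₁.nat 1 = N := by simp [hσ₁, State.setNat, hN]
  have n₂ : ∀ w, w ≠ 4 → w ≠ 8 → w ≠ 9 → σ₂.nat w = σ.nat w := by
    intro w h h' h''
    rw [hσ₂, Cmd.run_nat_of_not_writes O w _ _ (by
      simp [distCmd, sumCmd, Cmd.writesN, h.symm, h'.symm, h''.symm])]
    simp [hσ₁, State.setNat, h'']
  have a₂ : ∀ a, a ≠ 20 → σ₂.arr a = σ.arr a := by
    intro a h
    rw [hσ₂, Cmd.run_arr_of_not_writes O a _ _ (by
      simp [distCmd, sumCmd, Cmd.writesA, h.symm])]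
    simp [hσ₁, State.setNat]
  have key := run_loop_induct O (v := 8) (n := .var 1)
    (c := .seq (distCmd 0 8) <| .seq (distCmd 1 9) <|
      .ifLe (.cell 20 (.const 1) (.const 0)) (.cell 20 (.const 0) (.const 0)) .skip
      (.setN 9 (.var 8)))
    (σ := σ₁)
    (fun k τ => τ.nat 0 = d ∧ τ.nat 6 = s ∧ τ.arr 0 = σ.arr 0 ∧ τ.arr 1 = σ.arr 1 ∧ τ.nat 9 < N ∧
      ∀ j < k, σ.sqDist d s (τ.nat 9) ≤ σ.sqDist d s j)
    ⟨by simp [hσ₁, State.setNat, hd], by simp [hσ₁, State.setNat, hs], rfl, rfl,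
      by simpa [hσ₁, State.setNat, NExp.eval] using hpos, by simp⟩ ?_
  · rw [← hσ₂, NExp.eval, hN'] at key
    obtain ⟨-, -, -, -, h9, hmin⟩ := key
    refine ⟨σ₂.nat 9, h9, hmin, ?_⟩
    have a₃ := run_rowCmd O (v := 4) (a := 6) (n := .var 1) (i := .var 6)
      (e := .ofNat (.const 0)) (σ := σ₂) N s (fun _ => 0) ((n₂ 1 (by simp) (by simp)
        (by simp)).trans hN) (fun τ hτ => by simp [NExp.eval, hτ, n₂, hs])
      (fun k hk τ e₁ e₂ e₃ => by simp [RExp.eval, NExp.eval])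
    have n₃ : ∀ w, w ≠ 4 → ((rowCmd 4 (.var 1) 6 (.var 6) (.ofNat (.const 0))).run O σ₂).nat w =
        σ₂.nat w := fun w hw =>
      Cmd.run_nat_of_not_writes O w _ _ (by simp [rowCmd, Cmd.writesN, hw.symm])
    ext i j
    simp only [run_setR, State.setArr, a₃, NExp.eval, RExp.eval, n₃ 6 (by simp), n₃ 9 (by simp),
      n₂ 6 (by simp) (by simp) (by simp), hs, a₂ 6 (by simp)]
    by_cases hi : i = s <;> by_cases hj : j = σ₂.nat 9 <;> simp [hi, hj]
  · rw [NExp.eval, hN']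
    rintro k hk τ ⟨h₁, h₂, h₃, h₄, h₅, h₆⟩
    have hD : ∀ τ' : State, τ'.arr 0 = σ.arr 0 → τ'.arr 1 = σ.arr 1 →
        ∀ j, τ'.sqDist d s j = σ.sqDist d s j := fun τ' e e' j => by
      simp only [State.sqDist, e, e']
    simp only [run_seq]
    set τ₁ := (distCmd 0 8).run O (τ.setNat 8 k) with hτ₁
    have b₁ : τ₁.arr = (τ.setArr 20 0 0 (σ.sqDist d s k)).arr := by
      rw [hτ₁, run_distCmd O 0 8 (s := s) (by simpa [State.setNat]) (by simpa [State.setNat])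
        (by simp), hD _ (by simp [State.setNat, h₃]) (by simp [State.setNat, h₄])]
      rfl
    have m₁ : ∀ w, w ≠ 4 → τ₁.nat w = (τ.setNat 8 k).nat w := fun w hw =>
      Cmd.run_nat_of_not_writes O w _ _ (by simp [distCmd, sumCmd, Cmd.writesN, hw.symm])
    set τ₂ := (distCmd 1 9).run O τ₁ with hτ₂
    have b₂ : τ₂.arr = (τ₁.setArr 20 1 0 (σ.sqDist d s (τ.nat 9))).arr := by
      rw [hτ₂, run_distCmd O 1 9 (s := s) (by simp [m₁, State.setNat, h₁])
        (by simp [m₁, State.setNat, h₂]) (by simp), m₁ 9 (by simp), hD _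
        (by ext; simp [b₁, State.setArr, h₃]) (by ext; simp [b₁, State.setArr, h₄])]
      simp [State.setNat]
    have m₂ : ∀ w, w ≠ 4 → τ₂.nat w = (τ.setNat 8 k).nat w := fun w hw =>
      (Cmd.run_nat_of_not_writes O w _ _ (by simp [distCmd, sumCmd, Cmd.writesN, hw.symm])).trans
        (m₁ w hw)
    have c₀ : τ₂.arr 0 = σ.arr 0 := by ext; simp [b₂, b₁, State.setArr, h₃]
    have c₁ : τ₂.arr 1 = σ.arr 1 := by ext; simp [b₂, b₁, State.setArr, h₄]
    have v₀ : τ₂.arr 20 0 0 = σ.sqDist d s k := by simp [b₂, b₁, State.setArr]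
    have v₁ : τ₂.arr 20 1 0 = σ.sqDist d s (τ.nat 9) := by simp [b₂, State.setArr]
    have k₀ : τ₂.nat 0 = d := by simp [m₂, State.setNat, h₁]
    have k₆ : τ₂.nat 6 = s := by simp [m₂, State.setNat, h₂]
    have k₈ : τ₂.nat 8 = k := by simp [m₂, State.setNat]
    have k₉ : τ₂.nat 9 = τ.nat 9 := by simp [m₂, State.setNat]
    rw [run_ifLe]
    simp only [RExp.eval, NExp.eval, v₀, v₁]
    split_ifs with hle
    · refine ⟨k₀, k₆, c₀, c₁, by simpa [k₉] using h₅, fun j hj => ?_⟩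
      simp only [run_skip, k₉]
      rcases Nat.lt_succ_iff_lt_or_eq.1 hj with hj | rfl
      exacts [h₆ j hj, hle]
    · refine ⟨by simpa [State.setNat], by simpa [State.setNat], c₀, c₁,
        by simpa [State.setNat, NExp.eval, k₈] using hk, fun j hj => ?_⟩
      have : ((Cmd.setN 9 (.var 8)).run O τ₂).nat 9 = k := by simp [State.setNat, NExp.eval, k₈]
      rw [this]
      rcases Nat.lt_succ_iff_lt_or_eq.1 hj with hj | rfl
      exacts [(not_le.1 hle).le.trans (h₆ j hj), le_rfl]

/-! ### Barycentric coordinates -/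

lemma exists_weights_of_mem_convexHull {d N : ℕ} {pts : Fin N → Pt d}
    (hinj : Function.Injective pts) {c : Finset (Fin N)} {y : Pt d}
    (hy : y ∈ convexHull ℝ (pts '' c)) :
    ∃ w ∈ stdSimplex ℝ (Fin N), (∀ i ∉ c, w i = 0) ∧ ∑ i, w i • pts i = y := by
  classical
  rw [← Finset.coe_image, Finset.mem_convexHull'] at hy
  obtain ⟨w, h0, h1, hw⟩ := hy
  rw [Finset.sum_image hinj.injOn] at h1 hw
  refine ⟨fun i => if i ∈ c then w (pts i) else 0, ⟨fun i => ?_, ?_⟩, fun i hi => by simp [hi], ?_⟩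
  · dsimp only
    split_ifs with hi
    exacts [h0 _ (Finset.mem_image_of_mem _ hi), le_rfl]
  · rw [← h1]; simp
  · rw [← hw]; simp

/-- `(r, ρ)` is the projection of the last unit vector to the solutions `(κ, μ)` of the homogenized
barycentric system with columns masked outside `c`: `hd` and `h1` make it a solution, `hr` is the
projection property. Unit vectors at indices outside `c` are solutions, so `r` vanishes there;
affine independence then gives `r = ρ w` for the true coordinates `w`. Testing with `(w, 1)`
excludes `ρ = 0`, so dividing by `ρ` recovers `w`. -/
lemma barycentric_of_orthogonal {d N : ℕ} {ε : ℝ} {pts : Fin N → Pt d}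
    (hinj : Function.Injective pts) {y : Pt d} {c : Finset (Fin N)} (hc : IsCell ε pts y c)
    {r : Fin N → ℝ} {ρ : ℝ}
    (hd : ∀ k, ∑ i, r i * (pts i k * if i ∈ c then 1 else 0) = ρ * y k)
    (h1 : ∑ i, r i * (if i ∈ c then 1 else 0) = ρ)
    (hr : ∀ (κ : Fin N → ℝ) (μ : ℝ),
      (∀ k, ∑ i, κ i * (pts i k * if i ∈ c then 1 else 0) = μ * y k) →
      ∑ i, κ i * (if i ∈ c then 1 else 0) = μ → ∑ i, r i * κ i + ρ * μ = μ) :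
    (fun i => r i / ρ) ∈ stdSimplex ℝ (Fin N) ∧ (∀ i ∉ c, r i / ρ = 0) ∧
      ∑ i, (r i / ρ) • pts i = y := by
  obtain ⟨w, ⟨hw0, hw1⟩, hwc, hwy⟩ := exists_weights_of_mem_convexHull hinj hc.mem_hull
  have hwi : ∀ i, w i * (if i ∈ c then 1 else 0) = w i := by
    intro i
    split_ifs with hi
    · rw [mul_one]
    · rw [hwc i hi, zero_mul]
  have hrc : ∀ i ∉ c, r i = 0 := by
    intro i hi
    have := hr (Pi.single i 1) 0 (fun k => ?_) ?_
    · simpa [Pi.single_apply] using this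
    · rw [zero_mul]
      refine Finset.sum_eq_zero fun j _ => ?_
      by_cases hj : j = i
      · simp [hj, hi]
      · simp [hj]
    · refine Finset.sum_eq_zero fun j _ => ?_
      by_cases hj : j = i
      · simp [hj, hi]
      · simp [hj]
  have hyk : ∀ k, ∑ i, w i * pts i k = y k := by
    intro k
    rw [← hwy]
    simp
  have hw := hr w 1 (fun k => by
    rw [one_mul, ← hyk k]
    refine Finset.sum_congr rfl fun i _ => ?_
    rw [mul_comm (pts i k), ← mul_assoc, hwi]) (by simp only [hwi, hw1])
  have hri : ∀ i, r i = ρ * w i := by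
    intro i
    by_cases hi : i ∈ c
    · have key := affineIndependent_iff.1 hc.simplex Finset.univ (fun i => r i - ρ * w i) ?_ ?_
        ⟨i, hi⟩ (Finset.mem_univ _)
      · exact sub_eq_zero.1 key
      · rw [Finset.sum_coe_sort c fun i => r i - ρ * w i, Finset.sum_sub_distrib,
          ← Finset.mul_sum, sub_eq_zero]
        have e₁ : ∑ i ∈ c, r i = ρ := by rw [← h1]; simp
        have e₂ : ∑ i ∈ c, w i = 1 := by
          rw [← hw1]
          exact Finset.sum_subset (Finset.subset_univ _) fun i _ hi => hwc i hi
        rw [e₁, e₂, mul_one]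
      · rw [Finset.sum_coe_sort c fun i => (r i - ρ * w i) • pts i]
        ext k
        have e₁ : ∑ i ∈ c, r i * pts i k = ρ * y k := by rw [← hd]; simp
        have e₂ : ∑ i ∈ c, w i * pts i k = y k := by
          rw [← hyk]
          exact Finset.sum_subset (Finset.subset_univ _) fun i _ hi => by rw [hwc i hi, zero_mul]
        simp only [WithLp.ofLp_sum, WithLp.ofLp_smul, Finset.sum_apply, Pi.smul_apply,
          smul_eq_mul, sub_mul, Finset.sum_sub_distrib, mul_assoc, ← Finset.mul_sum, e₁, e₂]
        simp
    · rw [hrc i hi, hwc i hi, mul_zero]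
  have hρ : ρ ≠ 0 := by
    rintro rfl
    simp [hri] at hw
  have hz : ∀ i, r i / ρ = w i := fun i => by rw [hri, mul_div_cancel_left₀ _ hρ]
  simp only [hz]
  exact ⟨⟨hw0, hw1⟩, hwc, hwy⟩

/-- Write to array 7 the linear system for the barycentric coordinates. -/
def systemCmd : Cmd :=
  .seq (.loop 7 (.var 0) (.seq
    (rowCmd 4 (.var 1) 7 (.var 7) (.mul (.cell 0 (.var 4) (.var 7)) (.cell 12 (.var 6) (.var 4))))
    (.setR 7 (.var 7) (.var 1) (.sub (.ofNat (.const 0)) (.cell 11 (.var 6) (.var 7)))))) <|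
  .seq (rowCmd 4 (.var 1) 7 (.var 0) (.cell 12 (.var 6) (.var 4))) <|
  .seq (.setR 7 (.var 0) (.var 1) (.sub (.ofNat (.const 0)) (.ofNat (.const 1)))) <|
  .seq (rowCmd 4 (.var 1) 7 (.add (.var 0) (.const 1)) (.ofNat (.const 0)))
    (.setR 7 (.add (.var 0) (.const 1)) (.var 1) (.ofNat (.const 1)))

/-- Write to row `s` (variable 6) of array 6 the barycentric rounding of row `s` of array 1. -/
def barycentricRow : Cmd :=
  .seq (.query 3 1 (.var 6) 11 (.var 6)) <| .seq (.query 4 11 (.var 6) 12 (.var 6)) <|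
  .seq systemCmd <| .seq (orthCmd (.add (.var 0) (.const 2)) (.add (.var 1) (.const 1)))
    (rowCmd 4 (.var 1) 6 (.var 6) (.div (.cell 7 (.add (.var 0) (.const 1)) (.var 4))
      (.cell 7 (.add (.var 0) (.const 1)) (.var 1))))

lemma run_systemCmd {d : ℕ} (O : Oracles d) {σ : State} {N s : ℕ} (hd : σ.nat 0 = d)
    (hN : σ.nat 1 = N) (hs : σ.nat 6 = s) :
    let V := (systemCmd.run O σ).arr 7
    (∀ k < d, (∀ i < N, V k i = σ.arr 0 i k * σ.arr 12 s i) ∧ V k N = -σ.arr 11 s k) ∧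
    ((∀ i < N, V d i = σ.arr 12 s i) ∧ V d N = -1) ∧
    ((∀ i < N, V (d + 1) i = 0) ∧ V (d + 1) N = 1) := by
  simp only [systemCmd, run_seq]
  set σ₁ := (Cmd.loop 7 (.var 0) (.seq
    (rowCmd 4 (.var 1) 7 (.var 7) (.mul (.cell 0 (.var 4) (.var 7)) (.cell 12 (.var 6) (.var 4))))
    (.setR 7 (.var 7) (.var 1) (.sub (.ofNat (.const 0)) (.cell 11 (.var 6) (.var 7)))))).run O σ
    with hσ₁
  have n₁ : ∀ w, w ≠ 4 → w ≠ 7 → σ₁.nat w = σ.nat w := fun w hw hw' =>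
    Cmd.run_nat_of_not_writes O w _ _ (by simp [rowCmd, Cmd.writesN, hw.symm, hw'.symm])
  have b₁ : ∀ a, a ≠ 7 → σ₁.arr a = σ.arr a := fun a ha =>
    Cmd.run_arr_of_not_writes O a _ _ (by simp [rowCmd, Cmd.writesA, ha.symm])
  have a₁ : ∀ k < d, (∀ i < N, σ₁.arr 7 k i = σ.arr 0 i k * σ.arr 12 s i) ∧
      σ₁.arr 7 k N = -σ.arr 11 s k := by
    have key := run_loop_induct O (v := 7) (n := .var 0)
      (c := .seq (rowCmd 4 (.var 1) 7 (.var 7)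
          (.mul (.cell 0 (.var 4) (.var 7)) (.cell 12 (.var 6) (.var 4))))
        (.setR 7 (.var 7) (.var 1) (.sub (.ofNat (.const 0)) (.cell 11 (.var 6) (.var 7)))))
      (σ := σ)
      (fun m τ => (∀ w, w ≠ 4 → w ≠ 7 → τ.nat w = σ.nat w) ∧ (∀ a, a ≠ 7 → τ.arr a = σ.arr a) ∧
        ∀ k < m, (∀ i < N, τ.arr 7 k i = σ.arr 0 i k * σ.arr 12 s i) ∧
          τ.arr 7 k N = -σ.arr 11 s k)
      ⟨fun _ _ _ => rfl, fun _ _ => rfl, by simp⟩ ?_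
    · rw [NExp.eval, hd] at key
      exact key.2.2
    · rintro m - τ ⟨h₁, h₂, h₃⟩
      have a := run_rowCmd O (v := 4) (a := 7) (n := .var 1) (i := .var 7)
        (e := .mul (.cell 0 (.var 4) (.var 7)) (.cell 12 (.var 6) (.var 4)))
        (σ := τ.setNat 7 m) N m (fun i => σ.arr 0 i m * σ.arr 12 s i)
        (by simp [NExp.eval, State.setNat, h₁, hN])
        (fun τ' hτ => by simp [NExp.eval, hτ, State.setNat]) (fun i _ τ' e₁ e₂ e₃ => by
          simp only [RExp.eval, NExp.eval, e₂, e₁ 7 (by simp), e₁ 6 (by simp)]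
          rw [e₃ _ _ _ (by simp), e₃ _ _ _ (by simp)]
          simp [State.setNat, h₁, h₂, hs])
      rw [run_seq]
      set τ₁ := (rowCmd 4 (.var 1) 7 (.var 7)
          (.mul (.cell 0 (.var 4) (.var 7)) (.cell 12 (.var 6) (.var 4)))).run O (τ.setNat 7 m)
        with hτ₁
      have m₁ : ∀ w, w ≠ 4 → τ₁.nat w = (τ.setNat 7 m).nat w := fun w hw =>
        Cmd.run_nat_of_not_writes O w _ _ (by simp [rowCmd, Cmd.writesN, hw.symm])
      have k₁ : τ₁.nat 1 = N := by simp [m₁, State.setNat, h₁, hN]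
      have k₆ : τ₁.nat 6 = s := by simp [m₁, State.setNat, h₁, hs]
      have k₇ : τ₁.nat 7 = m := by simp [m₁, State.setNat]
      have c₁ : τ₁.arr 11 s m = σ.arr 11 s m := by simp [a, State.setNat, h₂]
      refine ⟨fun w hw hw' => ?_, fun a' ha' => ?_, fun k hk => ?_⟩
      · simp [State.setArr, m₁, hw, State.setNat, hw', h₁]
      · ext i j
        simp [State.setArr, ha', a, State.setNat, h₂]
      · simp only [run_setR, State.setArr, NExp.eval, RExp.eval, k₁, k₆, k₇, c₁]
        rcases Nat.lt_succ_iff_lt_or_eq.1 hk with hk | rfl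
        · simp only [hk.ne, false_and, and_false, if_false, a]
          exact h₃ k hk
        · simp only [true_and, a]
          refine ⟨fun i hi => ?_, by simp⟩
          simp [hi, hi.ne]
  set σ₂ := (rowCmd 4 (.var 1) 7 (.var 0) (.cell 12 (.var 6) (.var 4))).run O σ₁ with hσ₂
  have n₂ : ∀ w, w ≠ 4 → w ≠ 7 → σ₂.nat w = σ.nat w := fun w hw hw' =>
    (Cmd.run_nat_of_not_writes O w _ _ (by simp [rowCmd, Cmd.writesN, hw.symm])).trans
      (n₁ w hw hw')
  have a₂ : σ₂.arr = _ := run_rowCmd O N d (fun i => σ.arr 12 s i)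
    (by simp [NExp.eval, n₁, hN]) (fun τ hτ => by simp [NExp.eval, hτ, n₁, hd])
    (fun k _ τ e₁ e₂ e₃ => by
      simp only [RExp.eval, NExp.eval, e₂, e₁ 6 (by simp)]
      rw [e₃ _ _ _ (by simp), n₁ 6 (by simp) (by simp), b₁ 12 (by simp), hs])
  set σ₃ := (Cmd.setR 7 (.var 0) (.var 1) (.sub (.ofNat (.const 0)) (.ofNat (.const 1)))).run O σ₂
    with hσ₃
  have n₃ : ∀ w, w ≠ 4 → w ≠ 7 → σ₃.nat w = σ.nat w := n₂
  have a₃ : σ₃.arr = (σ₂.setArr 7 d N (-1)).arr := by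
    simp [hσ₃, NExp.eval, RExp.eval, n₂, hd, hN]
  set σ₄ := (rowCmd 4 (.var 1) 7 (.add (.var 0) (.const 1)) (.ofNat (.const 0))).run O σ₃ with hσ₄
  have n₄ : ∀ w, w ≠ 4 → w ≠ 7 → σ₄.nat w = σ.nat w := fun w hw hw' =>
    (Cmd.run_nat_of_not_writes O w _ _ (by simp [rowCmd, Cmd.writesN, hw.symm])).trans
      (n₃ w hw hw')
  have a₄ : σ₄.arr = _ := run_rowCmd O N (d + 1) (fun _ => 0)
    (by simp [NExp.eval, n₃, hN]) (fun τ hτ => by simp [NExp.eval, hτ, n₃, hd])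
    (fun k _ τ e₁ e₂ e₃ => by simp [RExp.eval, NExp.eval])
  simp only [run_setR, NExp.eval, RExp.eval, n₄ 0 (by simp) (by simp), n₄ 1 (by simp) (by simp),
    hd, hN, State.setArr, a₄, a₃, a₂]
  refine ⟨fun k hk => ?_, ⟨fun i hi => ?_, ?_⟩, ⟨fun i hi => ?_, ?_⟩⟩
  · have e₁ : k ≠ d + 1 := by omega
    simp only [e₁, hk.ne, false_and, and_false, if_false]
    exact a₁ k hk
  · simp [hi.ne, hi]
  · simp
  · simp [hi, hi.ne]
  · simp

lemma State.point_apply (σ : State) (d a i : ℕ) (k : Fin d) :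
    σ.point d a i k = σ.arr a i k := rfl

lemma point_setRow_ofFn {d : ℕ} (σ : State) (a i : ℕ) (x : Pt d) :
    (σ.setRow a i (List.ofFn x.ofLp)).point d a i = x := by
  ext k
  simp [State.point_apply, State.setRow, List.getD]

/-- Column `N` of array 7 belongs to the homogenizing unknown: `d` rows encode the coordinates, row
`d` the sum of the weights, and row `d + 1` is the last unit vector. After Gram–Schmidt this last
row is the pair `(r, ρ)` of `barycentric_of_orthogonal`. -/
lemma run_barycentricRow {d : ℕ} (O : Oracles d) {σ : State} {N s : ℕ} {ε : ℝ} (hd : σ.nat 0 = d)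
    (hN : σ.nat 1 = N) (hs : σ.nat 6 = s) {pts : Fin N → Pt d}
    (hpts : ∀ i : Fin N, σ.point d 0 i = pts i) (hinj : Function.Injective pts)
    {perp : Pt d → Pt d} {cell : Pt d → Finset (Fin N)}
    (h3 : ∀ x, O 3 x = List.ofFn (perp x).ofLp)
    (h4 : ∀ x, O 4 x = List.ofFn fun i : Fin N => if i ∈ cell x then (1 : ℝ) else 0)
    (hcell : IsCell ε pts (perp (σ.point d 1 s)) (cell (perp (σ.point d 1 s)))) :
    BarycentricRounding pts perp cell (σ.point d 1 s)
      (fun i => (barycentricRow.run O σ).arr 6 s i) ∧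
    ∀ s', s' ≠ s → (barycentricRow.run O σ).arr 6 s' = σ.arr 6 s' := by
  set q := σ.point d 1 s with hq
  set y := perp q with hy
  set c := cell y with hcdef
  simp only [barycentricRow, run_seq]
  set σ₁ := (Cmd.query 3 1 (.var 6) 11 (.var 6)).run O σ with hσ₁
  have e₁ : σ₁ = σ.setRow 11 s (List.ofFn y.ofLp) := by
    rw [hσ₁, run_query]
    simp only [NExp.eval, hs, h3, ← hq, ← hy]
  have y₁ : σ₁.point d 11 s = y := by rw [e₁]; exact point_setRow_ofFn _ _ _ _
  set σ₂ := (Cmd.query 4 11 (.var 6) 12 (.var 6)).run O σ₁ with hσ₂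
  have e₂ : σ₂ = σ₁.setRow 12 s (List.ofFn fun i : Fin N => if i ∈ c then (1 : ℝ) else 0) := by
    rw [hσ₂, run_query]
    simp only [NExp.eval, show σ₁.nat 6 = s from hs, y₁, h4]
    rfl
  have n₂ : ∀ w, σ₂.nat w = σ.nat w := fun w => rfl
  have p₂ : σ₂.arr 0 = σ.arr 0 := by ext; simp [e₂, e₁, State.setRow]
  have y₂ : ∀ k : Fin d, σ₂.arr 11 s k = y k := by
    intro k
    rw [← y₁]
    simp [e₂, State.setRow, State.point_apply]
  have c₂ : ∀ i : Fin N, σ₂.arr 12 s i = if i ∈ c then 1 else 0 := by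
    intro i
    simp [e₂, State.setRow, List.getD]
  have q₂ : σ₂.arr 6 = σ.arr 6 := by ext; simp [e₂, e₁, State.setRow]
  obtain ⟨v₁, ⟨v₂, v₂'⟩, v₃, v₃'⟩ := run_systemCmd O ((n₂ 0).trans hd) ((n₂ 1).trans hN)
    ((n₂ 6).trans hs)
  set σ₃ := systemCmd.run O σ₂ with hσ₃
  have n₃ : ∀ w, w ≠ 4 → w ≠ 7 → σ₃.nat w = σ.nat w := fun w hw hw' =>
    (Cmd.run_nat_of_not_writes O w _ _ (by
      simp [systemCmd, rowCmd, Cmd.writesN, hw.symm, hw'.symm])).trans (n₂ w)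
  have b₃ : σ₃.arr 6 = σ.arr 6 := (Cmd.run_arr_of_not_writes O 6 _ _ rfl).trans q₂
  obtain ⟨o₁, o₂⟩ := run_orthCmd O (R := .add (.var 0) (.const 2)) (m := .add (.var 1) (.const 1))
    (M := N + 1) (r := d + 1) (σ := σ₃) (by simp [NExp.eval, n₃, hd])
    (fun τ _ hτ => by simp [NExp.eval, hτ, n₃, hN])
  set σ₄ := (orthCmd (.add (.var 0) (.const 2)) (.add (.var 1) (.const 1))).run O σ₃ with hσ₄
  have n₄ : ∀ w, w ≠ 2 → w ≠ 3 → w ≠ 4 → w ≠ 7 → σ₄.nat w = σ.nat w := fun w h h' h'' hw' =>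
    (Cmd.run_nat_of_not_writes O w _ _ (by
      simp [orthCmd, orthStep, sumCmd, rowCmd, Cmd.writesN, h.symm, h'.symm, h''.symm])).trans
      (n₃ w h'' hw')
  have b₄ : σ₄.arr 6 = σ.arr 6 := (Cmd.run_arr_of_not_writes O 6 _ _ rfl).trans b₃
  have a₅ := run_rowCmd O (v := 4) (a := 6) (n := .var 1) (i := .var 6)
    (e := .div (.cell 7 (.add (.var 0) (.const 1)) (.var 4))
      (.cell 7 (.add (.var 0) (.const 1)) (.var 1))) (σ := σ₄) N s
    (fun i => σ₄.arr 7 (d + 1) i / σ₄.arr 7 (d + 1) N)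
    (by simp [NExp.eval, n₄, hN]) (fun τ hτ => by simp [NExp.eval, hτ, n₄, hs])
    (fun k _ τ e₁ e₂ e₃ => by
      simp only [RExp.eval, NExp.eval, e₂, e₁ 0 (by simp), e₁ 1 (by simp)]
      rw [e₃ _ _ _ (by simp), e₃ _ _ _ (by simp)]
      simp [n₄, hd, hN])
  rw [a₅]
  refine ⟨?_, fun s' hs' => by ext; simp [hs', b₄]⟩
  have hz : (fun i : Fin N => if 6 = 6 ∧ s = s ∧ (i : ℕ) < N then
      σ₄.arr 7 (d + 1) i / σ₄.arr 7 (d + 1) N else σ₄.arr 6 s i) =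
      fun i : Fin N => σ₄.arr 7 (d + 1) i / σ₄.arr 7 (d + 1) N := by
    ext i
    simp
  rw [hz]
  have hp : ∀ (i : Fin N) (k : Fin d), σ₂.arr 0 i k = pts i k := fun i k => by
    rw [p₂, ← hpts i]
    rfl
  have dotN : ∀ u v : ℕ → ℝ, dot (N + 1) u v = ∑ i : Fin N, u i * v i + u N * v N := by
    intro u v
    rw [dot, Finset.sum_range_succ, Finset.sum_range]
  have row₁ : ∀ (v : ℕ → ℝ) (k : Fin d), dot (N + 1) (σ₃.arr 7 k) v =
      ∑ i : Fin N, v i * (pts i k * if i ∈ c then 1 else 0) - v N * y k := by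
    intro v k
    rw [dotN, (v₁ k k.2).2, y₂]
    simp only [(v₁ k k.2).1 _ (Fin.is_lt _), hp, c₂]
    rw [Finset.sum_congr rfl fun i _ => mul_comm _ (v (Fin.val i))]
    ring
  have row₂ : ∀ v : ℕ → ℝ, dot (N + 1) (σ₃.arr 7 d) v =
      ∑ i : Fin N, v i * (if i ∈ c then 1 else 0) - v N := by
    intro v
    rw [dotN, v₂']
    simp only [v₂ _ (Fin.is_lt _), c₂]
    rw [Finset.sum_congr rfl fun i _ => mul_comm _ (v (Fin.val i))]
    ring
  refine barycentric_of_orthogonal hinj hcell (fun k => ?_) ?_ fun κ μ hκ hμ => ?_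
  · have := o₁ k (by omega)
    rw [dot_comm, row₁] at this
    exact sub_eq_zero.1 this
  · have := o₁ d (by omega)
    rw [dot_comm, row₂] at this
    exact sub_eq_zero.1 this
  · have := o₂ (fun i => if h : i < N then κ ⟨i, h⟩ else μ) ?_
    · rw [dotN, dotN] at this
      simpa [v₃ _ (Fin.is_lt _), v₃'] using this
    · intro i hi
      rcases Nat.lt_succ_iff_lt_or_eq.1 hi with hi | rfl
      · rw [row₁ _ ⟨i, hi⟩, sub_eq_zero]
        simpa using hκ ⟨i, hi⟩
      · rw [row₂, sub_eq_zero]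
        simpa using hμ

/-! ### The programs -/

/-- Blum–Mansour with multiplicative weights. -/
def mwuProgram : OnlineProgram where
  act := .seq (.loop 6 (.var 1) expRow) statCmd
  update := .seq (.loop 6 (.var 1) (.query 0 0 (.var 6) 5 (.var 6)))
    (.loop 6 (.var 1) (rowCmd 4 (.var 1) 4 (.var 6) (.add (.cell 4 (.var 6) (.var 4))
      (.mul (.cell 3 (.const 0) (.var 6)) (.cell 5 (.var 4) (.const 0))))))

/-- One step of online gradient descent for the copy number 6 (as a variable). -/
def ogdRow : Cmd :=
  .seq (.query 1 1 (.var 6) 9 (.var 6)) <|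
  .seq (.setR 8 (.var 6) (.const 0)
    (.add (.cell 8 (.var 6) (.const 0)) (.cell 3 (.const 0) (.var 6)))) <|
  .seq (.ifLe (.cell 8 (.var 6) (.const 0)) (.ofNat (.const 1))
    (.setR 20 (.const 0) (.const 0)
      (.div (.ofNat (.const 1)) (.cell 2 (.const 0) (.const 0))))
    (.setR 20 (.const 0) (.const 0) (.div (.ofNat (.const 1))
      (.mul (.cell 2 (.const 0) (.const 0)) (.cell 8 (.var 6) (.const 0)))))) <|
  .seq (rowCmd 4 (.var 0) 10 (.var 6) (.sub (.cell 1 (.var 6) (.var 4))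
    (.mul (.mul (.cell 20 (.const 0) (.const 0)) (.cell 3 (.const 0) (.var 6)))
      (.cell 9 (.var 6) (.var 4)))))
    (.query 2 10 (.var 6) 1 (.var 6))

/-- Blum–Mansour with online gradient descent; `row` computes a row of the transition matrix. -/
def ogdProgram (row : Cmd) : OnlineProgram where
  act := .seq (.loop 6 (.var 1) row) statCmd
  update := .loop 6 (.var 1) ogdRow

/-! ### Step counts of the programs -/

/-- Bounds on the variables of the programs. -/
def varBound (d N v : ℕ) : ℕ := if v = 0 then d else if v = 1 then N else d + N + 2

/-- The exponent in the polynomial bound on the number of steps per round. -/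
def OnlineProgram.timeConst (P : OnlineProgram) : ℕ :=
  (P.act.size + P.update.size) * 8 ^ max P.act.depth P.update.depth +
    max P.act.depth P.update.depth

lemma mul_pow_self_mono {k k' n : ℕ} (hn : 1 ≤ n) (h : k ≤ k') : k * n ^ k ≤ k' * n ^ k' :=
  Nat.mul_le_mul h (Nat.pow_le_pow_right hn h)

lemma OnlineProgram.time_le {d N : ℕ} (P : OnlineProgram) (O : Oracles d) (O' : ℕ → Oracles d)
    (pts start : Fin N → Pt d) (param : ℝ) (hd : 1 ≤ d + N)
    (ha : P.act.Fits (varBound d N)) (hu : P.update.Fits (varBound d N))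
    (hO : ∀ o x, (O o x).length ≤ 3 * (d + N)) (hO' : ∀ t o x, (O' t o x).length ≤ 3 * (d + N))
    (t : ℕ) :
    P.time O O' (inputState pts start param) t ≤ P.timeConst * (d + N) ^ P.timeConst := by
  -- This covers `d` plus an oracle answer of length `3 * (d + N)`, and also the bounds on the
  -- variables. It is at most `8 * (d + N)`, the source of the 8 in `timeConst`.
  set M := 4 * (d + N) + 4 with hM
  have henv : ∀ v, varBound d N v + 1 ≤ M := by
    intro v
    simp only [varBound]
    split_ifs <;> omega
  have ba := Cmd.exec_bounds (O := O) (M := M) (by omega) henv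
    (fun o x => by have := hO o x; omega) P.act ha
  have bu := fun t => Cmd.exec_bounds (O := O' t) (M := M) (by omega) henv
    (fun o x => by have := hO' t o x; omega) P.update hu
  have hst : ∀ t v, (P.state O O' (inputState pts start param) t).nat v ≤ varBound d N v := by
    intro t
    induction t with
    | zero =>
      intro v
      simp only [OnlineProgram.state, inputState, varBound]
      split_ifs <;> omega
    | succ t ih => exact (bu t _ (ba _ ih).1).1
  have h₁ := (ba _ (hst t)).2
  have h₂ := (bu t _ (ba _ (hst t)).1).2
  set D := max P.act.depth P.update.depth with hD
  have hpow : M ^ D ≤ 8 ^ D * (d + N) ^ D := by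
    rw [← mul_pow]
    exact Nat.pow_le_pow_left (by omega) _
  calc P.time O O' (inputState pts start param) t
      ≤ P.act.size * M ^ D + P.update.size * M ^ D :=
        add_le_add (h₁.trans (Nat.mul_le_mul_left _ (Nat.pow_le_pow_right (by omega)
          (le_max_left _ _)))) (h₂.trans (Nat.mul_le_mul_left _ (Nat.pow_le_pow_right (by omega)
          (le_max_right _ _))))
    _ = (P.act.size + P.update.size) * M ^ D := by ring
    _ ≤ (P.act.size + P.update.size) * (8 ^ D * (d + N) ^ D) := Nat.mul_le_mul_left _ hpow
    _ = (P.act.size + P.update.size) * 8 ^ D * (d + N) ^ D := by ring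
    _ ≤ P.timeConst * (d + N) ^ P.timeConst :=
        Nat.mul_le_mul (Nat.le_add_right _ _) (Nat.pow_le_pow_right hd (Nat.le_add_left _ _))

lemma mwuProgram_fits (d N : ℕ) :
    mwuProgram.act.Fits (varBound d N) ∧ mwuProgram.update.Fits (varBound d N) := by
  simp only [mwuProgram, expRow, statCmd, transposeCmd, absCmd, orthCmd, orthStep, sumCmd, rowCmd,
    Cmd.Fits, NExp.ub, varBound]
  simp
  omega

lemma ogdProgram_nearest_fits (d N : ℕ) :
    (ogdProgram nearestRow).act.Fits (varBound d N) ∧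
      (ogdProgram nearestRow).update.Fits (varBound d N) := by
  simp only [ogdProgram, ogdRow, nearestRow, distCmd, statCmd, transposeCmd, absCmd, orthCmd,
    orthStep, sumCmd, rowCmd, Cmd.Fits, NExp.ub, varBound]
  simp
  omega

lemma ogdProgram_barycentric_fits (d N : ℕ) :
    (ogdProgram barycentricRow).act.Fits (varBound d N) ∧
      (ogdProgram barycentricRow).update.Fits (varBound d N) := by
  simp only [ogdProgram, ogdRow, barycentricRow, systemCmd, statCmd, transposeCmd, absCmd, orthCmd,
    orthStep, sumCmd, rowCmd, Cmd.Fits, NExp.ub, varBound]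
  simp
  omega

/-! ### Correctness of the programs -/

lemma history_succ {F : Type} {N : ℕ} (f : ℕ → F) (x : ℕ → Fin N → ℝ) (s : Fin N) (t : ℕ) :
    history f x s (t + 1) = history f x s t ++ [(f t, x t s)] := by
  simp [history, List.range_succ]

lemma mwu_nonneg {d N : ℕ} (η : ℝ) (pts : Fin N → Pt d) (h : List ((Pt d → ℝ) × ℝ)) (j : Fin N) :
    0 ≤ mwu η pts h j :=
  div_nonneg (Real.exp_pos _).le (Finset.sum_nonneg fun _ _ => (Real.exp_pos _).le)

lemma sum_mwu {d N : ℕ} (hN : 0 < N) (η : ℝ) (pts : Fin N → Pt d) (h : List ((Pt d → ℝ) × ℝ)) :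
    ∑ j, mwu η pts h j = 1 := by
  simp only [mwu, ← Finset.sum_div]
  refine div_self (Finset.sum_pos (fun _ _ => Real.exp_pos _) ⟨⟨0, hN⟩, Finset.mem_univ _⟩).ne'

lemma point_inputState {d N : ℕ} (pts start : Fin N → Pt d) (param : ℝ) (i : Fin N) :
    (inputState pts start param).point d 0 i = pts i := by
  ext k
  simp [State.point_apply, inputState]

lemma point_inputState_start {d N : ℕ} (pts start : Fin N → Pt d) (param : ℝ) (i : Fin N) :
    (inputState pts start param).point d 1 i = start i := by
  ext k
  simp [State.point_apply, inputState]

lemma OnlineProgram.play_eq {d : ℕ} (P : OnlineProgram) (O : Oracles d) (O' : ℕ → Oracles d)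
    (σ : State) (N t : ℕ) :
    P.play O O' σ N t = fun i : Fin N => (P.act.run O (P.state O O' σ t)).arr 3 0 i := rfl

lemma run_mwuUpdate {d : ℕ} (l : Pt d → ℝ) {σ : State} {N : ℕ} (hN : σ.nat 1 = N) :
    ∀ s < N, ∀ j < N, (mwuProgram.update.run (valueOracle l) σ).arr 4 s j =
      σ.arr 4 s j + σ.arr 3 0 s * l (σ.point d 0 j) := by
  simp only [mwuProgram, run_seq]
  set σ₁ := (Cmd.loop 6 (.var 1) (.query 0 0 (.var 6) 5 (.var 6))).run (valueOracle l) σ with hσ₁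
  have n₁ : σ₁.nat 1 = N := (Cmd.run_nat_of_not_writes _ 1 _ _ rfl).trans hN
  have b₁ : ∀ a, a ≠ 5 → σ₁.arr a = σ.arr a := fun a ha =>
    Cmd.run_arr_of_not_writes _ a _ _ (by simp [Cmd.writesA, ha.symm])
  have a₁ := run_rows (valueOracle l) (c := .query 0 0 (.var 6) 5 (.var 6)) hN (fun b => b = 5)
    (fun s _ r => r 0 = l (σ.point d 0 s)) rfl rfl (by
      rintro s - τ - - h6 ha - b rfl
      have h0 : τ.point d 0 s = σ.point d 0 s := by
        simp only [State.point, ha 0 rfl]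
      refine ⟨?_, fun s' hs' => ?_⟩
      · simp [NExp.eval, h6, State.setRow, valueOracle, h0]
      · ext j
        simp [NExp.eval, h6, State.setRow, hs'])
  have a₂ := run_rows (valueOracle l) (c := rowCmd 4 (.var 1) 4 (.var 6)
      (.add (.cell 4 (.var 6) (.var 4))
      (.mul (.cell 3 (.const 0) (.var 6)) (.cell 5 (.var 4) (.const 0))))) n₁ (fun b => b = 4)
    (fun s _ r => ∀ j < N, r j = σ.arr 4 s j + σ.arr 3 0 s * l (σ.point d 0 j)) rfl rfl (by
      rintro s - τ - h1 h6 ha hb b rfl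
      have := run_rowCmd (valueOracle l) (v := 4) (a := 4) (n := .var 1) (i := .var 6)
        (e := .add (.cell 4 (.var 6) (.var 4))
          (.mul (.cell 3 (.const 0) (.var 6)) (.cell 5 (.var 4) (.const 0)))) (σ := τ) N s
        (fun j => σ.arr 4 s j + σ.arr 3 0 s * l (σ.point d 0 j)) h1
        (fun τ' h => by simp [NExp.eval, h, h6]) (fun j hj τ' e₁ e₂ e₃ => by
          simp only [RExp.eval, NExp.eval, e₂, e₁ 6 (by simp), h6]
          rw [e₃ _ _ _ (by simp), e₃ _ _ _ (by simp), e₃ _ _ _ (by simp), hb 4 rfl, ha 3 rfl,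
            ha 5 rfl, b₁ 4 (by simp), b₁ 3 (by simp), a₁ j hj 5 rfl])
      refine ⟨fun j hj => ?_, fun s' hs' => ?_⟩
      · simp [this, hj]
      · ext j
        simp [this, hs'])
  exact fun s hs => a₂ s hs 4 rfl

lemma OnlineProgram.exists_state {d : ℕ} (P : OnlineProgram) (O : Oracles d)
    (O' : ℕ → Oracles d) (σ : State) :
    ∃ S : ℕ → State, P.state O O' σ = S ∧ S 0 = σ ∧
      ∀ t, S (t + 1) = P.update.run (O' t) (P.act.run O (S t)) :=
  ⟨_, rfl, rfl, fun _ => rfl⟩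

/-- Histories need not be stored: entry `(s, j)` of array 4 is the cumulative loss of point `j`,
scaled as copy `s` sees it, and the weights depend on nothing else. -/
lemma mwuProgram_correct {d N : ℕ} (hN : 0 < N) (pts : Fin N → Pt d) (η : ℝ)
    (l : ℕ → Pt d → ℝ) (T : ℕ) :
    IsRunNonconvex (mwu η pts) l T (mwuProgram.play (noOracle d) (fun t => valueOracle (l t))
      (inputState pts (fun _ => 0) η) N) := by
  set σ := inputState pts (fun _ => 0) η with hσ
  obtain ⟨S, hS, hS0, hS1⟩ := mwuProgram.exists_state (noOracle d) (fun t => valueOracle (l t)) σ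
  obtain ⟨x, hx, hxt⟩ : ∃ x, x = mwuProgram.play (noOracle d) (fun t => valueOracle (l t)) σ N ∧
      ∀ t (i : Fin N), x t i = (mwuProgram.act.run (noOracle d) (S t)).arr 3 0 i :=
    ⟨_, rfl, fun t i => by rw [OnlineProgram.play_eq, hS]⟩
  rw [← hx]
  have hinv : ∀ t, (S t).nat 1 = N ∧ (S t).arr 0 = σ.arr 0 ∧ (S t).arr 2 = σ.arr 2 ∧
      ∀ s j : Fin N, (S t).arr 4 s j =
        ((history l x s t).map fun a => a.2 * a.1 (pts j)).sum := by
    intro t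
    induction t with
    | zero =>
      rw [hS0]
      exact ⟨rfl, rfl, rfl, fun s j => by simp [hσ, inputState, history]⟩
    | succ t ih =>
      obtain ⟨h₁, h₂, h₃, h₄⟩ := ih
      rw [hS1]
      have n₁ : (mwuProgram.act.run (noOracle d) (S t)).nat 1 = N := by
        rw [Cmd.run_nat_of_not_writes _ 1 mwuProgram.act _ rfl, h₁]
      have b : ∀ a, mwuProgram.act.writesA a = false →
          (mwuProgram.act.run (noOracle d) (S t)).arr a = (S t).arr a := fun a ha =>
        Cmd.run_arr_of_not_writes _ a mwuProgram.act _ ha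
      refine ⟨?_, ?_, ?_, fun s j => ?_⟩
      · rw [Cmd.run_nat_of_not_writes _ 1 mwuProgram.update _ rfl, n₁]
      · rw [Cmd.run_arr_of_not_writes _ 0 mwuProgram.update _ rfl, b 0 rfl, h₂]
      · rw [Cmd.run_arr_of_not_writes _ 2 mwuProgram.update _ rfl, b 2 rfl, h₃]
      rw [run_mwuUpdate (l t) n₁ s s.2 j j.2, history_succ, List.map_append, List.sum_append,
        b 4 rfl, h₄]
      have hp : (mwuProgram.act.run (noOracle d) (S t)).point d 0 j = pts j := by
        rw [← point_inputState pts (fun _ => 0) η j]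
        simp only [State.point]
        rw [b 0 rfl, h₂]
      simp only [hp, List.map_cons, List.map_nil, List.sum_cons, List.sum_nil, add_zero, hxt]
  intro t _
  obtain ⟨h₁, h₂, h₃, h₄⟩ := hinv t
  rw [show x t = _ from funext (hxt t)]
  have n₁ : ((Cmd.loop 6 (.var 1) expRow).run (noOracle d) (S t)).nat 1 = N := by
    rw [Cmd.run_nat_of_not_writes _ 1 (Cmd.loop 6 (.var 1) expRow) _ rfl, h₁]
  simp only [show mwuProgram.act = .seq (.loop 6 (.var 1) expRow) statCmd from rfl, run_seq]
  refine run_statCmd (noOracle d) n₁ hN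
    (fun s j => ?_) (fun s j => mwu_nonneg _ _ _ _) (fun s => sum_mwu hN _ _ _)
  have := run_rows (noOracle d) (c := expRow) h₁ (fun b => b = 6)
    (fun s _ r => ∀ j < N, r j = Real.exp (-η * (S t).arr 4 s j) /
        ∑ k ∈ Finset.range N, Real.exp (-η * (S t).arr 4 s k)) rfl rfl (by
      rintro s - τ - e₁ e₆ ea - b rfl
      have e2 : τ.arr 2 0 0 = η := by rw [ea 2 rfl, h₃]; simp [hσ, inputState]
      rw [run_expRow (noOracle d) e₁ e₆, e2, ea 4 rfl]
      refine ⟨fun j hj => by simp [hj], fun s' hs' => by ext j; simp [hs']⟩) s s.2 6 rfl j j.2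
  rw [this, Finset.sum_range]
  simp only [Matrix.of_apply, mwu, h₄]

/-- For the copy at hand, array 1 holds its point, array 8 its sum of scales, array 9 the
subgradient and array 10 the point before projection. -/
lemma run_ogdRow {d : ℕ} (O : Oracles d) {K : Set (Pt d)} {g : Pt d → Pt d} {σ : State} {s : ℕ}
    (h1 : ∀ x, O 1 x = List.ofFn (g x).ofLp) (h2 : ∀ x, O 2 x = List.ofFn (proj K x).ofLp)
    (hd : σ.nat 0 = d) (hs : σ.nat 6 = s) :
    ((ogdRow.run O σ).point d 1 s, (ogdRow.run O σ).arr 8 s 0) =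
      ogdStep K (σ.arr 2 0 0) (σ.point d 1 s, σ.arr 8 s 0) (g, σ.arr 3 0 s) ∧
    ∀ s', s' ≠ s → (ogdRow.run O σ).arr 1 s' = σ.arr 1 s' ∧
      (ogdRow.run O σ).arr 8 s' = σ.arr 8 s' := by
  simp only [ogdRow, run_seq]
  set q := σ.point d 1 s with hq
  set G := σ.arr 8 s 0 + σ.arr 3 0 s with hG
  set α := σ.arr 2 0 0 with hα
  set σ₁ := (Cmd.query 1 1 (.var 6) 9 (.var 6)).run O σ with hσ₁
  have e₁ : σ₁ = σ.setRow 9 s (List.ofFn (g q).ofLp) := by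
    rw [hσ₁, run_query]
    simp only [NExp.eval, hs, h1, ← hq]
  set σ₂ := (Cmd.setR 8 (.var 6) (.const 0)
    (.add (.cell 8 (.var 6) (.const 0)) (.cell 3 (.const 0) (.var 6)))).run O σ₁ with hσ₂
  have e₂ : σ₂ = σ₁.setArr 8 s 0 G := by
    have k₁ : σ₁.nat 6 = s := hs
    have g₁ : σ₁.arr 8 = σ.arr 8 := by ext; simp [e₁, State.setRow]
    have g₂ : σ₁.arr 3 = σ.arr 3 := by ext; simp [e₁, State.setRow]
    simp only [hσ₂, run_setR, NExp.eval, RExp.eval, k₁, g₁, g₂, hG]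
  set σ₃ := (Cmd.ifLe (.cell 8 (.var 6) (.const 0)) (.ofNat (.const 1))
    (.setR 20 (.const 0) (.const 0)
      (.div (.ofNat (.const 1)) (.cell 2 (.const 0) (.const 0))))
    (.setR 20 (.const 0) (.const 0) (.div (.ofNat (.const 1))
      (.mul (.cell 2 (.const 0) (.const 0)) (.cell 8 (.var 6) (.const 0)))))).run O σ₂ with hσ₃
  have k₂ : σ₂.nat 6 = s := hs
  have e₃ : σ₃ = σ₂.setArr 20 0 0 (ogdRate α G) := by
    have g₁ : σ₂.arr 8 s 0 = G := by simp [e₂, State.setArr]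
    have g₂ : σ₂.arr 2 0 0 = α := by simp [e₂, e₁, State.setArr, State.setRow, hα]
    rw [hσ₃, run_ifLe]
    simp only [run_setR, NExp.eval, RExp.eval, k₂, g₁, g₂, ogdRate, Nat.cast_one]
    split_ifs <;> rfl
  have n₃ : ∀ w, σ₃.nat w = σ.nat w := fun w => by rw [e₃]; rfl
  set σ₄ := (rowCmd 4 (.var 0) 10 (.var 6) (.sub (.cell 1 (.var 6) (.var 4))
    (.mul (.mul (.cell 20 (.const 0) (.const 0)) (.cell 3 (.const 0) (.var 6)))
      (.cell 9 (.var 6) (.var 4))))).run O σ₃ with hσ₄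
  have a₄ : σ₄.arr = _ := run_rowCmd O d s
    (fun k => σ₃.arr 1 s k - (ogdRate α G * σ.arr 3 0 s) * σ₃.arr 9 s k)
    ((n₃ 0).trans hd) (fun τ h => by simp [NExp.eval, h, n₃, hs]) (fun k _ τ f₁ f₂ f₃ => by
      simp only [RExp.eval, NExp.eval, f₂, f₁ 6 (by simp), n₃, hs]
      rw [f₃ _ _ _ (by simp), f₃ _ _ _ (by simp), f₃ _ _ _ (by simp), f₃ _ _ _ (by simp)]
      simp [e₃, e₂, e₁, State.setArr, State.setRow])
  have k₄ : σ₄.nat 6 = s :=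
    (Cmd.run_nat_of_not_writes O 6 _ _ rfl).trans ((n₃ 6).trans hs)
  have p₄ : σ₄.point d 10 s = q - (ogdRate α G * σ.arr 3 0 s) • g q := by
    ext k
    rw [State.point_apply, a₄]
    simp [e₃, e₂, e₁, State.setArr, State.setRow, List.getD, hq, State.point_apply]
  have e₅ : (Cmd.query 2 10 (.var 6) 1 (.var 6)).run O σ₄ = σ₄.setRow 1 s
      (List.ofFn (proj K (q - (ogdRate α G * σ.arr 3 0 s) • g q)).ofLp) := by
    rw [run_query]
    simp only [NExp.eval, k₄, h2, p₄]
  rw [e₅]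
  refine ⟨Prod.ext ?_ ?_, fun s' hs' => ⟨?_, ?_⟩⟩
  · rw [point_setRow_ofFn]
    rfl
  · simp [State.setRow, a₄, e₃, e₂, State.setArr, ogdStep, hG]
  · ext k
    simp [State.setRow, hs', a₄, e₃, e₂, e₁, State.setArr]
  · ext k
    simp [State.setRow, hs', a₄, e₃, e₂, e₁, State.setArr]

/-- The state of a copy of online gradient descent. -/
def ogdState {d : ℕ} (K : Set (Pt d)) (α : ℝ) (q₁ : Pt d) (h : List ((Pt d → Pt d) × ℝ)) :
    Pt d × ℝ :=
  h.foldl (ogdStep K α) (q₁, 0)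

/-- The set `C` contains all iterates, so `row` has to round correctly only there; for
triangulations nothing is known about `perp` and `cell` outside `K`. -/
lemma ogdProgram_correct {d N : ℕ} (hN : 0 < N) {row : Cmd} (hrow : ∀ w < 2, row.writesN w = false)
    (hrow' : ∀ a ∈ [0, 1, 2, 8], row.writesA a = false) {K : Set (Pt d)} {α : ℝ}
    {pts q₁ : Fin N → Pt d} {H : Pt d → (Fin N → ℝ) → Prop} {O : Oracles d} {O' : ℕ → Oracles d}
    {g : ℕ → Pt d → Pt d} {T : ℕ}
    (h1 : ∀ t x, O' t 1 x = List.ofFn (g t x).ofLp)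
    (h2 : ∀ t x, O' t 2 x = List.ofFn (proj K x).ofLp)
    (C : Set (Pt d)) (hq₁ : ∀ s, q₁ s ∈ C) (hproj : ∀ z, proj K z ∈ C)
    (hH : ∀ q z, H q z → z ∈ stdSimplex ℝ (Fin N))
    (hc : ∀ (s : Fin N) (τ : State), τ.nat 0 = d → τ.nat 1 = N → τ.nat 6 = s →
      (∀ i : Fin N, τ.point d 0 i = pts i) → τ.point d 1 s ∈ C →
      H (τ.point d 1 s) (fun j : Fin N => (row.run O τ).arr 6 s j) ∧
        ∀ s', s' ≠ (s : ℕ) → (row.run O τ).arr 6 s' = τ.arr 6 s') :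
    IsRunConvex (fun s => ogd K α (q₁ s)) H g T
      ((ogdProgram row).play O O' (inputState pts q₁ α) N) := by
  set σ := inputState pts q₁ α with hσ
  obtain ⟨S, hS, hS0, hS1⟩ := (ogdProgram row).exists_state O O' σ
  obtain ⟨x, hx, hxt⟩ : ∃ x, x = (ogdProgram row).play O O' σ N ∧
      ∀ t (i : Fin N), x t i = ((ogdProgram row).act.run O (S t)).arr 3 0 i :=
    ⟨_, rfl, fun t i => by rw [OnlineProgram.play_eq, hS]⟩
  rw [← hx]
  have an : ∀ w < 2, (ogdProgram row).act.writesN w = false := by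
    intro w hw
    have := hrow w hw
    interval_cases w <;> simp [ogdProgram, Cmd.writesN, this] <;> rfl
  have aa : ∀ a ∈ [0, 1, 2, 8], (ogdProgram row).act.writesA a = false := by
    intro a ha
    have := hrow' a ha
    simp only [ogdProgram, Cmd.writesA, this, Bool.false_or]
    fin_cases ha <;> rfl
  have hinv : ∀ t, (S t).nat 0 = d ∧ (S t).nat 1 = N ∧ (S t).arr 0 = σ.arr 0 ∧
      (S t).arr 2 = σ.arr 2 ∧ ∀ s : Fin N, (S t).point d 1 s ∈ C ∧
        ((S t).point d 1 s, (S t).arr 8 s 0) = ogdState K α (q₁ s) (history g x s t) := by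
    intro t
    induction t with
    | zero =>
      rw [hS0]
      refine ⟨rfl, rfl, rfl, rfl, fun s => ?_⟩
      have : σ.point d 1 s = q₁ s := point_inputState_start _ _ _ _
      rw [this]
      exact ⟨hq₁ s, by simp [hσ, inputState, history, ogdState]⟩
    | succ t ih =>
      obtain ⟨h₁, h₂, h₃, h₄, h₅⟩ := ih
      rw [hS1]
      obtain ⟨τ, hτ⟩ : ∃ τ, τ = (ogdProgram row).act.run O (S t) := ⟨_, rfl⟩
      rw [← hτ]
      have n₀ : τ.nat 0 = d := by
        rw [hτ, Cmd.run_nat_of_not_writes O 0 (ogdProgram row).act _ (an 0 (by simp)), h₁]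
      have n₁ : τ.nat 1 = N := by
        rw [hτ, Cmd.run_nat_of_not_writes O 1 (ogdProgram row).act _ (an 1 (by simp)), h₂]
      have b : ∀ a ∈ [0, 1, 2, 8], τ.arr a = (S t).arr a := fun a ha => by
        rw [hτ, Cmd.run_arr_of_not_writes O a (ogdProgram row).act _ (aa a ha)]
      refine ⟨?_, ?_, ?_, ?_, fun s => ?_⟩
      · rw [Cmd.run_nat_of_not_writes _ 0 (ogdProgram row).update _ rfl, n₀]
      · rw [Cmd.run_nat_of_not_writes _ 1 (ogdProgram row).update _ rfl, n₁]
      · rw [Cmd.run_arr_of_not_writes _ 0 (ogdProgram row).update _ rfl, b 0 (by simp), h₃]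
      · rw [Cmd.run_arr_of_not_writes _ 2 (ogdProgram row).update _ rfl, b 2 (by simp), h₄]
      have key := run_rows (O' t) (c := ogdRow) n₁ (fun b => b = 1 ∨ b = 8)
        (fun s b r => ∃ y : Pt d × ℝ, (∀ k : Fin d, b = 1 → r k = y.1 k) ∧ (b = 8 → r 0 = y.2) ∧
          y = ogdStep K α (τ.point d 1 s, τ.arr 8 s 0) (g t, τ.arr 3 0 s)) rfl rfl (by
          intro s _ τ' f₀ f₁ f₆ fa fb
          obtain ⟨r₁, r₂⟩ := run_ogdRow (O' t) (K := K) (h1 t) (h2 t) (f₀.trans n₀) f₆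
          have p : τ'.point d 1 s = τ.point d 1 s := by
            simp only [State.point, fb 1 (Or.inl rfl)]
          have hα : τ'.arr 2 0 0 = α := by
            rw [fa 2 rfl, b 2 (by simp), h₄]
            simp [hσ, inputState]
          rw [p, fb 8 (Or.inr rfl), hα, fa 3 rfl] at r₁
          rintro b' (rfl | rfl)
          · exact ⟨⟨_, fun k _ => by rw [← r₁]; rfl, by simp, rfl⟩, fun s' hs' => (r₂ s' hs').1⟩
          · exact ⟨⟨_, by simp, fun _ => by rw [← r₁], rfl⟩, fun s' hs' => (r₂ s' hs').2⟩)
      obtain ⟨y, y₁, -, hy⟩ := key s s.2 1 (Or.inl rfl)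
      obtain ⟨y', -, y₂, hy'⟩ := key s s.2 8 (Or.inr rfl)
      have e₁ : ((ogdProgram row).update.run (O' t) τ).point d 1 s = y.1 := by
        ext k
        exact y₁ k rfl
      have e₂ : ((ogdProgram row).update.run (O' t) τ).arr 8 s 0 = y.2 := by
        rw [hy, ← hy']
        exact y₂ rfl
      refine ⟨?_, ?_⟩
      · rw [e₁, hy]
        exact hproj _
      · have p : τ.point d 1 s = (S t).point d 1 s := by
          simp only [State.point, b 1 (by simp)]
        rw [e₁, e₂, Prod.mk.eta, hy, ogdState, history_succ, List.foldl_append, ← ogdState,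
          ← (h₅ s).2, p, b 8 (by simp), hτ, ← hxt]
        rfl
  intro t _
  obtain ⟨h₁, h₂, h₃, h₄, h₅⟩ := hinv t
  obtain ⟨τ, hτ⟩ : ∃ τ, τ = (Cmd.loop 6 (.var 1) row).run O (S t) := ⟨_, rfl⟩
  have hrows : ∀ s : Fin N, H (ogd K α (q₁ s) (history g x s t)) (fun j : Fin N => τ.arr 6 s j) := by
    have key := run_rows O (c := row) h₂ (fun b => b = 6)
      (fun s _ r => ∀ h : s < N, H ((S t).point d 1 s) (fun j : Fin N => r j))
      (hrow 0 (by simp)) (hrow 1 (by simp)) (by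
        rintro s hs τ' f₀ f₁ f₆ fa - b rfl
        have p : ∀ i, τ'.point d 1 i = (S t).point d 1 i := fun i => by
          simp only [State.point, fa 1 (hrow' 1 (by simp))]
        obtain ⟨r₁, r₂⟩ := hc ⟨s, hs⟩ τ' (f₀.trans h₁) f₁ f₆ (fun i => by
          rw [← point_inputState pts q₁ α i]
          simp only [State.point, fa 0 (hrow' 0 (by simp)), h₃, hσ]) (by
          rw [p]
          exact (h₅ ⟨s, hs⟩).1)
        exact ⟨fun _ => by rw [← p]; exact r₁, r₂⟩)
    intro s
    have := key s s.2 6 rfl s.2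
    rw [← hτ] at this
    rwa [show (S t).point d 1 s = ogd K α (q₁ s) (history g x s t) from
      congrArg Prod.fst (h₅ s).2] at this
  refine ⟨fun s j => τ.arr 6 s j, hrows, ?_⟩
  have hQ := fun s => hH _ _ (hrows s)
  rw [show x t = _ from funext (hxt t)]
  have n₁ : τ.nat 1 = N := by
    rw [hτ, Cmd.run_nat_of_not_writes O 1 (Cmd.loop 6 (.var 1) row) _ (by
      simp [Cmd.writesN, hrow 1 (by simp)]), h₂]
  simp only [show (ogdProgram row).act = .seq (.loop 6 (.var 1) row) statCmd from rfl, run_seq,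
    ← hτ]
  exact run_statCmd O n₁ hN (fun s j => rfl)
    (fun s j => (hQ s).1 j) (fun s => (hQ s).2)

lemma sqDist_eq {d : ℕ} (σ : State) (s j : ℕ) :
    σ.sqDist d s j = dist (σ.point d 1 s) (σ.point d 0 j) ^ 2 := by
  rw [EuclideanSpace.dist_eq, Real.sq_sqrt (Finset.sum_nonneg fun _ _ => sq_nonneg _),
    State.sqDist, Finset.sum_range]
  refine Finset.sum_congr rfl fun k _ => ?_
  rw [Real.dist_eq, sq_abs, sq]
  rfl

lemma nearestRow_correct {d N : ℕ} (O : Oracles d) {pts : Fin N → Pt d} (s : Fin N) (τ : State)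
    (hd : τ.nat 0 = d) (hN : τ.nat 1 = N) (h6 : τ.nat 6 = s)
    (hpts : ∀ i : Fin N, τ.point d 0 i = pts i) :
    NearestRounding pts (τ.point d 1 s) (fun j : Fin N => (nearestRow.run O τ).arr 6 s j) ∧
      ∀ s', s' ≠ (s : ℕ) → (nearestRow.run O τ).arr 6 s' = τ.arr 6 s' := by
  obtain ⟨b, hb, hmin, ha⟩ := run_nearestRow O hd hN h6 s.pos
  refine ⟨⟨⟨b, hb⟩, fun j => ?_, ?_⟩, fun s' hs' => ?_⟩
  · have := hmin j j.2
    rw [sqDist_eq, sqDist_eq, hpts j, hpts ⟨b, hb⟩] at this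
    exact (pow_le_pow_iff_left₀ dist_nonneg dist_nonneg two_ne_zero).1 this
  · ext j
    simp [ha, Pi.single_apply, Fin.ext_iff]
  · ext j
    simp [ha, hs']

/-! ### From external regret to full swap regret -/

lemma expLoss_add {d : ℕ} (l : Pt d → ℝ) (p q : Pt d →₀ ℝ) :
    expLoss l (p + q) = expLoss l p + expLoss l q :=
  Finsupp.sum_add_index' (by simp) (by simp [add_mul])

lemma expLoss_mixture {d N : ℕ} (l : Pt d → ℝ) (pts : Fin N → Pt d) (w : Fin N → ℝ) :
    expLoss l (mixture pts w) = ∑ i, w i * l (pts i) := by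
  let F : (Pt d →₀ ℝ) →+ ℝ :=
    { toFun := expLoss l, map_zero' := Finsupp.sum_zero_index, map_add' := expLoss_add l }
  change F (∑ i, Finsupp.single (pts i) (w i)) = _
  rw [map_sum]
  refine Finset.sum_congr rfl fun i _ => ?_
  change expLoss l (Finsupp.single (pts i) (w i)) = _
  rw [expLoss, Finsupp.sum_single_index (by simp)]

lemma mapDomain_mixture {d N : ℕ} (φ : Pt d → Pt d) (pts : Fin N → Pt d) (w : Fin N → ℝ) :
    Finsupp.mapDomain φ (mixture pts w) = mixture (fun i => φ (pts i)) w := by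
  simp [mixture, Finsupp.mapDomain_finsetSum, Finsupp.mapDomain_single]

/-- If all plays are stationary, the full swap regret is bounded by the sum of the external regrets
of the copies. -/
lemma fullSwapReg_le {d N T : ℕ} {K : Set (Pt d)} {pts : Fin N → Pt d} (hpts : ∀ i, pts i ∈ K)
    {x : ℕ → Fin N → ℝ} {l : ℕ → Pt d → ℝ} {Q : ℕ → Fin N → Fin N → ℝ}
    (hx : ∀ t < T, IsStationary (Matrix.of (Q t)) (x t)) {B : ℝ}
    (hB : ∀ u : Fin N → Pt d, (∀ s, u s ∈ K) →
      ∑ s, ∑ t ∈ Finset.range T, x t s * (∑ j, Q t s j * l t (pts j) - l t (u s)) ≤ B) :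
    fullSwapReg K T (fun t => mixture pts (x t)) l ≤ (B : EReal) := by
  refine iSup_le fun φ => EReal.coe_le_coe_iff.2 ((le_of_eq ?_).trans
    (hB (fun s => φ.1 (pts s)) fun s => φ.2 (hpts s)))
  rw [Finset.sum_comm]
  refine Finset.sum_congr rfl fun t ht => ?_
  rw [mapDomain_mixture, expLoss_mixture, expLoss_mixture, ← Finset.sum_sub_distrib]
  have hst := (hx t (Finset.mem_range.1 ht)).2
  -- The only place where stationarity enters: the mass at `j` is what all copies together send to
  -- `j`.
  have : ∑ j, x t j * l t (pts j) = ∑ s, x t s * ∑ j, Q t s j * l t (pts j) := by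
    calc ∑ j, x t j * l t (pts j) = ∑ j, (∑ s, x t s * Q t s j) * l t (pts j) := by
          refine Finset.sum_congr rfl fun j _ => ?_
          rw [← congrFun hst j]
          rfl
      _ = _ := by
          simp only [Finset.sum_mul, Finset.mul_sum]
          rw [Finset.sum_comm]
          simp only [mul_assoc]
  rw [Finset.sum_sub_distrib, this, ← Finset.sum_sub_distrib]
  exact Finset.sum_congr rfl fun s _ => by ring

/-! ### External regret of multiplicative weights -/

/-- The product of `1 + y + y ^ 2 / 2` and `1 - y + y ^ 2 / 2` is `1 + y ^ 4 / 4`, which is at least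
1. -/
lemma exp_neg_le {y : ℝ} (hy : 0 ≤ y) : Real.exp (-y) ≤ 1 - y + y ^ 2 / 2 := by
  have h := Real.quadratic_le_exp_of_nonneg hy
  have hpos : (0 : ℝ) < 1 + y + y ^ 2 / 2 := by positivity
  rw [Real.exp_neg]
  calc (Real.exp y)⁻¹ ≤ (1 + y + y ^ 2 / 2)⁻¹ := inv_anti₀ hpos h
    _ ≤ 1 - y + y ^ 2 / 2 := by
      rw [inv_le_iff_one_le_mul₀ hpos]
      nlinarith [sq_nonneg (y ^ 2)]

/-- Subtracting the minimum of `v` makes all exponents nonpositive, so the quadratic bound on the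
exponential applies without any restriction on `η * M`. Only the range of the losses matters, not
their size. -/
lemma sum_exp_mul_le {N : ℕ} (hN : 0 < N) {η M : ℝ} (hη : 0 ≤ η) {Q v : Fin N → ℝ}
    (hQ : Q ∈ stdSimplex ℝ (Fin N)) (hv : ∀ i j, v i - v j ≤ M) :
    ∑ j, Q j * Real.exp (-η * v j) ≤ Real.exp (-η * ∑ j, Q j * v j + η ^ 2 * M ^ 2 / 2) := by
  have : Nonempty (Fin N) := ⟨⟨0, hN⟩⟩
  obtain ⟨i, hi⟩ := Finite.exists_min v
  calc ∑ j, Q j * Real.exp (-η * v j)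
      = Real.exp (-η * v i) * ∑ j, Q j * Real.exp (-(η * (v j - v i))) := by
        rw [Finset.mul_sum]
        refine Finset.sum_congr rfl fun j _ => ?_
        rw [mul_left_comm, ← Real.exp_add]
        ring_nf
    _ ≤ Real.exp (-η * v i) * ∑ j, Q j * (1 - η * (v j - v i) + η ^ 2 * M ^ 2 / 2) := by
        refine mul_le_mul_of_nonneg_left (Finset.sum_le_sum fun j _ => ?_) (Real.exp_pos _).le
        have h0 : 0 ≤ v j - v i := sub_nonneg.2 (hi j)
        refine mul_le_mul_of_nonneg_left ((exp_neg_le (mul_nonneg hη h0)).trans ?_) (hQ.1 j)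
        have := mul_le_mul_of_nonneg_left (pow_le_pow_left₀ h0 (hv j i) 2) (sq_nonneg η)
        rw [mul_pow]
        linarith
    _ = Real.exp (-η * v i) * (1 - η * (∑ j, Q j * v j - v i) + η ^ 2 * M ^ 2 / 2) := by
        congr 1
        have e : ∀ j, Q j * (1 - η * (v j - v i) + η ^ 2 * M ^ 2 / 2) =
            (1 + η * v i + η ^ 2 * M ^ 2 / 2) * Q j - η * (Q j * v j) := fun j => by ring
        simp only [e, Finset.sum_sub_distrib, ← Finset.mul_sum, hQ.2]
        ring
    _ ≤ Real.exp (-η * v i) * Real.exp (-η * (∑ j, Q j * v j - v i) + η ^ 2 * M ^ 2 / 2) := by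
        refine mul_le_mul_of_nonneg_left ?_ (Real.exp_pos _).le
        have := Real.add_one_le_exp (-η * (∑ j, Q j * v j - v i) + η ^ 2 * M ^ 2 / 2)
        linarith
    _ = _ := by
        rw [← Real.exp_add]
        ring_nf

lemma mwu_mem_stdSimplex {d N : ℕ} (hN : 0 < N) (η : ℝ) (pts : Fin N → Pt d)
    (h : List ((Pt d → ℝ) × ℝ)) : mwu η pts h ∈ stdSimplex ℝ (Fin N) :=
  ⟨mwu_nonneg η pts h, sum_mwu hN η pts h⟩

/-- External regret of a copy of multiplicative weights. -/
lemma mwu_regret_le {d N T : ℕ} (hN : 0 < N) {η L : ℝ} (hη : 0 ≤ η)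
    {pts : Fin N → Pt d} {l : ℕ → Pt d → ℝ} {x : ℕ → Fin N → ℝ}
    (hx : ∀ t < T, x t ∈ stdSimplex ℝ (Fin N))
    (hl : ∀ t < T, ∀ i j, l t (pts i) - l t (pts j) ≤ L) (s i : Fin N) :
    η * ∑ t ∈ Finset.range T, x t s *
      (∑ j, mwu η pts (history l x s t) j * l t (pts j) - l t (pts i)) ≤
      Real.log N + η ^ 2 * L ^ 2 / 2 * ∑ t ∈ Finset.range T, x t s := by
  have hL : 0 ≤ L ∨ T = 0 := by
    rcases Nat.eq_zero_or_pos T with h | h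
    · exact Or.inr h
    · left
      simpa using hl 0 h i i
  rcases hL with hL | rfl
  swap
  · simpa using Real.log_natCast_nonneg N
  set S : ℕ → Fin N → ℝ := fun t j => ((history l x s t).map fun a => a.2 * a.1 (pts j)).sum
    with hS
  set p : ℕ → ℝ := fun t => x t s * ∑ j, mwu η pts (history l x s t) j * l t (pts j) with hp
  have hS1 : ∀ t j, S (t + 1) j = S t j + x t s * l t (pts j) := by
    intro t j
    simp [hS, history_succ]
  -- The usual potential: the sum of the weights shrinks in each round by a factor governed by the
  -- loss `p t` of the copy, and in the end it dominates the weight of `i` alone.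
  have key : ∀ t ≤ T, ∑ j, Real.exp (-η * S t j) ≤ N * Real.exp (-η * ∑ τ ∈ Finset.range t, p τ +
      η ^ 2 * L ^ 2 / 2 * ∑ τ ∈ Finset.range t, x τ s) := by
    intro t
    induction t with
    | zero => intro _; simp [hS, history]
    | succ t ih =>
      intro ht
      have ht' : t < T := ht
      have x0 := (hx t ht').1 s
      have x1 : x t s ≤ 1 := by
        rw [← (hx t ht').2]
        exact Finset.single_le_sum (fun i _ => (hx t ht').1 i) (Finset.mem_univ s)
      have hZ : 0 < ∑ j, Real.exp (-η * S t j) :=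
        Finset.sum_pos (fun _ _ => Real.exp_pos _) ⟨i, Finset.mem_univ _⟩
      have e := sum_exp_mul_le hN hη (mwu_mem_stdSimplex hN η pts (history l x s t))
        (v := fun j => x t s * l t (pts j)) (M := x t s * L) (fun i j => by
          rw [← mul_sub]; exact mul_le_mul_of_nonneg_left (hl t ht' i j) x0)
      calc ∑ j, Real.exp (-η * S (t + 1) j)
          = (∑ j, Real.exp (-η * S t j)) *
              ∑ j, mwu η pts (history l x s t) j * Real.exp (-η * (x t s * l t (pts j))) := by
            rw [Finset.mul_sum]
            refine Finset.sum_congr rfl fun j _ => ?_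
            have hm : mwu η pts (history l x s t) j =
              Real.exp (-η * S t j) / ∑ j, Real.exp (-η * S t j) := rfl
            rw [hS1, mul_add, Real.exp_add, hm, ← mul_assoc (∑ j, Real.exp (-η * S t j)),
              mul_div_cancel₀ _ hZ.ne']
        _ ≤ (N * Real.exp (-η * ∑ τ ∈ Finset.range t, p τ +
              η ^ 2 * L ^ 2 / 2 * ∑ τ ∈ Finset.range t, x τ s)) *
              Real.exp (-η * p t + η ^ 2 * L ^ 2 / 2 * x t s) := by
            refine mul_le_mul (ih ht'.le) (e.trans (Real.exp_le_exp.2 ?_))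
              (Finset.sum_nonneg fun j _ => mul_nonneg (mwu_nonneg _ _ _ _) (Real.exp_pos _).le)
              (by positivity)
            have e₁ : ∑ j, mwu η pts (history l x s t) j * (x t s * l t (pts j)) = p t := by
              simp only [hp, Finset.mul_sum]
              exact Finset.sum_congr rfl fun _ _ => by ring
            rw [e₁, mul_pow]
            -- A scale in `[0, 1]` makes the second-order term linear in the scale; summed over the
            -- copies it then contributes `T` and not `N * T`.
            have : x t s ^ 2 ≤ x t s := by nlinarith
            have := mul_le_mul_of_nonneg_left this (by positivity : 0 ≤ η ^ 2 * L ^ 2 / 2)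
            linarith
        _ = _ := by
            rw [mul_assoc, ← Real.exp_add, Finset.sum_range_succ, Finset.sum_range_succ]
            ring_nf
  have hST : ∀ t, S t i = ∑ τ ∈ Finset.range t, x τ s * l τ (pts i) := by
    intro t
    induction t with
    | zero => simp [hS, history]
    | succ t ih => rw [hS1, ih, Finset.sum_range_succ]
  have h1 := (Finset.single_le_sum (f := fun j => Real.exp (-η * S T j))
    (fun j _ => (Real.exp_pos _).le) (Finset.mem_univ i)).trans (key T le_rfl)
  have hN' : (0 : ℝ) < N := Nat.cast_pos.2 hN
  have h2 := Real.log_le_log (Real.exp_pos _) h1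
  rw [Real.log_exp, Real.log_mul hN'.ne' (Real.exp_pos _).ne', Real.log_exp, hST] at h2
  simp only [mul_sub, Finset.sum_sub_distrib]
  simp only [hp] at h2
  linarith

/-- Full swap regret of Blum–Mansour with multiplicative weights, if the discretization dominates
every point of `K` up to `δ`. -/
lemma fullSwapReg_mwu_le {d N T : ℕ} (hT : 0 < T) (hN : 0 < N) {L : ℝ≥0} (hL : 0 < L)
    {K : Set (Pt d)} {pts : Fin N → Pt d} (hpts : ∀ i, pts i ∈ K) {l : ℕ → Pt d → ℝ}
    (hl : ∀ t < T, ∀ i j, l t (pts i) - l t (pts j) ≤ L) {δ : ℝ}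
    (hδ : ∀ u ∈ K, ∃ w ∈ stdSimplex ℝ (Fin N), ∀ t < T, ∑ j, w j * l t (pts j) ≤ l t u + δ)
    {x : ℕ → Fin N → ℝ} (hx : IsRunNonconvex (mwu (mwuRate L T N) pts) l T x) :
    fullSwapReg K T (fun t => mixture pts (x t)) l ≤
      ((2 * L * √(T * (N * Real.log N)) + δ * T : ℝ) : EReal) := by
  refine fullSwapReg_le hpts hx fun u hu => ?_
  set η := mwuRate L T N with hη
  have hη0 : 0 ≤ η := by rw [hη, mwuRate]; positivity
  set Q : ℕ → Fin N → Fin N → ℝ := fun t s => mwu η pts (history l x s t) with hQ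
  have hxs : ∀ t < T, x t ∈ stdSimplex ℝ (Fin N) := fun t ht => (hx t ht).1
  choose w hw hwl using fun s => hδ (u s) (hu s)
  have hLr : (0 : ℝ) < L := hL
  have hTr : (0 : ℝ) < T := Nat.cast_pos.2 hT
  have hsumx : ∑ s, ∑ t ∈ Finset.range T, x t s = T := by
    rw [Finset.sum_comm, Finset.sum_congr rfl fun t ht => (hxs t (Finset.mem_range.1 ht)).2]
    simp
  -- comparison with a point of the discretization
  have hcmp : ∀ i : Fin N → Fin N, ∑ s, ∑ t ∈ Finset.range T,
      x t s * (∑ j, Q t s j * l t (pts j) - l t (pts (i s))) ≤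
        2 * L * √(T * (N * Real.log N)) := by
    intro i
    -- For `N = 1` the learning rate is 0 and cannot be divided by, but then the single point is
    -- always played and the regret is zero.
    rcases Nat.lt_or_ge 1 N with hN1 | hN1
    · have hlog : 0 < Real.log N := Real.log_pos (by exact_mod_cast hN1)
      have hNr : (0 : ℝ) < N := Nat.cast_pos.2 hN
      have hη1 : 0 < η := by rw [hη, mwuRate]; positivity
      have hs := Finset.sum_le_sum fun s (_ : s ∈ Finset.univ) =>
        mwu_regret_le (L := L) hN hη0 hxs hl s (i s)
      rw [← Finset.mul_sum, Finset.sum_add_distrib, ← Finset.mul_sum, hsumx] at hs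
      simp only [Finset.sum_const, Finset.card_univ, Fintype.card_fin, nsmul_eq_mul] at hs
      set A : ℝ := N * Real.log N with hA
      have hA0 : 0 < A := by positivity
      have e₁ : η * L = √(A / T) := by
        rw [hη, mwuRate, div_mul_cancel₀ _ hLr.ne']
      have e₂ : η ^ 2 * L ^ 2 = A / T := by
        rw [← mul_pow, e₁, Real.sq_sqrt (by positivity)]
      have e₃ : √(A / T) * √(T * A) = A := by
        rw [← Real.sqrt_mul (by positivity), show A / T * (T * A) = A ^ 2 by field_simp,
          Real.sqrt_sq hA0.le]
      rw [e₂] at hs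
      -- After multiplication by `η` the regret is at most `A + A / 2` and the claimed bound is `2 *
      -- A`.
      have e₄ : η * (2 * L * √(T * A)) = 2 * A := by
        calc η * (2 * L * √(T * A)) = 2 * (η * L * √(T * A)) := by ring
          _ = 2 * A := by rw [e₁, e₃]
      refine le_of_mul_le_mul_left (hs.trans ?_) hη1
      rw [e₄]
      have : A / T / 2 * T = A / 2 := by field_simp
      rw [this]
      linarith
    · have hN1' : N = 1 := le_antisymm hN1 hN
      subst hN1'
      have hz : ∀ (s : Fin 1) t, ∑ j, Q t s j * l t (pts j) - l t (pts (i s)) = 0 := by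
        intro s t
        have h1 : Q t s 0 = 1 := by
          have := sum_mwu hN η pts (history l x s t)
          simpa using this
        simp [h1, Subsingleton.elim (i s) 0]
      simp only [hz, mul_zero, Finset.sum_const_zero]
      positivity
  -- averaging over the comparators
  have hsum : ∑ s, ∑ t ∈ Finset.range T,
      x t s * (∑ j, Q t s j * l t (pts j) - ∑ i, w s i * l t (pts i)) ≤
        2 * L * √(T * (N * Real.log N)) := by
    -- The comparing distribution `w s` does not change over the rounds, so its cumulative loss is
    -- an average of those of single points and at least the smallest of them.
    have hbest : ∀ s, ∃ i, ∀ j, ∑ t ∈ Finset.range T, x t s * l t (pts i) ≤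
        ∑ t ∈ Finset.range T, x t s * l t (pts j) := fun s =>
      haveI : Nonempty (Fin N) := ⟨⟨0, hN⟩⟩
      Finite.exists_min _
    choose i hi using hbest
    refine le_trans (Finset.sum_le_sum fun s _ => ?_) (hcmp i)
    simp only [mul_sub, Finset.sum_sub_distrib]
    refine sub_le_sub_left ?_ _
    calc ∑ t ∈ Finset.range T, x t s * l t (pts (i s))
        = ∑ j, w s j * ∑ t ∈ Finset.range T, x t s * l t (pts (i s)) := by
          rw [← Finset.sum_mul, (hw s).2, one_mul]
      _ ≤ ∑ j, w s j * ∑ t ∈ Finset.range T, x t s * l t (pts j) :=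
          Finset.sum_le_sum fun j _ => mul_le_mul_of_nonneg_left (hi s j) ((hw s).1 j)
      _ = _ := by
          simp only [Finset.mul_sum]
          rw [Finset.sum_comm]
          exact Finset.sum_congr rfl fun t _ => Finset.sum_congr rfl fun j _ => by ring
  have hδT : ∑ s, ∑ t ∈ Finset.range T, x t s * δ = δ * T := by
    rw [← hsumx, mul_comm δ, Finset.sum_mul]
    simp only [Finset.sum_mul]
  rw [← hδT]
  refine le_trans ?_ (add_le_add_left hsum _)
  rw [← Finset.sum_add_distrib]
  refine Finset.sum_le_sum fun s _ => ?_
  rw [← Finset.sum_add_distrib]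
  refine Finset.sum_le_sum fun t ht => ?_
  have ht' := Finset.mem_range.1 ht
  rw [← mul_add]
  refine mul_le_mul_of_nonneg_left ?_ ((hxs t ht').1 s)
  have := hwl s t ht'
  linarith

/-! ### Projections -/

lemma proj_spec {d : ℕ} {K : Set (Pt d)} (hne : K.Nonempty) (hcl : IsClosed K) (z : Pt d) :
    proj K z ∈ K ∧ ∀ y ∈ K, dist z (proj K z) ≤ dist z y := by
  obtain ⟨p, hp, hpd⟩ := hcl.exists_infDist_eq_dist hne z
  exact Classical.epsilon_spec (p := fun p => p ∈ K ∧ ∀ y ∈ K, dist z p ≤ dist z y)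
    ⟨p, hp, fun y hy => hpd ▸ Metric.infDist_le_dist_of_mem hy⟩

lemma inner_sub_proj_le {d : ℕ} {K : Set (Pt d)} (hne : K.Nonempty) (hcl : IsClosed K)
    (hK : Convex ℝ K) (z : Pt d) {y : Pt d} (hy : y ∈ K) :
    inner ℝ (z - proj K z) (y - proj K z) ≤ 0 := by
  obtain ⟨hp, hmin⟩ := proj_spec hne hcl z
  refine (norm_eq_iInf_iff_real_inner_le_zero hK hp).1 ?_ y hy
  have : Nonempty K := ⟨⟨_, hp⟩⟩
  refine le_antisymm (le_ciInf fun w => ?_) (ciInf_le ⟨0, ?_⟩ (⟨_, hp⟩ : K))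
  · simpa [dist_eq_norm] using hmin w w.2
  · rintro _ ⟨w, rfl⟩
    exact norm_nonneg _

/-- The projection moves points closer to `K`. -/
lemma norm_proj_sub_le {d : ℕ} {K : Set (Pt d)} (hne : K.Nonempty) (hcl : IsClosed K)
    (hK : Convex ℝ K) (z : Pt d) {u : Pt d} (hu : u ∈ K) :
    ‖proj K z - u‖ ^ 2 ≤ ‖z - u‖ ^ 2 := by
  have h := inner_sub_proj_le hne hcl hK z hu
  have e : z - u = (z - proj K z) - (u - proj K z) := by abel
  rw [e, norm_sub_sq_real (z - proj K z), norm_sub_rev (proj K z) u]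
  nlinarith [sq_nonneg ‖z - proj K z‖]

/-! ### Subgradients -/

/-- The open cone below the graph of `l x - L * ‖p - x‖` is disjoint from the epigraph by the
Lipschitz property. A separating hyperplane passes through their common boundary point `(x, l x)`;
above the cone its slope is at most `L`, and below the epigraph it is a subgradient. The cone is
what bounds the norm also at boundary points of `K`. -/
lemma exists_isSubgradientMap {d : ℕ} {K : Set (Pt d)} {L : ℝ≥0} {l : Pt d → ℝ}
    (hl : LipschitzOnWith L l K) (hc : ConvexOn ℝ K l) : ∃ g, IsSubgradientMap K L l g := by
  suffices h : ∀ x ∈ K, ∃ g : Pt d, ‖g‖ ≤ L ∧ ∀ y ∈ K, 0 ≤ l y - l x - inner ℝ g (y - x) by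
    choose! g hg using h
    exact ⟨g, hg⟩
  intro x hx
  set A : Set (Pt d × ℝ) := {p | L * ‖p.1 - x‖ + p.2 < l x} with hA
  set B : Set (Pt d × ℝ) := {p | p.1 ∈ K ∧ l p.1 ≤ p.2} with hB
  have hAo : IsOpen A := isOpen_lt (by fun_prop) continuous_const
  have hAc : Convex ℝ A := by
    rintro ⟨p, a⟩ hp ⟨q, b⟩ hq s t hs ht hst
    simp only [hA, Set.mem_ofPred_eq, Prod.smul_mk, Prod.mk_add_mk, smul_eq_mul] at hp hq ⊢
    have e : s • p + t • q - x = s • (p - x) + t • (q - x) := by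
      have : x = s • x + t • x := by rw [← add_smul, hst, one_smul]
      nth_rewrite 1 [this]
      module
    have hn : ‖s • p + t • q - x‖ ≤ s * ‖p - x‖ + t * ‖q - x‖ := by
      rw [e]
      refine (norm_add_le _ _).trans (le_of_eq ?_)
      rw [norm_smul, norm_smul, Real.norm_of_nonneg hs, Real.norm_of_nonneg ht]
    have hn' := mul_le_mul_of_nonneg_left hn L.2
    have hx' : l x = s * l x + t * l x := by rw [← add_mul, hst, one_mul]
    rcases hs.eq_or_lt with rfl | hs
    · have : t = 1 := by linarith
      subst this
      simp only [zero_mul, zero_add, one_mul] at hn' ⊢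
      exact lt_of_le_of_lt (add_le_add_left hn' _) hq
    · have h₁ := mul_lt_mul_of_pos_left hp hs
      have h₂ := mul_le_mul_of_nonneg_left hq.le ht
      have hL : (L : ℝ) * (s * ‖p - x‖ + t * ‖q - x‖) =
        s * (L * ‖p - x‖) + t * (L * ‖q - x‖) := by ring
      change (L : ℝ) * _ ≤ L * _ at hn'
      rw [hL] at hn'
      linarith
  have hBc : Convex ℝ B := hc.convex_epigraph
  have hd : Disjoint A B := by
    rw [Set.disjoint_left]
    rintro ⟨p, a⟩ hp ⟨hpK, hpa⟩
    have := hl.dist_le_mul x hx p hpK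
    rw [Real.dist_eq, dist_comm, dist_eq_norm] at this
    have := (abs_le.1 this).2
    simp only [hA, Set.mem_ofPred_eq] at hp hpa
    linarith
  obtain ⟨f, u, hfA, hfB⟩ := geometric_hahn_banach_open hAc hAo hBc hd
  set c := f (0, 1) with hcdef
  have hf : ∀ p a, f (p, a) = f (p, 0) + a * c := by
    intro p a
    rw [hcdef, ← smul_eq_mul, ← map_smul, ← map_add]
    simp
  have hxB := hfB (x, l x) ⟨hx, le_rfl⟩
  -- The hyperplane is not vertical: it separates `(x, l x)` from a point directly below it in the
  -- cone.
  have hc0 : 0 < c := by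
    have := hfA (x, l x - 1) (by simp [hA])
    rw [hf] at this hxB
    linarith
  -- the separating hyperplane passes through `(x, l x)`
  have hA' : ∀ p, f (p, 0) + (l x - L * ‖p - x‖) * c ≤ u := by
    intro p
    refine le_of_forall_pos_le_add fun δ hδ => ?_
    have := hfA (p, l x - L * ‖p - x‖ - δ / c) (by
      have : 0 < δ / c := div_pos hδ hc0
      simp only [hA, Set.mem_ofPred_eq]
      linarith)
    rw [hf, sub_mul _ (δ / c), div_mul_cancel₀ _ hc0.ne'] at this
    linarith
  have hu : u = f (x, 0) + l x * c := by
    refine le_antisymm ?_ ?_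
    · rw [← hf]; exact hxB
    · simpa using hA' x
  let φ : StrongDual ℝ (Pt d) := f.comp (ContinuousLinearMap.inl ℝ (Pt d) ℝ)
  obtain ⟨v, hv⟩ := (InnerProductSpace.toDual ℝ (Pt d)).surjective φ
  have hv' : ∀ p, inner ℝ v p = f (p, 0) := by
    intro p
    rw [← InnerProductSpace.toDual_apply_apply (𝕜 := ℝ), hv]
    rfl
  have hsub : ∀ p, inner ℝ v (p - x) = f (p, 0) - f (x, 0) := by
    intro p
    rw [inner_sub_right, hv', hv']
  have hg : ∀ p, inner ℝ (-(c⁻¹ • v)) (p - x) = (f (x, 0) - f (p, 0)) / c := by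
    intro p
    rw [inner_neg_left, real_inner_smul_left, hsub]
    field_simp
    ring
  refine ⟨-(c⁻¹ • v), ?_, fun y hy => ?_⟩
  · set g := -(c⁻¹ • v) with hgdef
    -- In the direction `-g` the cone condition reads `‖g‖ ^ 2 ≤ L * ‖g‖`.
    have h := hA' (x - g)
    rw [hu] at h
    have h' := hg (x - g)
    have e : x - g - x = -g := by abel
    rw [e, norm_neg] at h
    rw [e, inner_neg_right, real_inner_self_eq_norm_sq, eq_div_iff hc0.ne'] at h'
    have h'' : (‖g‖ ^ 2 - L * ‖g‖) * c ≤ 0 := by nlinarith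
    have h3 : ‖g‖ ^ 2 - L * ‖g‖ ≤ 0 := by
      by_contra hcon
      exact absurd h'' (not_le.2 (mul_pos (not_le.1 hcon) hc0))
    rcases (norm_nonneg g).eq_or_lt with h0 | h0
    · rw [← h0]; exact L.2
    · nlinarith
  · have h := hfB (y, l y) ⟨hy, le_rfl⟩
    rw [hf, hu] at h
    rw [hg]
    have : (f (x, 0) - f (y, 0)) / c ≤ l y - l x := by
      rw [div_le_iff₀ hc0]
      linarith
    linarith

/-- A subgradient of a strongly convex function gives a quadratic lower bound. -/
lemma StrongConvexOn.quadratic_le_of_subgradient {d : ℕ} {K : Set (Pt d)} {α : ℝ} {l : Pt d → ℝ}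
    (hl : StrongConvexOn K α l) {x y g : Pt d} (hx : x ∈ K) (hy : y ∈ K)
    (hg : ∀ y ∈ K, 0 ≤ l y - l x - inner ℝ g (y - x)) :
    l x - l y ≤ inner ℝ g (x - y) - α / 2 * ‖x - y‖ ^ 2 := by
  -- Strong convexity is compared with the subgradient inequality at a point of the segment from `x`
  -- to `y`; after division by `s` the limit at 0 is the claim.
  have key : ∀ s ∈ Set.Ioo (0 : ℝ) 1,
      l x - l y - inner ℝ g (x - y) + (1 - s) * (α / 2 * ‖x - y‖ ^ 2) ≤ 0 := by
    rintro s ⟨hs0, hs1⟩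
    have h1 := hl.2 hx hy (by linarith : 0 ≤ 1 - s) hs0.le (by ring)
    have hm : (1 - s) • x + s • y ∈ K := hl.1 hx hy (by linarith) hs0.le (by ring)
    have h2 := hg _ hm
    have e : (1 - s) • x + s • y - x = s • (y - x) := by
      rw [sub_smul, one_smul, smul_sub]; abel
    rw [e, real_inner_smul_right, ← neg_sub x y, inner_neg_right] at h2
    simp only [smul_eq_mul] at h1
    have h3 : s * (l x - l y - inner ℝ g (x - y) + (1 - s) * (α / 2 * ‖x - y‖ ^ 2)) ≤ 0 := by
      nlinarith
    by_contra hcon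
    exact absurd h3 (not_le.2 (mul_pos hs0 (not_le.1 hcon)))
  have hlim : Filter.Tendsto (fun s : ℝ => l x - l y - inner ℝ g (x - y) +
      (1 - s) * (α / 2 * ‖x - y‖ ^ 2)) (nhdsWithin 0 (Set.Ioi 0))
      (nhds (l x - l y - inner ℝ g (x - y) + (1 - 0) * (α / 2 * ‖x - y‖ ^ 2))) :=
    (Continuous.tendsto (by fun_prop) 0).mono_left nhdsWithin_le_nhds
  have := le_of_tendsto hlim (Filter.mem_of_superset (Ioo_mem_nhdsGT one_pos) key)
  linarith

/-! ### Consequences of the normalization of the diameter -/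

lemma nonempty_of_diam {d : ℕ} {K : Set (Pt d)} (h : Metric.diam K = 1) : K.Nonempty := by
  rw [Set.nonempty_iff_ne_empty]
  rintro rfl
  simp at h

/-- Unbounded sets have `Metric.diam` equal to 0 by convention, so diameter 1 includes boundedness.
-/
lemma isBounded_of_diam {d : ℕ} {K : Set (Pt d)} (h : Metric.diam K = 1) :
    Bornology.IsBounded K := by
  by_contra hb
  rw [Metric.diam_eq_zero_of_unbounded hb] at h
  exact zero_ne_one h

lemma dist_le_one_of_diam {d : ℕ} {K : Set (Pt d)} (h : Metric.diam K = 1) {x y : Pt d}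
    (hx : x ∈ K) (hy : y ∈ K) : dist x y ≤ 1 :=
  h ▸ Metric.dist_le_diam_of_mem (isBounded_of_diam h) hx hy

lemma dim_pos_of_diam {d : ℕ} {K : Set (Pt d)} (h : Metric.diam K = 1) : 0 < d := by
  rcases Nat.eq_zero_or_pos d with rfl | hd
  · rw [Metric.diam_subsingleton (Set.subsingleton_of_subsingleton)] at h
    exact absurd h zero_ne_one
  · exact hd

/-- A strongly convex Lipschitz function on a set of diameter 1 has modulus at most `4 L`. -/
lemma modulus_le_of_lipschitz {d : ℕ} {K : Set (Pt d)} (h : Metric.diam K = 1) {L : ℝ≥0} {α : ℝ}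
    (hα : 0 < α) {l : Pt d → ℝ} (hl : LipschitzOnWith L l K) (hs : StrongConvexOn K α l) :
    α ≤ 4 * L := by
  refine le_of_forall_pos_lt_add fun δ hδ => ?_
  have hL : (0 : ℝ) ≤ L := L.2
  -- every pair of points has distance at most `4 L / α`
  have hd : ∀ x ∈ K, ∀ y ∈ K, dist x y ≤ 4 * L / α := by
    intro x hx y hy
    rw [le_div_iff₀ hα]
    -- At the midpoint strong convexity gains `α / 8 * dist x y ^ 2`, while the Lipschitz property
    -- allows at most `L * dist x y / 2`; this is the origin of the 4.
    have h1 := hs.2 hx hy (by norm_num : (0 : ℝ) ≤ 1 / 2) (by norm_num : (0 : ℝ) ≤ 1 / 2)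
      (by norm_num)
    have hm : (1 / 2 : ℝ) • x + (1 / 2 : ℝ) • y ∈ K :=
      hs.1 hx hy (by norm_num) (by norm_num) (by norm_num)
    have d1 := hl.dist_le_mul x hx _ hm
    have d2 := hl.dist_le_mul y hy _ hm
    have e1 : dist x ((1 / 2 : ℝ) • x + (1 / 2 : ℝ) • y) = dist x y / 2 := by
      rw [dist_eq_norm, dist_eq_norm, show x - ((1 / 2 : ℝ) • x + (1 / 2 : ℝ) • y) =
        (1 / 2 : ℝ) • (x - y) by module, norm_smul]
      norm_num
      ring
    have e2 : dist y ((1 / 2 : ℝ) • x + (1 / 2 : ℝ) • y) = dist x y / 2 := by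
      rw [dist_comm x y, dist_eq_norm, dist_eq_norm, show y - ((1 / 2 : ℝ) • x + (1 / 2 : ℝ) • y) =
        (1 / 2 : ℝ) • (y - x) by module, norm_smul]
      norm_num
      ring
    rw [e1, Real.dist_eq] at d1
    rw [e2, Real.dist_eq] at d2
    have d1' := (abs_le.1 d1).2
    have d2' := (abs_le.1 d2).2
    simp only [smul_eq_mul, ← dist_eq_norm] at h1
    have h3 : dist x y * (α * dist x y) ≤ dist x y * (4 * L) := by nlinarith
    rcases (dist_nonneg (x := x) (y := y)).eq_or_lt with h0 | h0
    · rw [← h0]; simp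
    · have := le_of_mul_le_mul_left h3 h0
      linarith
  have := Metric.diam_le_of_forall_dist_le (by positivity) hd
  rw [h, le_div_iff₀ hα] at this
  linarith

/-! ### External regret of online gradient descent -/

/-- An antiderivative of `1 / max 1 G`. -/
def logPotential (G : ℝ) : ℝ := if G ≤ 1 then G else 1 + Real.log G

/-- The integrand `1 / max 1 G` is nonincreasing, so its value at the right end of an interval,
times the length, is at most the integral. The cases are settled by `1 - y⁻¹ ≤ log y`. -/
lemma div_max_le_logPotential {a G : ℝ} (ha : 0 ≤ a) :
    a / max 1 (G + a) ≤ logPotential (G + a) - logPotential G := by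
  have hlog : ∀ {y : ℝ}, 0 < y → 1 - y⁻¹ ≤ Real.log y := fun hy => Real.one_sub_inv_le_log_of_pos hy
  unfold logPotential
  rcases le_or_gt (G + a) 1 with h | h
  · rw [max_eq_left h, if_pos h, if_pos (by linarith)]
    linarith
  · rw [max_eq_right h.le, if_neg (not_le.2 h)]
    have h0 : 0 < G + a := by linarith
    rcases le_or_gt G 1 with hG | hG
    · rw [if_pos hG]
      have h1 := hlog h0
      have h2 : a / (G + a) ≤ (1 - G) + (1 - (G + a)⁻¹) := by
        rw [div_le_iff₀ h0, add_mul, sub_mul (1 : ℝ) (G + a)⁻¹, inv_mul_cancel₀ h0.ne']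
        nlinarith
      linarith
    · rw [if_neg (not_le.2 hG)]
      have hG0 : 0 < G := by linarith
      have h1 := hlog (div_pos h0 hG0)
      rw [Real.log_div h0.ne' hG0.ne', inv_div] at h1
      have h2 : a / (G + a) = 1 - G / (G + a) := by field_simp; ring
      rw [h2]
      linarith

lemma logPotential_le {G T : ℝ} (hT : 1 ≤ T) (h : G ≤ T) : logPotential G ≤ 1 + Real.log T := by
  unfold logPotential
  have := Real.log_nonneg hT
  split_ifs with hG
  · linarith
  · have := Real.log_le_log (by linarith) h
    linarith

lemma ogdRate_eq (α G : ℝ) : ogdRate α G = 1 / (α * max 1 G) := by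
  unfold ogdRate
  split_ifs with h
  · rw [max_eq_left h, mul_one]
  · rw [max_eq_right (not_le.1 h).le]

/-- One step of online gradient descent. -/
lemma ogdStep_regret {d : ℕ} {K : Set (Pt d)} (hne : K.Nonempty) (hcl : IsClosed K)
    (hK : Convex ℝ K) {α : ℝ} (hα : 0 < α) {L : ℝ≥0} {l : Pt d → ℝ} {g : Pt d → Pt d}
    (hl : StrongConvexOn K α l) (hg : IsSubgradientMap K L l g) {q u : Pt d} (hq : q ∈ K)
    (hu : u ∈ K) {G a : ℝ} (ha0 : 0 ≤ a) (ha1 : a ≤ 1) :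
    a * (l q - l u) + α / 2 * (max 1 (G + a) * ‖(ogdStep K α (q, G) (g, a)).1 - u‖ ^ 2) ≤
      α / 2 * (max 1 G * ‖q - u‖ ^ 2) +
        L ^ 2 / (2 * α) * (logPotential (G + a) - logPotential G) := by
  set M := max 1 (G + a) with hM
  have hM1 : 1 ≤ M := le_max_left _ _
  have hM0 : 0 < M := by linarith
  set η := ogdRate α (G + a) with hη
  have hηM : η * (α * M) = 1 := by
    rw [hη, ogdRate_eq, one_div, inv_mul_cancel₀ (by positivity)]
  have hη0 : 0 ≤ η := by rw [hη, ogdRate_eq]; positivity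
  obtain ⟨hgL, hgs⟩ := hg q hq
  have h1 := StrongConvexOn.quadratic_le_of_subgradient hl hq hu hgs
  have h2 : ‖(ogdStep K α (q, G) (g, a)).1 - u‖ ^ 2 ≤
      ‖q - u‖ ^ 2 - 2 * (η * a) * inner ℝ (g q) (q - u) + (η * a) ^ 2 * L ^ 2 := by
    refine (norm_proj_sub_le hne hcl hK (q - (η * a) • g q) hu).trans ?_
    rw [show q - (η * a) • g q - u = (q - u) - (η * a) • g q by abel, norm_sub_sq_real,
      real_inner_smul_right, norm_smul, mul_pow, Real.norm_eq_abs, sq_abs, real_inner_comm]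
    have := mul_le_mul_of_nonneg_left (pow_le_pow_left₀ (norm_nonneg _) hgL 2) (sq_nonneg (η * a))
    linarith
  -- The weight of the squared distance grows by at most `a`, which is exactly what the quadratic
  -- term of strong convexity, scaled by `a`, pays for.
  have h3 : M ≤ max 1 G + a := by
    rw [hM]
    refine max_le ?_ ?_
    · have := le_max_left 1 G; linarith
    · have := le_max_right 1 G; linarith
  have h4 := mul_le_mul_of_nonneg_left (div_max_le_logPotential (G := G) ha0)
    (by positivity : 0 ≤ (L : ℝ) ^ 2 / (2 * α))
  rw [← hM] at h4
  have h5 : α / 2 * (M * ‖(ogdStep K α (q, G) (g, a)).1 - u‖ ^ 2) ≤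
      α / 2 * (M * ‖q - u‖ ^ 2) - a * inner ℝ (g q) (q - u) + L ^ 2 / (2 * α) * (a / M) := by
    have := mul_le_mul_of_nonneg_left h2 (by positivity : 0 ≤ α / 2 * M)
    have e1 : α / 2 * M * (2 * (η * a) * inner ℝ (g q) (q - u)) =
        (η * (α * M)) * (a * inner ℝ (g q) (q - u)) := by ring
    -- The scale is at most 1, so one of the two factors `a` can be dropped; the sum over the rounds
    -- is then logarithmic in the total scale.
    have e2 : α / 2 * M * ((η * a) ^ 2 * L ^ 2) ≤ L ^ 2 / (2 * α) * (a / M) := by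
      have e3 : η = 1 / (α * M) := ogdRate_eq _ _
      have e4 : α / 2 * M * ((η * a) ^ 2 * L ^ 2) = L ^ 2 / (2 * α) * (a / M) * a := by
        rw [e3]; field_simp
      rw [e4]
      exact mul_le_of_le_one_right (by positivity) ha1
    rw [hηM] at e1
    linarith
  have h6 := mul_le_mul_of_nonneg_left h1 ha0
  have h7 := mul_le_mul_of_nonneg_left
    (mul_le_mul_of_nonneg_right h3 (sq_nonneg ‖q - u‖)) (by positivity : 0 ≤ α / 2)
  linarith

lemma ogdState_history_succ {d N : ℕ} (K : Set (Pt d)) (α : ℝ) (q₁ : Pt d)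
    (g : ℕ → Pt d → Pt d) (x : ℕ → Fin N → ℝ) (s : Fin N) (t : ℕ) :
    ogdState K α q₁ (history g x s (t + 1)) =
      ogdStep K α (ogdState K α q₁ (history g x s t)) (g t, x t s) := by
  rw [history_succ, ogdState, List.foldl_append, ← ogdState]
  rfl

lemma ogd_mem {d N : ℕ} {K : Set (Pt d)} (hne : K.Nonempty) (hcl : IsClosed K) (α : ℝ) {q₁ : Pt d}
    (hq₁ : q₁ ∈ K) (g : ℕ → Pt d → Pt d) (x : ℕ → Fin N → ℝ) (s : Fin N) (t : ℕ) :
    ogd K α q₁ (history g x s t) ∈ K := by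
  cases t with
  | zero => simpa [ogd, history] using hq₁
  | succ t =>
    change (ogdState K α q₁ (history g x s (t + 1))).1 ∈ K
    rw [ogdState_history_succ]
    exact (proj_spec hne hcl _).1

/-- External regret of a copy of online gradient descent. -/
lemma ogd_regret_le {d N T : ℕ} {K : Set (Pt d)} (hdiam : Metric.diam K = 1) (hcl : IsClosed K)
    (hK : Convex ℝ K) {α : ℝ} (hα : 0 < α) {L : ℝ≥0} {l : ℕ → Pt d → ℝ} {g : ℕ → Pt d → Pt d}
    (hl : ∀ t < T, StrongConvexOn K α (l t)) (hg : ∀ t < T, IsSubgradientMap K L (l t) (g t))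
    {x : ℕ → Fin N → ℝ} (hx : ∀ t < T, x t ∈ stdSimplex ℝ (Fin N)) (hT : 1 ≤ T)
    {q₁ u : Pt d} (hq₁ : q₁ ∈ K) (hu : u ∈ K) (s : Fin N) :
    ∑ t ∈ Finset.range T, x t s * (l t (ogd K α q₁ (history g x s t)) - l t u) ≤
      α / 2 + L ^ 2 / (2 * α) * (1 + Real.log T) := by
  have hne := nonempty_of_diam hdiam
  set st : ℕ → Pt d × ℝ := fun t => ogdState K α q₁ (history g x s t) with hst
  have hq : ∀ t, (st t).1 ∈ K := fun t => ogd_mem hne hcl α hq₁ g x s t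
  have x1 : ∀ t < T, x t s ≤ 1 := by
    intro t ht
    rw [← (hx t ht).2]
    exact Finset.single_le_sum (fun i _ => (hx t ht).1 i) (Finset.mem_univ s)
  -- The one-step estimates telescope, with the squared distance weighted by the larger of 1 and the
  -- sum of scales; this weight starts at 1.
  have key : ∀ t ≤ T, (st t).2 ≤ t ∧ ∑ τ ∈ Finset.range t, x τ s * (l τ (st τ).1 - l τ u) +
      α / 2 * (max 1 (st t).2 * ‖(st t).1 - u‖ ^ 2) ≤
        α / 2 * ‖q₁ - u‖ ^ 2 + L ^ 2 / (2 * α) * logPotential (st t).2 := by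
    intro t
    induction t with
    | zero => intro _; simp [hst, ogdState, history, logPotential]
    | succ t ih =>
      intro ht
      have ht' : t < T := ht
      obtain ⟨ih₁, ih₂⟩ := ih ht'.le
      have e : st (t + 1) = ogdStep K α (st t) (g t, x t s) := ogdState_history_succ _ _ _ _ _ _ _
      have e2 : (st (t + 1)).2 = (st t).2 + x t s := by rw [e]; rfl
      have h := ogdStep_regret hne hcl hK hα (hl t ht') (hg t ht') (hq t) hu (G := (st t).2)
        ((hx t ht').1 s) (x1 t ht')
      refine ⟨?_, ?_⟩
      · rw [e2]
        push_cast
        have := x1 t ht'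
        linarith
      · rw [Finset.sum_range_succ, e2, e]
        rw [Prod.mk.eta] at h
        linarith
  obtain ⟨k₁, k₂⟩ := key T le_rfl
  have hT' : (1 : ℝ) ≤ T := by exact_mod_cast hT
  have h1 := mul_le_mul_of_nonneg_left (logPotential_le hT' k₁)
    (by positivity : 0 ≤ (L : ℝ) ^ 2 / (2 * α))
  have h2 : ‖q₁ - u‖ ^ 2 ≤ 1 := by
    rw [← dist_eq_norm]
    exact pow_le_one₀ dist_nonneg (dist_le_one_of_diam hdiam hq₁ hu)
  have h3 := mul_le_mul_of_nonneg_left h2 (by positivity : 0 ≤ α / 2)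
  have h4 : 0 ≤ α / 2 * (max 1 (st T).2 * ‖(st T).1 - u‖ ^ 2) := by positivity
  change ∑ t ∈ Finset.range T, x t s * (l t (st t).1 - l t u) ≤ _
  linarith

/-- Full swap regret of Blum–Mansour with online gradient descent, if rounding increases the loss
by at most `δ`. -/
lemma fullSwapReg_ogd_le {d N T : ℕ} {K : Set (Pt d)} (hdiam : Metric.diam K = 1)
    (hcl : IsClosed K) (hK : Convex ℝ K) {α : ℝ} (hα : 0 < α) {L : ℝ≥0} (hT : 1 ≤ T)
    {pts : Fin N → Pt d} (hpts : ∀ i, pts i ∈ K) {l : ℕ → Pt d → ℝ} {g : ℕ → Pt d → Pt d}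
    (hL : ∀ t < T, LipschitzOnWith L (l t) K) (hl : ∀ t < T, StrongConvexOn K α (l t))
    (hg : ∀ t < T, IsSubgradientMap K L (l t) (g t)) {q₁ : Fin N → Pt d} (hq₁ : ∀ s, q₁ s ∈ K)
    {H : Pt d → (Fin N → ℝ) → Prop} {δ : ℝ}
    (hH : ∀ q ∈ K, ∀ z, H q z → ∀ t < T, ∑ j, z j * l t (pts j) ≤ l t q + δ)
    {x : ℕ → Fin N → ℝ} (hx : IsRunConvex (fun s => ogd K α (q₁ s)) H g T x) :
    fullSwapReg K T (fun t => mixture pts (x t)) l ≤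
      ((N * (L ^ 2 / α * (9 + Real.log T)) + δ * T : ℝ) : EReal) := by
  have hne := nonempty_of_diam hdiam
  have hQ : ∀ t, ∃ Q : Fin N → Fin N → ℝ, t < T →
      (∀ s, H (ogd K α (q₁ s) (history g x s t)) (Q s)) ∧ IsStationary (Matrix.of Q) (x t) := by
    intro t
    by_cases ht : t < T
    · obtain ⟨Q, hQ⟩ := hx t ht
      exact ⟨Q, fun _ => hQ⟩
    · exact ⟨0, fun h => absurd h ht⟩
  choose Q hQ using hQ
  refine fullSwapReg_le hpts (fun t ht => (hQ t ht).2) fun u hu => ?_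
  have hxs : ∀ t < T, x t ∈ stdSimplex ℝ (Fin N) := fun t ht => (hQ t ht).2.1
  have hsumx : ∑ s, ∑ t ∈ Finset.range T, x t s = T := by
    rw [Finset.sum_comm, Finset.sum_congr rfl fun t ht => (hxs t (Finset.mem_range.1 ht)).2]
    simp
  have hαL := modulus_le_of_lipschitz hdiam hα (hL 0 hT) (hl 0 hT)
  have hlog : 0 ≤ Real.log T := Real.log_natCast_nonneg T
  -- Since `α ≤ 4 * L`, the initial term `α / 2` is at most `8 * L ^ 2 / α`; with the additional `1
  -- / 2` this stays below 9.
  have hbd : α / 2 + L ^ 2 / (2 * α) * (1 + Real.log T) ≤ L ^ 2 / α * (9 + Real.log T) := by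
    have h1 : α ≤ 16 * (L ^ 2 / α) := by
      rw [← mul_div_assoc, le_div_iff₀ hα]
      nlinarith
    have h2 : (L : ℝ) ^ 2 / (2 * α) = L ^ 2 / α / 2 := by rw [div_div, mul_comm]
    have h3 : 0 ≤ (L : ℝ) ^ 2 / α := by positivity
    rw [h2]
    nlinarith [mul_nonneg h3 hlog]
  have hδT : ∑ s, ∑ t ∈ Finset.range T, x t s * δ = δ * T := by
    rw [← hsumx, mul_comm δ, Finset.sum_mul]
    simp only [Finset.sum_mul]
  have hreg : ∑ s, ∑ t ∈ Finset.range T, x t s *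
      (l t (ogd K α (q₁ s) (history g x s t)) - l t (u s)) ≤
      N * (L ^ 2 / α * (9 + Real.log T)) := by
    refine (Finset.sum_le_sum fun s _ =>
      (ogd_regret_le hdiam hcl hK hα hl hg hxs hT (hq₁ s) (hu s) s).trans hbd).trans ?_
    simp
  rw [← hδT]
  refine le_trans ?_ (add_le_add_left hreg _)
  rw [← Finset.sum_add_distrib]
  refine Finset.sum_le_sum fun s _ => ?_
  rw [← Finset.sum_add_distrib]
  refine Finset.sum_le_sum fun t ht => ?_
  have ht' := Finset.mem_range.1 ht
  rw [← mul_add]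
  refine mul_le_mul_of_nonneg_left ?_ ((hxs t ht').1 s)
  have := hH _ (ogd_mem hne hcl α (hq₁ s) g x s t) _ ((hQ t ht').1 s) t ht'
  linarith

/-! ### Centers -/

/-- A convex set of diameter 1 is contained in a ball of radius `3 / 4` around one of its points. -/
lemma exists_center {d : ℕ} {K : Set (Pt d)} (hK : Convex ℝ K) (hdiam : Metric.diam K = 1) :
    ∃ x ∈ K, ∀ y ∈ K, dist y x ≤ 3 / 4 := by
  set A : Set ℝ := {R | ∃ x ∈ K, ∀ y ∈ K, ‖x - y‖ ^ 2 ≤ R} with hA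
  obtain ⟨x₀, hx₀⟩ := nonempty_of_diam hdiam
  have hsq : ∀ x ∈ K, ∀ y ∈ K, ‖x - y‖ ^ 2 ≤ 1 := fun x hx y hy => by
    rw [← dist_eq_norm]
    exact pow_le_one₀ dist_nonneg (dist_le_one_of_diam hdiam hx hy)
  have hA1 : (1 : ℝ) ∈ A := ⟨x₀, hx₀, hsq x₀ hx₀⟩
  have hbd : BddBelow A := ⟨0, by
    rintro R ⟨x, hx, h⟩
    exact (sq_nonneg _).trans (h x hx)⟩
  by_contra hcon
  have hno : ∀ R ∈ A, 9 / 16 ≤ R := by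
    rintro R ⟨x, hx, h⟩
    by_contra hR
    refine hcon ⟨x, hx, fun y hy => ?_⟩
    rw [dist_comm, dist_eq_norm]
    refine (pow_le_pow_iff_left₀ (norm_nonneg _) (by norm_num) two_ne_zero).1
      ((h y hy).trans ?_)
    norm_num at hR ⊢
    linarith
  set m := sInf A with hm
  have hm9 : 9 / 16 ≤ m := le_csInf ⟨1, hA1⟩ hno
  obtain ⟨R, ⟨x, hx, hxR⟩, hR⟩ : ∃ R ∈ A, R < m + 1 / 512 :=
    exists_lt_of_csInf_lt ⟨1, hA1⟩ (by linarith)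
  obtain ⟨y, hy, hxy⟩ : ∃ y ∈ K, m - 1 / 512 < ‖x - y‖ ^ 2 := by
    by_contra! h
    have := csInf_le hbd (show m - 1 / 512 ∈ A from ⟨x, hx, h⟩)
    linarith
  -- `x` is a nearly optimal center and `y` a nearly farthest point from it. Moving from `x` towards
  -- `y` by `1 / 16` lowers the squared radius below the infimum `m` if `9 / 16 ≤ m`, because all
  -- squared distances to `y` are at most 1. The slack `1 / 512` replaces an optimal center, which
  -- may not exist as `K` need not be closed.
  have hz : (15 / 16 : ℝ) • x + (1 / 16 : ℝ) • y ∈ K :=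
    hK hx hy (by norm_num) (by norm_num) (by norm_num)
  have hzA : 15 / 16 * R + 1 / 16 - 15 / 256 * (m - 1 / 512) ∈ A := by
    refine ⟨_, hz, fun w hw => ?_⟩
    have e : (15 / 16 : ℝ) • x + (1 / 16 : ℝ) • y - w =
      (15 / 16 : ℝ) • (x - w) + (1 / 16 : ℝ) • (y - w) := by module
    have e' : x - y = (x - w) - (y - w) := by abel
    have h1 := hxR w hw
    have h2 := hsq y hy w hw
    rw [e', norm_sub_sq_real (x - w)] at hxy
    rw [e, norm_add_sq_real, norm_smul, norm_smul, real_inner_smul_left, real_inner_smul_right,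
      mul_pow, mul_pow, Real.norm_of_nonneg (by norm_num), Real.norm_of_nonneg (by norm_num)]
    nlinarith
  have := csInf_le hbd hzA
  linarith

/-! ### Packing and nets -/

/-- Volumes of disjoint balls inside a large ball, divided by the volume of the unit ball. Different
radii are needed for the count on spheres. -/
lemma sum_pow_le_of_disjoint_balls {d : ℕ} {ι : Type*} (s : Finset ι) (c : ι → Pt d) (r : ι → ℝ)
    (x₀ : Pt d) {R : ℝ} (hR : 0 < R) (hr : ∀ i ∈ s, 0 < r i)
    (hd : ∀ i ∈ s, ∀ j ∈ s, i ≠ j → r i + r j ≤ dist (c i) (c j))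
    (hs : ∀ i ∈ s, r i + dist (c i) x₀ ≤ R) : ∑ i ∈ s, r i ^ d ≤ R ^ d := by
  let μ : MeasureTheory.Measure (Pt d) := MeasureTheory.volume
  have hD : Set.PairwiseDisjoint (s : Set ι) fun i => Metric.ball (c i) (r i) := by
    intro i hi j hj hij
    exact Metric.ball_disjoint_ball (hd i hi j hj hij)
  have hsub : ⋃ i ∈ s, Metric.ball (c i) (r i) ⊆ Metric.ball x₀ R :=
    Set.iUnion₂_subset fun i hi => Metric.ball_subset_ball' (hs i hi)
  have h1 := MeasureTheory.measure_mono (μ := μ) hsub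
  rw [MeasureTheory.measure_biUnion_finset hD fun i _ => measurableSet_ball,
    Finset.sum_congr rfl fun i hi => MeasureTheory.Measure.addHaar_ball_of_pos μ (c i) (hr i hi),
    MeasureTheory.Measure.addHaar_ball_of_pos μ x₀ hR, ← Finset.sum_mul,
    ENNReal.mul_le_mul_iff_left (Metric.measure_ball_pos _ _ zero_lt_one).ne'
      MeasureTheory.measure_ball_lt_top.ne,
    ← ENNReal.ofReal_sum_of_nonneg fun i hi => pow_nonneg (hr i hi).le _] at h1
  simpa using (ENNReal.ofReal_le_ofReal_iff (by positivity)).1 h1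

/-- The points of `Z` have pairwise distances at least `η`. -/
def IsSeparatedFinset {d : ℕ} (η : ℝ) (Z : Finset (Pt d)) : Prop :=
  ∀ z ∈ Z, ∀ w ∈ Z, z ≠ w → η ≤ dist z w

/-- A separated set of maximal cardinality is a net, since a point far from all its members could be
added; the uniform bound `B` provides the maximum. -/
lemma exists_net {d : ℕ} {A : Set (Pt d)} {η B : ℝ} (hη : 0 ≤ η)
    (hB : ∀ Z : Finset (Pt d), (Z : Set (Pt d)) ⊆ A → IsSeparatedFinset η Z → (Z.card : ℝ) ≤ B) :
    ∃ Z : Finset (Pt d), (Z : Set (Pt d)) ⊆ A ∧ (Z.card : ℝ) ≤ B ∧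
      ∀ x ∈ A, ∃ z ∈ Z, dist x z ≤ η := by
  classical
  set S : Set ℕ := {n | ∃ Z : Finset (Pt d), (Z : Set (Pt d)) ⊆ A ∧ IsSeparatedFinset η Z ∧
    Z.card = n} with hS
  have hbd : BddAbove S := by
    refine ⟨⌊B⌋₊, ?_⟩
    rintro n ⟨Z, hZ, hsep, rfl⟩
    exact Nat.le_floor (hB Z hZ hsep)
  obtain ⟨Z, hZ, hsep, hcard⟩ : sSup S ∈ S :=
    Nat.sSup_mem ⟨0, ∅, by simp, by simp [IsSeparatedFinset], by simp⟩ hbd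
  refine ⟨Z, hZ, hB Z hZ hsep, fun x hx => ?_⟩
  by_contra! h
  have hxZ : x ∉ Z := fun hxZ => by
    have := h x hxZ
    rw [dist_self] at this
    linarith
  have hins : (insert x Z).card ∈ S := by
    refine ⟨insert x Z, ?_, ?_, rfl⟩
    · rw [Finset.coe_insert]
      exact Set.insert_subset hx hZ
    · intro z hz w hw hne
      rcases Finset.mem_insert.1 hz with rfl | hz' <;> rcases Finset.mem_insert.1 hw with rfl | hw'
      · exact absurd rfl hne
      · exact (h w hw').le
      · rw [dist_comm]; exact (h z hz').le
      · exact hsep z hz' w hw' hne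
  have := le_csSup hbd hins
  rw [Finset.card_insert_of_notMem hxZ] at this
  omega

lemma card_le_of_separated_ball {d : ℕ} {η r : ℝ} (hη : 0 < η) (hr : 0 ≤ r) (x₀ : Pt d)
    {Z : Finset (Pt d)} (hZ : ∀ z ∈ Z, dist z x₀ ≤ r) (hsep : IsSeparatedFinset η Z) :
    (Z.card : ℝ) ≤ (2 * r / η + 1) ^ d := by
  have h := sum_pow_le_of_disjoint_balls Z id (fun _ => η / 2) x₀ (R := η / 2 + r) (by positivity)
    (fun _ _ => by positivity) (fun z hz w hw hne => by
      have := hsep z hz w hw hne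
      simpa using this) (fun z hz => by simpa using hZ z hz)
  rw [Finset.sum_const, nsmul_eq_mul, ← le_div_iff₀ (by positivity), ← div_pow] at h
  refine h.trans (le_of_eq ?_)
  congr 1
  field_simp
  ring

lemma pow_sub_pow_le_mul {a b : ℝ} (hb : 0 ≤ b) (hab : b ≤ a) (n : ℕ) :
    a ^ (n + 1) - b ^ (n + 1) ≤ (n + 1) * (a - b) * a ^ n := by
  induction n with
  | zero => simp
  | succ n ih =>
    have h1 : b ^ (n + 1) ≤ a ^ (n + 1) := pow_le_pow_left₀ hb hab _
    have h2 := mul_le_mul_of_nonneg_left ih (hb.trans hab)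
    have h3 := mul_le_mul_of_nonneg_left h1 (sub_nonneg.2 hab)
    have e : a ^ (n + 1 + 1) - b ^ (n + 1 + 1) =
      a * (a ^ (n + 1) - b ^ (n + 1)) + (a - b) * b ^ (n + 1) := by ring
    rw [e]
    push_cast
    calc _ ≤ a * ((n + 1) * (a - b) * a ^ n) + (a - b) * a ^ (n + 1) := add_le_add h2 h3
      _ = _ := by ring

/-- A concentric ball of radius `r - η / 2` is added to the small balls. It confines them to a shell
of thickness `η`, whose volume is of first order in `η`, and this improves the exponent from `n + 1`
to `n`. -/
lemma card_le_of_separated_sphere {n : ℕ} {η r : ℝ} (hη : 0 < η) (hr : η < 2 * r)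
    (x₀ : Pt (n + 1)) {Z : Finset (Pt (n + 1))} (hZ : ∀ z ∈ Z, dist z x₀ = r)
    (hsep : IsSeparatedFinset η Z) :
    (Z.card : ℝ) ≤ 2 * (n + 1) * (2 * r / η + 1) ^ n := by
  classical
  have hx₀ : x₀ ∉ Z := fun h => by
    have := hZ x₀ h
    rw [dist_self] at this
    linarith
  have hne : ∀ z ∈ Z, z ≠ x₀ := fun z hz h => hx₀ (h ▸ hz)
  have h := sum_pow_le_of_disjoint_balls (insert x₀ Z) id
    (fun z => if z = x₀ then r - η / 2 else η / 2) x₀ (R := r + η / 2) (by linarith)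
    (fun z _ => by split_ifs <;> linarith) (fun z hz w hw hzw => by
      rcases Finset.mem_insert.1 hz with rfl | hz' <;> rcases Finset.mem_insert.1 hw with rfl | hw'
      · exact absurd rfl hzw
      · have := hZ w hw'
        rw [dist_comm] at this
        simp [hne w hw', this]
      · have := hZ z hz'
        simp [hne z hz', this]
      · have := hsep z hz' w hw' hzw
        simpa [hne z hz', hne w hw'] using this) (fun z hz => by
      rcases Finset.mem_insert.1 hz with rfl | hz'
      · simp; linarith
      · simp [hne z hz', hZ z hz', add_comm])
  rw [Finset.sum_insert hx₀, if_pos rfl,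
    Finset.sum_congr rfl fun z hz => by rw [if_neg (hne z hz)], Finset.sum_const,
    nsmul_eq_mul] at h
  have h2 := pow_sub_pow_le_mul (by linarith : 0 ≤ r - η / 2)
    (by linarith : r - η / 2 ≤ r + η / 2) n
  have h3 : Z.card * (η / 2) ^ (n + 1) ≤ (n + 1) * η * (r + η / 2) ^ n := by
    have e : r + η / 2 - (r - η / 2) = η := by ring
    rw [e] at h2
    linarith
  rw [← le_div_iff₀ (by positivity)] at h3
  refine h3.trans (le_of_eq ?_)
  have e : 2 * r / η + 1 = (r + η / 2) / (η / 2) := by field_simp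
  have hpos : (0 : ℝ) < (η / 2) ^ n := by positivity
  rw [e, div_pow (r + η / 2), pow_succ (η / 2)]
  generalize (r + η / 2) ^ n = X
  generalize (η / 2) ^ n = Y at hpos
  field_simp

/-! ### Existence of discretizations -/

section geometry

variable {d : ℕ} {C : Set (Pt d)}

/-- Stability of the projection: if `g` is normal to `C` at `p`, and `z` is near `p + g`. -/
lemma proj_near_normal (hne : C.Nonempty) (hcl : IsClosed C) (hC : Convex ℝ C) {p g z : Pt d}
    {η : ℝ} (hp : p ∈ C) (hg : ∀ y ∈ C, inner ℝ g (y - p) ≤ 0) (hz : ‖p + g - z‖ ≤ η) :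
    ‖proj C z - p‖ ≤ η ∧ -(η ^ 2 / 2) ≤ inner ℝ g (proj C z - p) := by
  set s := proj C z with hs
  have hsC : s ∈ C := (proj_spec hne hcl z).1
  have h1 := hg s hsC
  have h2 := inner_sub_proj_le hne hcl hC z hp
  rw [← hs, ← neg_sub s p, inner_neg_right] at h2
  -- In the expanded square both cross terms are nonnegative, by the two variational inequalities
  -- `h1` and `h2`, and so are the squares. Hence each summand is at most `η ^ 2`; the cross term
  -- with `g` gives the second-order estimate.
  have e : p + g - z = (g - (z - s)) - (s - p) := by abel
  have h3 := pow_le_pow_left₀ (norm_nonneg _) hz 2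
  rw [e, norm_sub_sq_real (g - (z - s)), inner_sub_left] at h3
  have h0 : 0 ≤ η := (norm_nonneg _).trans hz
  have h4 := norm_nonneg (s - p)
  constructor
  · refine (pow_le_pow_iff_left₀ h4 h0 two_ne_zero).1 ?_
    nlinarith [sq_nonneg ‖g - (z - s)‖]
  · nlinarith [sq_nonneg ‖g - (z - s)‖, sq_nonneg ‖s - p‖]

lemma norm_proj_sub_proj_le (hne : C.Nonempty) (hcl : IsClosed C) (hC : Convex ℝ C)
    (z w : Pt d) : ‖proj C z - proj C w‖ ≤ ‖z - w‖ := by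
  refine (proj_near_normal hne hcl hC (g := w - proj C w) (proj_spec hne hcl w).1
    (fun y hy => inner_sub_proj_le hne hcl hC w hy) (le_of_eq ?_)).1
  rw [add_sub_cancel, norm_sub_rev]

lemma continuous_proj (hne : C.Nonempty) (hcl : IsClosed C) (hC : Convex ℝ C) :
    Continuous (proj C) :=
  (LipschitzWith.of_dist_le_mul (K := 1) fun z w => by
    simpa [dist_eq_norm] using norm_proj_sub_proj_le hne hcl hC z w).continuous

/-- A point is near a polytope if no half space separates them by much. -/
lemma exists_mem_convexHull_of_support {F : Finset (Pt d)} (hF : F.Nonempty) {x : Pt d} {δ : ℝ}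
    (hδ : 0 ≤ δ) (h : ∀ u : Pt d, ‖u‖ = 1 → ∃ s ∈ F, -δ ≤ inner ℝ u (s - x)) :
    ∃ y ∈ convexHull ℝ (F : Set (Pt d)), dist x y ≤ δ := by
  set P := convexHull ℝ (F : Set (Pt d)) with hP
  have hcl : IsClosed P := F.finite_toSet.isClosed_convexHull ℝ
  have hne : P.Nonempty := hF.to_set.convexHull
  refine ⟨proj P x, (proj_spec hne hcl x).1, ?_⟩
  set y := proj P x with hy
  rcases eq_or_ne x y with hxy | hxy
  · rw [← hxy, dist_self]; exact hδ
  have hn : 0 < ‖x - y‖ := norm_pos_iff.2 (sub_ne_zero.2 hxy)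
  obtain ⟨s, hs, hsu⟩ := h (‖x - y‖⁻¹ • (x - y)) (by
    rw [norm_smul, norm_inv, norm_norm, inv_mul_cancel₀ hn.ne'])
  have h1 := inner_sub_proj_le hne hcl (convex_convexHull ℝ _) x (subset_convexHull ℝ _ hs)
  rw [← hy] at h1
  rw [real_inner_smul_left, show s - x = (s - y) - (x - y) by abel, inner_sub_right,
    real_inner_self_eq_norm_sq] at hsu
  rw [dist_eq_norm]
  have h2 : ‖x - y‖⁻¹ * (inner ℝ (x - y) (s - y) - ‖x - y‖ ^ 2) =
      ‖x - y‖⁻¹ * inner ℝ (x - y) (s - y) - ‖x - y‖ := by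
    field_simp
  have h3 : ‖x - y‖⁻¹ * inner ℝ (x - y) (s - y) ≤ 0 :=
    mul_nonpos_of_nonneg_of_nonpos (inv_nonneg.2 hn.le) h1
  rw [h2] at hsu
  linarith

end geometry

lemma isCompact_closure_of_diam {d : ℕ} {K : Set (Pt d)} (h : Metric.diam K = 1) :
    IsCompact (closure K) :=
  (isBounded_of_diam h).isCompact_closure

/-- Points of `K` near the projections of the points of a finite set. -/
lemma exists_near_proj {d : ℕ} {K : Set (Pt d)} (hne : K.Nonempty) (Z : Finset (Pt d)) {δ : ℝ}
    (hδ : 0 < δ) :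
    ∃ S : Finset (Pt d), (S : Set (Pt d)) ⊆ K ∧ S.card ≤ Z.card ∧
      ∀ z ∈ Z, ∃ s ∈ S, ‖s - proj (closure K) z‖ ≤ δ := by
  classical
  -- Projections lie only in the closure, as `K` is not assumed closed, and are moved back into `K`
  -- by at most `δ`.
  have : ∀ z, ∃ s ∈ K, ‖s - proj (closure K) z‖ ≤ δ := by
    intro z
    obtain ⟨s, hs, h⟩ := Metric.mem_closure_iff.1
      (proj_spec hne.closure isClosed_closure z).1 δ hδ
    rw [dist_comm, dist_eq_norm] at h
    exact ⟨s, hs, h.le⟩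
  choose f hf hf' using this
  refine ⟨Z.image f, ?_, Finset.card_image_le, fun z hz =>
    ⟨f z, Finset.mem_image_of_mem f hz, hf' z⟩⟩
  rw [Finset.coe_image]
  rintro _ ⟨z, -, rfl⟩
  exact hf z

lemma dist_le_one_of_mem_closure {d : ℕ} {K : Set (Pt d)} (h : Metric.diam K = 1) {x y : Pt d}
    (hx : x ∈ closure K) (hy : y ∈ closure K) : dist x y ≤ 1 :=
  dist_le_one_of_diam ((Metric.diam_closure K).trans h) hx hy

/-- The enumeration of a finite set. -/
def enum {d : ℕ} (S : Finset (Pt d)) : Fin S.card → Pt d := fun i => S.equivFin.symm i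

lemma enum_injective {d : ℕ} (S : Finset (Pt d)) : Function.Injective (enum S) :=
  Subtype.val_injective.comp S.equivFin.symm.injective

lemma enum_mem {d : ℕ} (S : Finset (Pt d)) (i : Fin S.card) : enum S i ∈ S :=
  (S.equivFin.symm i).2

lemma exists_enum_eq {d : ℕ} {S : Finset (Pt d)} {s : Pt d} (hs : s ∈ S) : ∃ i, enum S i = s :=
  ⟨S.equivFin ⟨s, hs⟩, by simp [enum]⟩

lemma range_enum {d : ℕ} (S : Finset (Pt d)) : Set.range (enum S) = S := by
  ext s
  constructor
  · rintro ⟨i, rfl⟩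
    exact enum_mem S i
  · exact fun hs => exists_enum_eq hs

/-- The alternative serves the polynomial size bound: either one center suffices, or `ε⁻¹` is
bounded away from 1 and some fixed power of it exceeds the base of the exponential constant. -/
lemma exists_isNet {d : ℕ} {K : Set (Pt d)} (hK : Convex ℝ K) (hdiam : Metric.diam K = 1) {ε : ℝ}
    (hε : 0 < ε) :
    ∃ (N : ℕ) (pts : Fin N → Pt d), IsNet ε K pts ∧
      (N = 1 ∨ ε < 3 / 4 ∧ (N : ℝ) ≤ (3 / ε) ^ d) := by
  rcases le_or_gt (3 / 4) ε with h | h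
  · obtain ⟨x, hx, hxK⟩ := exists_center hK hdiam
    exact ⟨1, fun _ => x, ⟨fun i j _ => Subsingleton.elim i j, fun _ => hx,
      fun y hy => ⟨0, (hxK y hy).trans h⟩⟩, Or.inl rfl⟩
  · obtain ⟨x₀, hx₀⟩ := nonempty_of_diam hdiam
    obtain ⟨Z, hZ, hcard, hnet⟩ := exists_net (A := K) (B := (2 * 1 / ε + 1) ^ d) hε.le
      fun Z hZ hsep => card_le_of_separated_ball hε zero_le_one x₀
        (fun z hz => dist_le_one_of_diam hdiam (hZ hz) hx₀) hsep
    refine ⟨Z.card, enum Z, ⟨enum_injective Z, fun i => hZ (enum_mem Z i), fun x hx => ?_⟩,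
      Or.inr ⟨h, hcard.trans ?_⟩⟩
    · obtain ⟨z, hz, hxz⟩ := hnet x hx
      obtain ⟨i, rfl⟩ := exists_enum_eq hz
      exact ⟨i, hxz⟩
    · refine pow_le_pow_left₀ (by positivity) ?_ d
      rw [div_add_one hε.ne']
      gcongr
      linarith

/-- A polytope approximation with the vertices among the points of a finite set. -/
lemma exists_isPolytopeApprox_of_finset {d : ℕ} {K : Set (Pt d)} {δ : ℝ} {S : Finset (Pt d)}
    (hS : (S : Set (Pt d)) ⊆ K)
    (hnear : ∀ x ∈ K, ∃ y ∈ convexHull ℝ (S : Set (Pt d)), dist x y ≤ δ) :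
    ∃ (N : ℕ) (pts : Fin N → Pt d), IsPolytopeApprox δ K pts ∧ N ≤ S.card := by
  classical
  -- A subset of least cardinality with the same hull is convexly independent: a point in the hull
  -- of the others could be dropped.
  set P : ℕ → Prop := fun n => ∃ S' : Finset (Pt d), S' ⊆ S ∧ S'.card = n ∧
    convexHull ℝ (S' : Set (Pt d)) = convexHull ℝ (S : Set (Pt d)) with hP
  have hex : ∃ n, P n := ⟨S.card, S, subset_rfl, rfl, rfl⟩
  obtain ⟨S', hS', hcard, hhull⟩ := Nat.find_spec hex
  refine ⟨S'.card, enum S', ⟨enum_injective S', ?_, fun i => hS (hS' (enum_mem S' i)), ?_⟩,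
    Finset.card_le_card hS'⟩
  · rw [convexIndependent_iff_notMem_convexHull_sdiff]
    intro i s hi
    set S'' := S'.erase (enum S' i) with hS''
    have hsub : enum S' '' (s \ {i}) ⊆ S'' := by
      rintro _ ⟨j, hj, rfl⟩
      rw [hS'', Finset.mem_coe, Finset.mem_erase]
      exact ⟨fun h => hj.2 (enum_injective S' h), enum_mem S' j⟩
    have hi'' := convexHull_mono hsub hi
    have hle : convexHull ℝ (S' : Set (Pt d)) ≤ convexHull ℝ (S'' : Set (Pt d)) := by
      refine convexHull_min (fun z hz => ?_) (convex_convexHull ℝ _)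
      by_cases hzi : z = enum S' i
      · rw [hzi]; exact hi''
      · exact subset_convexHull ℝ _ (Finset.mem_coe.2 (Finset.mem_erase.2 ⟨hzi, hz⟩))
    have hlt : S''.card < Nat.find hex := by
      rw [← hcard]
      exact Finset.card_erase_lt_of_mem (enum_mem S' i)
    refine Nat.find_min hex hlt ⟨S'', (Finset.erase_subset _ _).trans hS', rfl, ?_⟩
    rw [← hhull]
    exact le_antisymm (convexHull_mono (Finset.coe_subset.2 (Finset.erase_subset _ _))) hle
  · rw [range_enum, hhull]
    exact hnear

/-- An `ε`-net of the sphere of radius 2 around a point of `K` is projected to the closure. To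
control a direction `u`, follow the ray from a maximizer of `u` to the sphere: the net point near
its end projects almost to that maximizer, with an error quadratic in `ε` in the direction `u`. -/
lemma exists_isPolytopeApprox {n : ℕ} {K : Set (Pt (n + 1))} (hK : Convex ℝ K)
    (hdiam : Metric.diam K = 1) {ε : ℝ} (hε : 0 < ε) (hε1 : ε ≤ 1) :
    ∃ (N : ℕ) (pts : Fin N → Pt (n + 1)), IsPolytopeApprox (ε ^ 2) K pts ∧
      (N = 1 ∨ ε ^ 2 < 3 / 4 ∧ (N : ℝ) ≤ 2 * (n + 1) * (5 / ε) ^ n) := by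
  rcases le_or_gt (3 / 4) (ε ^ 2) with h | h
  · obtain ⟨x, hx, hxK⟩ := exists_center hK hdiam
    refine ⟨1, fun _ => x, ⟨fun i j _ => Subsingleton.elim i j, ?_, fun _ => hx,
      fun y hy => ⟨x, subset_convexHull ℝ _ ⟨0, rfl⟩, (hxK y hy).trans h⟩⟩, Or.inl rfl⟩
    exact Subsingleton.convexIndependent _
  obtain ⟨x₀, hx₀⟩ := nonempty_of_diam hdiam
  set C := closure K with hC
  have hcl : IsClosed C := isClosed_closure
  have hCc : Convex ℝ C := hK.closure
  have hCne : C.Nonempty := ⟨x₀, subset_closure hx₀⟩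
  obtain ⟨Z, hZ, hcard, hnet⟩ := exists_net (A := Metric.sphere x₀ 2)
    (B := 2 * (n + 1) * (2 * 2 / ε + 1) ^ n) hε.le
    fun Z hZ hsep => card_le_of_separated_sphere hε (by linarith) x₀ (fun z hz => hZ hz) hsep
  -- Half of the admissible error `ε ^ 2` is spent on the return from the closure to `K`, the other
  -- half on the projected net point.
  obtain ⟨S, hSK, hScard, hS⟩ := exists_near_proj ⟨x₀, hx₀⟩ Z (half_pos (pow_pos hε 2))
  have key : ∀ x ∈ K, ∀ u : Pt (n + 1), ‖u‖ = 1 → ∃ s ∈ S, -(ε ^ 2) ≤ inner ℝ u (s - x) := by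
    intro x hx u hu
    obtain ⟨p, hp, hpmax⟩ := (isCompact_closure_of_diam hdiam).exists_isMaxOn hCne
      (f := fun y => inner ℝ u y) (by fun_prop)
    have hpmax' : ∀ y ∈ C, inner ℝ u (y - p) ≤ 0 := fun y hy => by
      rw [inner_sub_right]
      exact sub_nonpos.2 (hpmax hy)
    have hpx₀ : ‖p - x₀‖ ≤ 1 := by
      rw [← dist_eq_norm]
      exact dist_le_one_of_mem_closure hdiam hp (subset_closure hx₀)
    -- As `‖p - x₀‖ ≤ 1`, the ray crosses the sphere of radius 2 between `τ = 1` and `τ = 3`. That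
    -- `1 ≤ τ` matters: the estimate for `τ • u` passes to `u` without loss.
    obtain ⟨τ, ⟨hτ1, -⟩, hτ⟩ : (2 : ℝ) ∈ (fun τ : ℝ => ‖p + τ • u - x₀‖) '' Set.Icc 1 3 := by
      refine intermediate_value_Icc (by norm_num) (by fun_prop) ⟨?_, ?_⟩
      · rw [one_smul, show p + u - x₀ = (p - x₀) + u by abel]
        refine (norm_add_le _ _).trans ?_
        rw [hu]
        linarith
      · have e : (3 : ℝ) • u = (p + (3 : ℝ) • u - x₀) - (p - x₀) := by abel
        have h3 : ‖(3 : ℝ) • u‖ = 3 := by rw [norm_smul, hu]; norm_num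
        have := norm_sub_le (p + (3 : ℝ) • u - x₀) (p - x₀)
        rw [← e, h3] at this
        linarith
    obtain ⟨z, hz, hdz⟩ := hnet (p + τ • u) (by rw [mem_sphere_iff_norm]; exact hτ)
    obtain ⟨s, hs, hsz⟩ := hS z hz
    rw [dist_eq_norm] at hdz
    have h1 := (proj_near_normal hCne hcl hCc hp (g := τ • u) (fun y hy => by
      rw [real_inner_smul_left]
      exact mul_nonpos_of_nonneg_of_nonpos (by linarith) (hpmax' y hy)) hdz).2
    rw [real_inner_smul_left] at h1
    refine ⟨s, hs, ?_⟩
    have h2 : -(ε ^ 2 / 2) ≤ inner ℝ u (proj C z - p) := by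
      rcases le_or_gt 0 (inner ℝ u (proj C z - p)) with h0 | h0
      · have := sq_nonneg ε
        linarith
      · nlinarith
    have h3 := hpmax' x (subset_closure hx)
    have h4 : -(ε ^ 2 / 2) ≤ inner ℝ u (s - proj C z) := by
      have : |inner ℝ u (s - proj C z)| ≤ ε ^ 2 / 2 :=
        (abs_real_inner_le_norm _ _).trans (by rw [hu, one_mul]; exact hsz)
      exact (abs_le.1 this).1
    rw [show s - x = (s - proj C z) + (proj C z - p) - (x - p) by abel, inner_sub_right,
      inner_add_right]
    linarith
  have hSne : S.Nonempty := by
    obtain ⟨s, hs, -⟩ := key x₀ hx₀ (EuclideanSpace.single 0 1) (by simp)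
    exact ⟨s, hs⟩
  obtain ⟨N, pts, hpts, hN⟩ := exists_isPolytopeApprox_of_finset hSK fun x hx =>
    exists_mem_convexHull_of_support hSne (sq_nonneg ε) (key x hx)
  refine ⟨N, pts, hpts, Or.inr ⟨h, ?_⟩⟩
  have : (N : ℝ) ≤ Z.card := by exact_mod_cast hN.trans hScard
  refine this.trans (hcard.trans ?_)
  refine mul_le_mul_of_nonneg_left (pow_le_pow_left₀ (by positivity) ?_ n) (by positivity)
  rw [div_add_one hε.ne']
  gcongr
  linarith

/-- A triangulation from local approximations. -/
lemma exists_isTriangulation_of_finset {d : ℕ} {K : Set (Pt d)} {ε : ℝ}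
    {S : Finset (Pt d)} (hS : (S : Set (Pt d)) ⊆ K)
    (hnear : ∀ x ∈ K, ∃ y ∈ convexHull ℝ {s | s ∈ S ∧ dist s x ≤ ε / 2}, dist x y ≤ ε ^ 2) :
    ∃ (perp : Pt d → Pt d) (cell : Pt d → Finset (Fin S.card)),
      IsTriangulation ε K (enum S) perp cell := by
  classical
  have hcell : ∀ x ∈ K, ∃ y, dist x y ≤ ε ^ 2 ∧ ∃ c, IsCell ε (enum S) y c := by
    intro x hx
    obtain ⟨y, hy, hxy⟩ := hnear x hx
    refine ⟨y, hxy, ?_⟩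
    -- Both `y` and the vertices of its Carathéodory simplex lie within `ε / 2` of `x`, hence within
    -- `ε` of each other.
    have hyx : dist y x ≤ ε / 2 := by
      have hsub : {s | s ∈ S ∧ dist s x ≤ ε / 2} ⊆ Metric.closedBall x (ε / 2) := fun s hs => hs.2
      exact convexHull_min hsub (convex_closedBall x _) hy
    rw [convexHull_eq_union] at hy
    simp only [Set.mem_iUnion] at hy
    obtain ⟨t, hts, hti, hyt⟩ := hy
    set c : Finset (Fin S.card) := Finset.univ.filter fun i => enum S i ∈ t with hc
    have himg : enum S '' c = t := by
      ext s
      constructor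
      · rintro ⟨i, hi, rfl⟩
        exact (Finset.mem_filter.1 hi).2
      · intro hs
        obtain ⟨i, rfl⟩ := exists_enum_eq (hts hs).1
        exact ⟨i, by simpa [hc] using hs, rfl⟩
    have hsimp : AffineIndependent ℝ fun i : c => enum S i := by
      let f : c ↪ t := ⟨fun i => ⟨enum S i, (Finset.mem_filter.1 i.2).2⟩, fun i j hij => by
        have : enum S i = enum S j := congrArg (fun z : t => (z : Pt d)) hij
        exact Subtype.ext (enum_injective S this)⟩
      exact hti.comp_embedding f
    refine ⟨c, ⟨?_, hsimp, by rwa [himg], fun i hi => ?_⟩⟩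
    · have := hsimp.card_le_finrank_succ
      rw [Fintype.card_coe] at this
      refine this.trans (Nat.succ_le_succ ((Submodule.finrank_le _).trans (le_of_eq ?_)))
      simp
    · have h1 := (hts (Finset.mem_filter.1 hi).2).2
      have := dist_triangle_right y (enum S i) x
      linarith
  choose! perp hperp cell' hcell' using hcell
  -- The construction gives a cell for each `x`, but `cell` may depend only on `y`; any cell at `y`
  -- will do.
  refine ⟨perp, fun y => if h : ∃ c, IsCell ε (enum S) y c then h.choose else ∅,
    enum_injective S, fun i => hS (enum_mem S i), fun x hx => ?_, hperp, fun x hx => ?_⟩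
  · exact convexHull_mono (Set.image_subset_range _ _) (hcell' x hx).mem_hull
  · have h : ∃ c, IsCell ε (enum S) (perp x) c := ⟨_, hcell' x hx⟩
    rw [dif_pos h]
    exact h.choose_spec

/-- Each direction needs a supporting point close to `x`, not just somewhere in `K`. From `x` one
moves along `u` until the projection has moved by `ε / 4`, or up to length 1. The rescaled residual
`g` is a normal at the projection `p`, of norm at most 1, so `p + g` lies in the ball of radius 2
covered by the net, and the net point near it projects near `p`. -/
lemma exists_isTriangulation {d : ℕ} {K : Set (Pt d)} (hK : Convex ℝ K)
    (hdiam : Metric.diam K = 1) {ε : ℝ} (hε : 0 < ε) (hε1 : ε ≤ 1) :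
    ∃ (N : ℕ) (pts : Fin N → Pt d) (perp : Pt d → Pt d) (cell : Pt d → Finset (Fin N)),
      IsTriangulation ε K pts perp cell ∧
      (N = 1 ∨ ε ^ 2 < 3 / 4 ∧ (N : ℝ) ≤ (40 / ε) ^ d) := by
  rcases le_or_gt (3 / 4) (ε ^ 2) with h | h
  · obtain ⟨x, hx, hxK⟩ := exists_center hK hdiam
    refine ⟨1, fun _ => x, fun _ => x, fun _ => Finset.univ,
      ⟨fun i j _ => Subsingleton.elim i j, fun _ => hx,
      fun y hy => subset_convexHull ℝ _ ⟨0, rfl⟩, fun y hy => (hxK y hy).trans h,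
      fun y hy => ⟨by simp, ?_, subset_convexHull ℝ _ ⟨0, by simp, rfl⟩,
        fun i _ => by simpa using hε.le⟩⟩, Or.inl rfl⟩
    have : Subsingleton (Finset.univ : Finset (Fin 1)) :=
      ⟨fun i j => Subtype.ext (Subsingleton.elim _ _)⟩
    exact affineIndependent_of_subsingleton ℝ _
  obtain ⟨x₀, hx₀⟩ := nonempty_of_diam hdiam
  set C := closure K with hC
  have hcl : IsClosed C := isClosed_closure
  have hCc : Convex ℝ C := hK.closure
  have hCne : C.Nonempty := ⟨x₀, subset_closure hx₀⟩
  obtain ⟨Z, hZ, hcard, hnet⟩ := exists_net (A := Metric.closedBall x₀ 2) (η := ε / 8)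
    (B := (2 * 2 / (ε / 8) + 1) ^ d) (by positivity)
    fun Z hZ hsep => card_le_of_separated_ball (by positivity) (by norm_num) x₀
      (fun z hz => hZ hz) hsep
  obtain ⟨S, hSK, hScard, hS⟩ := exists_near_proj (δ := ε ^ 2 / 8) ⟨x₀, hx₀⟩ Z (by positivity)
  have key : ∀ x ∈ K, ∀ u : Pt d, ‖u‖ = 1 →
      ∃ s ∈ S, dist s x ≤ ε / 2 ∧ -(ε ^ 2) ≤ inner ℝ u (s - x) := by
    intro x hx u hu
    have hxC : x ∈ C := subset_closure hx
    -- a step in the direction `u`, short enough for the projection to stay near `x`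
    obtain ⟨τ, hτ0, hτ⟩ : ∃ τ : ℝ, 0 < τ ∧ ((τ = 1 ∧ ‖proj C (x + τ • u) - x‖ ≤ ε / 4) ∨
        ‖proj C (x + τ • u) - x‖ = ε / 4) := by
      rcases le_or_gt ‖proj C (x + (1 : ℝ) • u) - x‖ (ε / 4) with h1 | h1
      · exact ⟨1, one_pos, Or.inl ⟨rfl, h1⟩⟩
      · have hx0 : proj C (x + (0 : ℝ) • u) = x := by
          have := (proj_spec hCne hcl (x + (0 : ℝ) • u)).2 x hxC
          rw [zero_smul, add_zero, dist_self] at this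
          rw [zero_smul, add_zero]
          exact (dist_le_zero.1 this).symm
        obtain ⟨τ, ⟨hτ0, -⟩, hτ⟩ :
            ε / 4 ∈ (fun τ : ℝ => ‖proj C (x + τ • u) - x‖) '' Set.Icc 0 1 := by
          refine intermediate_value_Icc zero_le_one ?_ ⟨?_, h1.le⟩
          · have := continuous_proj hCne hcl hCc
            fun_prop
          · rw [hx0, sub_self, norm_zero]
            positivity
        refine ⟨τ, hτ0.lt_of_ne ?_, Or.inr hτ⟩
        rintro rfl
        dsimp only at hτ
        rw [hx0, sub_self, norm_zero] at hτ
        linarith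
    set p := proj C (x + τ • u) with hp
    have hpC : p ∈ C := (proj_spec hCne hcl _).1
    set g := τ⁻¹ • (x + τ • u - p) with hg
    have hgn : ∀ y ∈ C, inner ℝ g (y - p) ≤ 0 := fun y hy => by
      rw [hg, real_inner_smul_left]
      exact mul_nonpos_of_nonneg_of_nonpos (inv_nonneg.2 hτ0.le)
        (inner_sub_proj_le hCne hcl hCc _ hy)
    have hg1 : ‖g‖ ≤ 1 := by
      have := (proj_spec hCne hcl (x + τ • u)).2 x hxC
      rw [← hp, dist_eq_norm, dist_eq_norm, add_sub_cancel_left, norm_smul, hu, mul_one,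
        Real.norm_of_nonneg hτ0.le] at this
      rw [hg, norm_smul, norm_inv, Real.norm_of_nonneg hτ0.le]
      rw [inv_mul_le_iff₀ hτ0, mul_one]
      exact this
    -- The direction splits into a normal at `p`, handled by the stability of the projection, and a
    -- multiple of the displacement `p - x`.
    have hug : u = g + τ⁻¹ • (p - x) := by
      rw [hg, ← smul_add, show x + τ • u - p + (p - x) = τ • u by abel, smul_smul,
        inv_mul_cancel₀ hτ0.ne', one_smul]
    obtain ⟨z, hz, hdz⟩ := hnet (p + g) (by
      rw [Metric.mem_closedBall, dist_eq_norm, show p + g - x₀ = (p - x₀) + g by abel]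
      refine (norm_add_le _ _).trans ?_
      have := dist_le_one_of_mem_closure hdiam hpC (subset_closure hx₀)
      rw [dist_eq_norm] at this
      linarith)
    rw [dist_eq_norm] at hdz
    obtain ⟨h1, h2⟩ := proj_near_normal hCne hcl hCc hpC hgn hdz
    obtain ⟨s, hs, hsz⟩ := hS z hz
    rw [← hC] at hsz
    set s' := proj C z with hs'
    have hpx : ‖p - x‖ ≤ ε / 4 := by
      rcases hτ with ⟨-, h⟩ | h
      exacts [h, h.le]
    refine ⟨s, hs, ?_, ?_⟩
    · rw [dist_eq_norm, show s - x = (s - s') + (s' - p) + (p - x) by abel]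
      refine (norm_add₃_le).trans ?_
      nlinarith
    · have h3 := hgn x hxC
      have h4 : -(ε ^ 2 / 8) ≤ inner ℝ u (s - s') :=
        (abs_le.1 ((abs_real_inner_le_norm u (s - s')).trans
          (by rw [hu, one_mul]; exact hsz))).1
      have h5 : ‖p - x‖ ^ 2 - ‖p - x‖ * (ε / 8) ≤ inner ℝ (p - x) (s' - x) := by
        rw [show s' - x = (p - x) + (s' - p) by abel, inner_add_right, real_inner_self_eq_norm_sq]
        have := (abs_le.1 (abs_real_inner_le_norm (p - x) (s' - p))).1
        have := mul_le_mul_of_nonneg_left h1 (norm_nonneg (p - x))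
        linarith
      -- If `τ = 1`, completing the square in `h5` suffices. If the displacement is exactly `ε / 4`,
      -- an error of `ε / 8` cannot reverse it; the inner product is nonnegative and the size of
      -- `τ⁻¹` is irrelevant.
      have h6 : -(ε ^ 2 / 4) ≤ τ⁻¹ * inner ℝ (p - x) (s' - x) := by
        rcases hτ with ⟨hτ1, -⟩ | hτ1
        · rw [hτ1, inv_one, one_mul]
          nlinarith [sq_nonneg (‖p - x‖ - ε / 16), sq_nonneg ε]
        · rw [hτ1] at h5
          have h7 : 0 ≤ inner ℝ (p - x) (s' - x) := le_trans (by nlinarith) h5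
          have := mul_nonneg (inv_nonneg.2 hτ0.le) h7
          nlinarith [sq_nonneg ε]
      have e : inner ℝ u (s - x) = inner ℝ u (s - s') +
          (inner ℝ g (s' - p) - inner ℝ g (x - p) + τ⁻¹ * inner ℝ (p - x) (s' - x)) := by
        rw [← inner_sub_right, show s' - p - (x - p) = s' - x by abel, ← real_inner_smul_left,
          ← inner_add_left, ← hug, ← inner_add_right]
        congr 1
        abel
      rw [e]
      nlinarith
  have hne : ∃ u : Pt d, ‖u‖ = 1 := ⟨EuclideanSpace.single ⟨0, dim_pos_of_diam hdiam⟩ 1, by simp⟩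
  obtain ⟨u₀, hu₀⟩ := hne
  obtain ⟨perp, cell, ht⟩ := exists_isTriangulation_of_finset hSK (ε := ε) fun x hx => by
    classical
    have e : {s | s ∈ S ∧ dist s x ≤ ε / 2} = (S.filter fun s => dist s x ≤ ε / 2 : Finset _) := by
      ext s
      simp
    rw [e]
    refine exists_mem_convexHull_of_support ?_ (sq_nonneg ε) fun u hu => ?_
    · obtain ⟨s, hs, hsx, -⟩ := key x hx u₀ hu₀
      exact ⟨s, Finset.mem_filter.2 ⟨hs, hsx⟩⟩
    · obtain ⟨s, hs, hsx, hsu⟩ := key x hx u hu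
      exact ⟨s, Finset.mem_filter.2 ⟨hs, hsx⟩, hsu⟩
  refine ⟨S.card, enum S, perp, cell, ht, Or.inr ⟨h, ?_⟩⟩
  have : (S.card : ℝ) ≤ Z.card := by exact_mod_cast hScard
  refine this.trans (hcard.trans (pow_le_pow_left₀ (by positivity) ?_ d))
  rw [show 2 * 2 / (ε / 8) = 32 / ε by field_simp; norm_num, div_add_one hε.ne']
  gcongr
  linarith

/-! ### Sizes of the discretizations -/

lemma inv_pow_of_eq_rpow {d e T : ℕ} {ε : ℝ} (he : 0 < e)
    (hε : ε = (T : ℝ) ^ (-(1 / ((d : ℝ) + e)))) : ε⁻¹ ^ (d + e) = T := by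
  have hpos : ((d : ℝ) + e) ≠ 0 := by positivity
  rw [hε, Real.rpow_neg (Nat.cast_nonneg _), inv_inv, ← Real.rpow_natCast,
    ← Real.rpow_mul (Nat.cast_nonneg _)]
  push_cast
  rw [one_div_mul_cancel hpos, Real.rpow_one]

lemma eps_pos {T : ℕ} (hT : 2 ≤ T) {ε r : ℝ} (hε : ε = (T : ℝ) ^ (-r)) : 0 < ε := by
  rw [hε]
  have : (0 : ℝ) < T := by exact_mod_cast (by omega : 0 < T)
  positivity

lemma eps_le_one {T : ℕ} (hT : 2 ≤ T) {ε r : ℝ} (hr : 0 ≤ r) (hε : ε = (T : ℝ) ^ (-r)) :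
    ε ≤ 1 := by
  rw [hε]
  exact Real.rpow_le_one_of_one_le_of_nonpos (by exact_mod_cast (by omega : 1 ≤ T))
    (neg_nonpos.2 hr)

lemma rpow_neg_natCast {ε : ℝ} (hε : 0 < ε) (n : ℕ) : ε ^ (-(n : ℝ)) = ε⁻¹ ^ n := by
  rw [Real.rpow_neg hε.le, Real.rpow_natCast, inv_pow]

/-- An exponential in the dimension is polynomial in `M` when the scale `x` is bounded away
from one. -/
lemma mul_pow_le_pow {x M : ℝ} {n m : ℕ} (hx0 : 1 ≤ x) (hx : 4 / 3 ≤ x ^ 2) (hM : x ^ m ≤ M)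
    (hn : n ≤ m) : (40 * x) ^ n ≤ M ^ 27 := by
  -- As `40 ≤ (4 / 3) ^ 13`, the factor 40 costs 26 powers of `x`, so `40 * x ≤ x ^ 27`.
  have h40 : (40 : ℝ) ≤ x ^ 26 := by
    calc (40 : ℝ) ≤ (4 / 3) ^ 13 := by norm_num
      _ ≤ (x ^ 2) ^ 13 := pow_le_pow_left₀ (by norm_num) hx 13
      _ = x ^ 26 := by ring
  calc (40 * x) ^ n ≤ (x ^ 26 * x) ^ n := by gcongr
    _ = (x ^ n) ^ 27 := by ring
    _ ≤ M ^ 27 := by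
      gcongr
      exact (pow_le_pow_right₀ hx0 hn).trans hM

lemma one_le_inv_of_sq_lt {ε : ℝ} (hε : 0 < ε) (h : ε ^ 2 < 3 / 4) :
    1 ≤ ε⁻¹ ∧ 4 / 3 ≤ ε⁻¹ ^ 2 := by
  refine ⟨(one_le_inv₀ hε).2 (by nlinarith), ?_⟩
  rw [inv_pow, le_inv_comm₀ (by norm_num) (by positivity)]
  norm_num
  linarith

lemma natCast_le_mul_pow {N d T q : ℕ} (hT : 2 ≤ T) (hq : q ≤ 81)
    (h : (N : ℝ) ≤ 2 * d * (T : ℝ) ^ q) : N ≤ 81 * (d * T) ^ 81 := by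
  have h1 : N ≤ 2 * d * T ^ q := by exact_mod_cast h
  have h2 : T ^ q ≤ T ^ 81 := Nat.pow_le_pow_right (by omega) hq
  have h3 : d ≤ d ^ 81 := Nat.le_self_pow (by norm_num) d
  calc N ≤ 2 * d * T ^ q := h1
    _ ≤ 81 * d ^ 81 * T ^ 81 := by gcongr; norm_num
    _ = 81 * (d * T) ^ 81 := by ring

/-- The cube of `T` leaves room for strongly convex losses, where `ε⁻¹ ^ (d + 1)` can exceed `T` by
a factor of up to 4. It is also the reason for the exponent `81 = 3 * 27`. -/
lemma exists_net_size {d : ℕ} {K : Set (Pt d)} (hK : Convex ℝ K) (hdiam : Metric.diam K = 1)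
    {T e : ℕ} (hT : 2 ≤ T) (he : 0 < e) {ε : ℝ} (hε : 0 < ε)
    (hεT : ε⁻¹ ^ (d + e) ≤ (T : ℝ) ^ 3) :
    ∃ (N : ℕ) (pts : Fin N → Pt d), IsNet ε K pts ∧
      (N : ℝ) ≤ 40 ^ d * max 1 (ε ^ (-(d : ℝ))) ∧ N ≤ 81 * (d * T) ^ 81 := by
  have hd := dim_pos_of_diam hdiam
  obtain ⟨N, pts, hpts, hN⟩ := exists_isNet hK hdiam hε
  refine ⟨N, pts, hpts, ?_⟩
  have h40 : (1 : ℝ) ≤ 40 ^ d := one_le_pow₀ (by norm_num)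
  rcases hN with rfl | ⟨h, hN⟩
  · constructor
    · push_cast
      nlinarith [le_max_left (1 : ℝ) (ε ^ (-(d : ℝ)))]
    · exact one_le_mul (by norm_num) (Nat.one_le_pow _ _ (by positivity))
  · obtain ⟨hx, hx2⟩ := one_le_inv_of_sq_lt hε (by nlinarith)
    have hN' : (N : ℝ) ≤ (40 * ε⁻¹) ^ d := by
      refine hN.trans ?_
      rw [div_eq_mul_inv]
      gcongr
      norm_num
    refine ⟨hN'.trans ?_, natCast_le_mul_pow hT le_rfl ?_⟩
    · rw [mul_pow, ← rpow_neg_natCast hε]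
      gcongr
      exact le_max_right _ _
    · refine hN'.trans ((mul_pow_le_pow hx hx2 hεT (by omega)).trans ?_)
      rw [← pow_mul]
      have : (1 : ℝ) ≤ 2 * d := by
        have : (1 : ℝ) ≤ d := by exact_mod_cast hd
        linarith
      exact le_mul_of_one_le_left (by positivity) this

lemma exists_isNet_size {d : ℕ} {K : Set (Pt d)} (hK : Convex ℝ K) (hdiam : Metric.diam K = 1)
    {T : ℕ} (hT : 2 ≤ T) {ε : ℝ} (hε : ε = (T : ℝ) ^ (-(1 / ((d : ℝ) + 2)))) :
    ∃ (N : ℕ) (pts : Fin N → Pt d), IsNet ε K pts ∧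
      (N : ℝ) ≤ 40 ^ d * ε ^ (-(d : ℝ)) ∧ N ≤ 81 * (d * T) ^ 81 := by
  have hε0 := eps_pos hT hε
  have hε1 := eps_le_one hT (by positivity) hε
  have hT1 : (1 : ℝ) ≤ T := by exact_mod_cast (by omega : 1 ≤ T)
  obtain ⟨N, pts, hpts, hN, hN'⟩ := exists_net_size hK hdiam hT (e := 2) two_pos hε0
    ((inv_pow_of_eq_rpow two_pos (by exact_mod_cast hε)).le.trans
      (le_self_pow₀ hT1 (by norm_num)))
  refine ⟨N, pts, hpts, ?_, hN'⟩
  rwa [max_eq_right] at hN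
  exact Real.one_le_rpow_of_pos_of_le_one_of_nonpos hε0 hε1 (by simp)

/-- A loss in the class forces `α ≤ 4 * L` and thereby a lower bound on `ε` in terms of `d` and `T`.
For an empty class `ε` could be arbitrarily small, and no bound on `N` in `d` and `T` would hold. -/
lemma exists_isNet_size_of_strongConvex {d : ℕ} {K : Set (Pt d)} (hK : Convex ℝ K)
    (hdiam : Metric.diam K = 1) {L : ℝ≥0} {α : ℝ} (hα : 0 < α)
    (hl : ∃ l, LipschitzOnWith L l K ∧ StrongConvexOn K α l) {T : ℕ} (hT : 2 ≤ T) {ε : ℝ}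
    (hε : ε = ((L : ℝ) / α) ^ (1 / ((d : ℝ) + 1)) * (T : ℝ) ^ (-(1 / ((d : ℝ) + 1)))) :
    ∃ (N : ℕ) (pts : Fin N → Pt d), IsNet ε K pts ∧
      (N : ℝ) ≤ 40 ^ d * max 1 (ε ^ (-(d : ℝ))) ∧ N ≤ 81 * (d * T) ^ 81 := by
  obtain ⟨l, hl, hs⟩ := hl
  have hLα := modulus_le_of_lipschitz hdiam hα hl hs
  have hT2 : (2 : ℝ) ≤ T := by exact_mod_cast hT
  have hr : 1 / 4 ≤ (L : ℝ) / α := by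
    rw [le_div_iff₀ hα]
    linarith
  have hε' := inv_pow_of_eq_rpow (d := d) (e := 1) (T := T) one_pos rfl
  have hε0 : 0 < ε := by
    rw [hε]
    have : 0 < (L : ℝ) / α := by linarith
    have : (0 : ℝ) < T := by linarith
    positivity
  refine exists_net_size hK hdiam hT one_pos hε0 ?_
  push_cast at hε'
  rw [hε, mul_inv, mul_pow, hε', inv_pow, ← Real.rpow_natCast, ← Real.rpow_mul (by linarith)]
  push_cast
  rw [one_div_mul_cancel (by positivity), Real.rpow_one]
  have h4 : ((L : ℝ) / α)⁻¹ ≤ 4 := by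
    rw [inv_le_comm₀ (by linarith) (by norm_num)]
    linarith
  calc ((L : ℝ) / α)⁻¹ * T ≤ 4 * T := by gcongr
    _ ≤ (T : ℝ) ^ 2 * T := by gcongr; nlinarith
    _ = (T : ℝ) ^ 3 := by ring

lemma exists_isTriangulation_size {d : ℕ} {K : Set (Pt d)} (hK : Convex ℝ K)
    (hdiam : Metric.diam K = 1) {T e : ℕ} (hT : 2 ≤ T) (he : 0 < e) {ε : ℝ}
    (hε : ε = (T : ℝ) ^ (-(1 / ((d : ℝ) + e)))) :
    ∃ (N : ℕ) (pts : Fin N → Pt d) (perp : Pt d → Pt d) (cell : Pt d → Finset (Fin N)),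
      IsTriangulation ε K pts perp cell ∧
      (N : ℝ) ≤ 40 ^ d * ε ^ (-(d : ℝ)) ∧ N ≤ 81 * (d * T) ^ 81 := by
  have hd := dim_pos_of_diam hdiam
  have hε0 := eps_pos hT hε
  have hε1 := eps_le_one hT (by positivity) hε
  have hT1 : (1 : ℝ) ≤ T := by exact_mod_cast (by omega : 1 ≤ T)
  obtain ⟨N, pts, perp, cell, hpts, hN⟩ := exists_isTriangulation hK hdiam hε0 hε1
  refine ⟨N, pts, perp, cell, hpts, ?_⟩
  have h40 : (1 : ℝ) ≤ 40 ^ d := one_le_pow₀ (by norm_num)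
  have hεd := Real.one_le_rpow_of_pos_of_le_one_of_nonpos hε0 hε1 (z := -(d : ℝ)) (by simp)
  rcases hN with rfl | ⟨h, hN⟩
  · constructor
    · push_cast
      nlinarith
    · exact one_le_mul (by norm_num) (Nat.one_le_pow _ _ (by positivity))
  · obtain ⟨hx, hx2⟩ := one_le_inv_of_sq_lt hε0 h
    rw [div_eq_mul_inv] at hN
    refine ⟨hN.trans ?_, natCast_le_mul_pow (q := 27) hT (by norm_num) ?_⟩
    · rw [mul_pow, ← rpow_neg_natCast hε0]
    · refine hN.trans ((mul_pow_le_pow hx hx2 (inv_pow_of_eq_rpow he hε).le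
        (Nat.le_add_right d e)).trans ?_)
      have : (1 : ℝ) ≤ 2 * d := by
        have : (1 : ℝ) ≤ d := by exact_mod_cast hd
        linarith
      exact le_mul_of_one_le_left (by positivity) this

lemma exists_isPolytopeApprox_size {d : ℕ} {K : Set (Pt d)} (hK : Convex ℝ K)
    (hdiam : Metric.diam K = 1) {T : ℕ} (hT : 2 ≤ T) {ε : ℝ}
    (hε : ε = (T : ℝ) ^ (-(1 / ((d : ℝ) + 3)))) :
    ∃ (N : ℕ) (pts : Fin N → Pt d), IsPolytopeApprox (ε ^ 2) K pts ∧
      (N : ℝ) ≤ 2 * d * 40 ^ d * ε ^ (-((d : ℝ) - 1)) ∧ N ≤ 81 * (d * T) ^ 81 := by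
  have hd := dim_pos_of_diam hdiam
  obtain ⟨n, rfl⟩ : ∃ n, d = n + 1 := ⟨d - 1, by omega⟩
  have hε0 := eps_pos hT hε
  have hε1 := eps_le_one hT (by positivity) hε
  obtain ⟨N, pts, hpts, hN⟩ := exists_isPolytopeApprox hK hdiam hε0 hε1
  refine ⟨N, pts, hpts, ?_⟩
  have e1 : (((n + 1 : ℕ) : ℝ) - 1) = n := by push_cast; ring
  have h40 : (1 : ℝ) ≤ 40 ^ (n + 1) := one_le_pow₀ (by norm_num)
  have hεd := Real.one_le_rpow_of_pos_of_le_one_of_nonpos hε0 hε1 (z := -(n : ℝ)) (by simp)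
  have h2d : (1 : ℝ) ≤ 2 * (n + 1 : ℕ) := by
    push_cast
    have : (0 : ℝ) ≤ n := n.cast_nonneg
    linarith
  rw [e1]
  rcases hN with rfl | ⟨h, hN⟩
  · constructor
    · rw [Nat.cast_one]
      exact one_le_mul_of_one_le_of_one_le (one_le_mul_of_one_le_of_one_le h2d h40) hεd
    · exact one_le_mul (by norm_num) (Nat.one_le_pow _ _ (by positivity))
  · obtain ⟨hx, hx2⟩ := one_le_inv_of_sq_lt hε0 h
    have hN' : (N : ℝ) ≤ 2 * (n + 1 : ℕ) * (40 * ε⁻¹) ^ n := by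
      refine hN.trans ?_
      rw [div_eq_mul_inv]
      push_cast
      gcongr
      norm_num
    refine ⟨hN'.trans ?_, natCast_le_mul_pow (q := 27) hT (by norm_num) (hN'.trans ?_)⟩
    · rw [mul_pow, ← rpow_neg_natCast hε0, ← mul_assoc]
      gcongr
      · norm_num
      · exact Nat.le_succ n
    · gcongr
      exact mul_pow_le_pow hx hx2 (inv_pow_of_eq_rpow three_pos (by exact_mod_cast hε)).le
        (by omega)

/-! ### Discretization errors -/

lemma sub_le_of_lipschitz {d : ℕ} {K : Set (Pt d)} {L : ℝ≥0} {l : Pt d → ℝ}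
    (hl : LipschitzOnWith L l K) {x y : Pt d} (hx : x ∈ K) (hy : y ∈ K) {r : ℝ}
    (hr : dist x y ≤ r) : l y ≤ l x + L * r := by
  have h := hl.dist_le_mul y hy x hx
  rw [Real.dist_eq, dist_comm] at h
  have h1 := (le_abs_self _).trans h
  have h2 : (L : ℝ) * dist x y ≤ L * r := mul_le_mul_of_nonneg_left hr L.2
  linarith

lemma sum_single_mul {d N : ℕ} (pts : Fin N → Pt d) (l : Pt d → ℝ) (i : Fin N) :
    ∑ j, (Pi.single i 1 : Fin N → ℝ) j * l (pts j) = l (pts i) := by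
  simp [Pi.single_apply]

lemma StrongConvexOn.convexOn_of_pos {d : ℕ} {K : Set (Pt d)} {α : ℝ} {l : Pt d → ℝ}
    (h : StrongConvexOn K α l) (hα : 0 < α) : ConvexOn ℝ K l :=
  UniformConvexOn.convexOn h fun r => by
    rw [Pi.zero_apply]
    positivity

lemma pos_of_mem_convexHull {d N : ℕ} {pts : Fin N → Pt d} {y : Pt d}
    (hy : y ∈ convexHull ℝ (Set.range pts)) : 0 < N := by
  obtain ⟨_, i, -⟩ := convexHull_nonempty_iff.1 ⟨y, hy⟩
  exact i.pos

lemma IsNet.pos {d N : ℕ} {K : Set (Pt d)} (hdiam : Metric.diam K = 1) {ε : ℝ}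
    {pts : Fin N → Pt d} (h : IsNet ε K pts) : 0 < N := by
  obtain ⟨x, hx⟩ := nonempty_of_diam hdiam
  obtain ⟨i, -⟩ := h.near x hx
  exact i.pos

lemma IsNet.nearestRounding_le {d N : ℕ} {K : Set (Pt d)} {ε : ℝ} {pts : Fin N → Pt d}
    (h : IsNet ε K pts) {L : ℝ≥0} {l : Pt d → ℝ} (hl : LipschitzOnWith L l K) {q : Pt d}
    (hq : q ∈ K) {z : Fin N → ℝ} (hz : NearestRounding pts q z) :
    ∑ j, z j * l (pts j) ≤ l q + L * ε := by
  obtain ⟨i, hi, rfl⟩ := hz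
  obtain ⟨j, hj⟩ := h.near q hq
  rw [sum_single_mul]
  exact sub_le_of_lipschitz hl hq (h.mem i) ((hi j).trans hj)

/-- The rounding has mean `perp q`, so the linear term of the smoothness inequality at `perp q`
averages to zero and only `β / 2 * ε ^ 2` remains; the move from `q` to `perp q` costs `L * ε ^ 2`.
-/
lemma IsTriangulation.barycentricRounding_le {d N : ℕ} {K : Set (Pt d)} (hK : Convex ℝ K) {ε : ℝ}
    {pts : Fin N → Pt d} {perp : Pt d → Pt d} {cell : Pt d → Finset (Fin N)}
    (h : IsTriangulation ε K pts perp cell) {L : ℝ≥0} {β : ℝ} (hβ : 0 ≤ β) {l : Pt d → ℝ}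
    (hl : LipschitzOnWith L l K) (hs : IsSmoothOn K β l) {q : Pt d} (hq : q ∈ K)
    {z : Fin N → ℝ} (hz : BarycentricRounding pts perp cell q z) :
    ∑ j, z j * l (pts j) ≤ l q + (L + β / 2) * ε ^ 2 := by
  obtain ⟨⟨hz0, hz1⟩, hzc, hzs⟩ := hz
  have hyK : perp q ∈ K :=
    convexHull_min (Set.range_subset_iff.2 h.mem) hK (h.perp_mem q hq)
  have hy := sub_le_of_lipschitz hl hq hyK (h.near q hq)
  obtain ⟨g, hg⟩ := hs (perp q) hyK
  have key : ∀ j, z j * l (pts j) ≤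
      z j * (l (perp q) + β / 2 * ε ^ 2) + inner ℝ g (z j • pts j - z j • perp q) := by
    intro j
    by_cases hj : j ∈ cell (perp q)
    · rw [← smul_sub, real_inner_smul_right, ← mul_add]
      refine mul_le_mul_of_nonneg_left ?_ (hz0 j)
      have h1 := hg (pts j) (h.mem j)
      have h2 := (h.isCell q hq).near j hj
      rw [dist_comm, dist_eq_norm] at h2
      have h3 : β / 2 * ‖pts j - perp q‖ ^ 2 ≤ β / 2 * ε ^ 2 := by gcongr
      linarith
    · simp [hzc j hj]
  refine (Finset.sum_le_sum fun j _ => key j).trans ?_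
  rw [Finset.sum_add_distrib, ← Finset.sum_mul, hz1, ← inner_sum, Finset.sum_sub_distrib, hzs,
    ← Finset.sum_smul, hz1, one_smul, sub_self, inner_zero_right]
  linarith

lemma IsTriangulation.exists_barycentricRounding {d N : ℕ} {K : Set (Pt d)} {ε : ℝ}
    {pts : Fin N → Pt d} {perp : Pt d → Pt d} {cell : Pt d → Finset (Fin N)}
    (h : IsTriangulation ε K pts perp cell) {q : Pt d} (hq : q ∈ K) :
    ∃ z, BarycentricRounding pts perp cell q z := by
  obtain ⟨w, hw, hwc, hws⟩ := exists_weights_of_mem_convexHull h.inj (h.isCell q hq).mem_hull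
  exact ⟨w, hw, fun i hi => hwc i hi, hws⟩

/-- Jensen's inequality at a nearby point of the hull. The weights depend on `u` only and serve all
losses at once, as a comparator fixed over the rounds requires. -/
lemma IsPolytopeApprox.exists_weights {d N : ℕ} {K : Set (Pt d)} {δ : ℝ} {pts : Fin N → Pt d}
    (h : IsPolytopeApprox δ K pts) {u : Pt d} (hu : u ∈ K) :
    ∃ w ∈ stdSimplex ℝ (Fin N), ∀ (L : ℝ≥0) (l : Pt d → ℝ), LipschitzOnWith L l K →
      ConcaveOn ℝ K l → ∑ j, w j * l (pts j) ≤ l u + L * δ := by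
  obtain ⟨y, hy, huy⟩ := h.near u hu
  obtain ⟨w, hw, -, hws⟩ := exists_weights_of_mem_convexHull (c := Finset.univ) h.inj
    (by simpa using hy)
  refine ⟨w, hw, fun L l hl hc => ?_⟩
  have h1 := hc.le_map_sum (t := Finset.univ) (w := w) (p := pts) (fun i _ => hw.1 i) hw.2
    fun i _ => h.mem i
  rw [hws] at h1
  simp only [smul_eq_mul] at h1
  have hyK : y ∈ K := convexHull_min (Set.range_subset_iff.2 h.mem) hc.1 hy
  exact h1.trans (sub_le_of_lipschitz hl hu hyK huy)

/-! ### Guarantees from regret bounds -/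

lemma guaranteeMWU {d N : ℕ} {k : ℕ} (hk : mwuProgram.timeConst ≤ k) {K : Set (Pt d)}
    (hdiam : Metric.diam K = 1) {L : ℝ≥0} (hL : 0 < L) {T : ℕ} (hT : 0 < T) (hN : 0 < N)
    {pts : Fin N → Pt d} (hpts : ∀ i, pts i ∈ K) {𝓛 : Set (Pt d → ℝ)} {δ B : ℝ}
    (h𝓛 : ∀ l ∈ 𝓛, LipschitzOnWith L l K)
    (hδ : ∀ u ∈ K, ∃ w ∈ stdSimplex ℝ (Fin N), ∀ l ∈ 𝓛, ∑ j, w j * l (pts j) ≤ l u + δ)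
    (hB : 2 * L * √(T * (N * Real.log N)) + δ * T ≤ B) :
    GuaranteeMWU mwuProgram k K L T pts 𝓛 B := by
  intro l hl
  refine ⟨fun x hx => (fullSwapReg_mwu_le (δ := δ) hT hN hL hpts (fun t ht i j => ?_)
    (fun u hu => ?_) hx).trans (EReal.coe_le_coe_iff.2 hB), mwuProgram_correct hN _ _ _ _,
    fun t _ => ?_⟩
  · have := sub_le_of_lipschitz (h𝓛 _ (hl t ht)) (hpts j) (hpts i)
      (dist_le_one_of_diam hdiam (hpts j) (hpts i))
    linarith
  · obtain ⟨w, hw, hwl⟩ := hδ u hu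
    exact ⟨w, hw, fun t ht => hwl _ (hl t ht)⟩
  · refine (mwuProgram.time_le _ _ _ _ _ (by omega) (mwuProgram_fits d N).1
      (mwuProgram_fits d N).2 (fun o x => by simp [noOracle]) (fun t o x => ?_) t).trans
      (mul_pow_self_mono (by omega) hk)
    unfold valueOracle
    split_ifs
    · rw [List.length_singleton]
      omega
    · exact Nat.zero_le _

/-- Joined oracles concatenate their answers; `O` must be silent at the numbers 1 and 2 so that
subgradients and projections arrive unaltered. -/
lemma ogdProgram_guarantee {d N : ℕ} {k : ℕ} {row : Cmd}
    (hfits : (ogdProgram row).act.Fits (varBound d N) ∧ (ogdProgram row).update.Fits (varBound d N))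
    (hrow : ∀ w < 2, row.writesN w = false) (hrow' : ∀ a ∈ [0, 1, 2, 8], row.writesA a = false)
    (hk : (ogdProgram row).timeConst ≤ k) {K : Set (Pt d)} (hne : K.Nonempty) (hcl : IsClosed K)
    {α : ℝ} {T : ℕ} (hN : 0 < N) {pts q₁ : Fin N → Pt d} {H : Pt d → (Fin N → ℝ) → Prop}
    {O : Oracles d} (hO1 : ∀ x, O 1 x = []) (hO2 : ∀ x, O 2 x = [])
    (hO : ∀ o x, (O o x).length ≤ d + N) (hq₁ : ∀ s, q₁ s ∈ K)
    (hH : ∀ q z, H q z → z ∈ stdSimplex ℝ (Fin N)) (g : ℕ → Pt d → Pt d)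
    (hc : ∀ (s : Fin N) (τ : State), τ.nat 0 = d → τ.nat 1 = N → τ.nat 6 = s →
      (∀ i : Fin N, τ.point d 0 i = pts i) → τ.point d 1 s ∈ K →
      H (τ.point d 1 s) (fun j : Fin N => (row.run ((projOracle K).join O) τ).arr 6 s j) ∧
        ∀ s', s' ≠ (s : ℕ) → (row.run ((projOracle K).join O) τ).arr 6 s' = τ.arr 6 s') :
    let O₀ := (projOracle K).join O
    let O' := fun t => O₀.join (gradOracle (g t))
    let σ := inputState pts q₁ α
    IsRunConvex (fun s => ogd K α (q₁ s)) H g T ((ogdProgram row).play O₀ O' σ N) ∧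
    ∀ t < T, (ogdProgram row).time O₀ O' σ t ≤ k * (d + N) ^ k := by
  intro O₀ O' σ
  have hlen₀ : ∀ o x, (O₀ o x).length ≤ d + (d + N) := by
    intro o x
    simp only [O₀, Oracles.join, List.length_append]
    refine Nat.add_le_add ?_ (hO o x)
    unfold projOracle
    split_ifs <;> simp
  have hlen' : ∀ t o x, (O' t o x).length ≤ d + (d + N) + d := by
    intro t o x
    simp only [O', Oracles.join, List.length_append]
    refine Nat.add_le_add (by simpa [Oracles.join] using hlen₀ o x) ?_
    unfold gradOracle
    split_ifs <;> simp
  refine ⟨ogdProgram_correct hN hrow hrow' (fun t x => ?_) (fun t x => ?_) K hq₁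
    (fun z => (proj_spec hne hcl z).1) hH hc, fun t _ => ?_⟩
  · simp [O', O₀, Oracles.join, projOracle, gradOracle, hO1]
  · simp [O', O₀, Oracles.join, projOracle, gradOracle, hO2]
  · refine ((ogdProgram row).time_le _ _ _ _ _ (by omega) hfits.1 hfits.2
      (fun o x => (hlen₀ o x).trans (by omega)) (fun t o x => (hlen' t o x).trans (by omega))
      t).trans (mul_pow_self_mono (by omega) hk)

lemma guaranteeOGD_nearest {d N : ℕ} {k : ℕ} (hk : (ogdProgram nearestRow).timeConst ≤ k)
    {K : Set (Pt d)} (hne : K.Nonempty) (hcl : IsClosed K) {L : ℝ≥0} {α : ℝ} (hα : 0 < α) {T : ℕ}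
    (hN : 0 < N) {pts : Fin N → Pt d} {𝓛 : Set (Pt d → ℝ)}
    (h𝓛 : ∀ l ∈ 𝓛, LipschitzOnWith L l K ∧ StrongConvexOn K α l) {B : ℝ}
    (hB : ∀ (l : ℕ → Pt d → ℝ) (g : ℕ → Pt d → Pt d) (q₁ : Fin N → Pt d),
      (∀ t < T, l t ∈ 𝓛 ∧ IsSubgradientMap K L (l t) (g t)) → (∀ s, q₁ s ∈ K) →
      ∀ x : ℕ → Fin N → ℝ, IsRunConvex (fun s => ogd K α (q₁ s)) (NearestRounding pts) g T x →
      fullSwapReg K T (fun t => mixture pts (x t)) l ≤ (B : EReal)) :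
    GuaranteeOGD (ogdProgram nearestRow) k K L α T pts (NearestRounding pts) (noOracle d) 𝓛 B := by
  refine ⟨fun l hl => exists_isSubgradientMap (h𝓛 l hl).1 (StrongConvexOn.convexOn_of_pos (h𝓛 l hl).2 hα),
    fun l g q₁ hl hq₁ => ⟨hB l g q₁ hl hq₁, ?_⟩⟩
  refine ogdProgram_guarantee (ogdProgram_nearest_fits d N) (by decide) (by decide) hk hne hcl hN
    (fun _ => rfl) (fun _ => rfl) (fun _ _ => Nat.zero_le _) hq₁ ?_ g ?_
  · rintro q _ ⟨i, -, rfl⟩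
    exact single_mem_stdSimplex ℝ i
  · exact fun s τ hd hN h6 hpts _ => nearestRow_correct _ s τ hd hN h6 hpts

lemma guaranteeOGD_barycentric {d N : ℕ} {k : ℕ} (hk : (ogdProgram barycentricRow).timeConst ≤ k)
    {K : Set (Pt d)} (hne : K.Nonempty) (hcl : IsClosed K) {L : ℝ≥0} {α : ℝ} (hα : 0 < α) {T : ℕ}
    (hN : 0 < N) {pts : Fin N → Pt d} {ε : ℝ} {perp : Pt d → Pt d}
    {cell : Pt d → Finset (Fin N)} (htri : IsTriangulation ε K pts perp cell)
    {𝓛 : Set (Pt d → ℝ)}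
    (h𝓛 : ∀ l ∈ 𝓛, LipschitzOnWith L l K ∧ StrongConvexOn K α l) {B : ℝ}
    (hB : ∀ (l : ℕ → Pt d → ℝ) (g : ℕ → Pt d → Pt d) (q₁ : Fin N → Pt d),
      (∀ t < T, l t ∈ 𝓛 ∧ IsSubgradientMap K L (l t) (g t)) → (∀ s, q₁ s ∈ K) →
      ∀ x : ℕ → Fin N → ℝ,
      IsRunConvex (fun s => ogd K α (q₁ s)) (BarycentricRounding pts perp cell) g T x →
      fullSwapReg K T (fun t => mixture pts (x t)) l ≤ (B : EReal)) :
    GuaranteeOGD (ogdProgram barycentricRow) k K L α T pts (BarycentricRounding pts perp cell)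
      (cellOracle perp cell) 𝓛 B := by
  refine ⟨fun l hl => exists_isSubgradientMap (h𝓛 l hl).1 (StrongConvexOn.convexOn_of_pos (h𝓛 l hl).2 hα),
    fun l g q₁ hl hq₁ => ⟨hB l g q₁ hl hq₁, ?_⟩⟩
  refine ogdProgram_guarantee (ogdProgram_barycentric_fits d N) (by decide) (by decide) hk hne hcl
    hN (fun _ => rfl) (fun _ => rfl) (fun o x => ?_) hq₁ (fun q z hz => hz.1) g ?_
  · unfold cellOracle
    split_ifs <;> simp
  · exact fun s τ hd hN h6 hpts hK => run_barycentricRow _ hd hN h6 hpts htri.inj (fun _ => rfl)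
      (fun _ => rfl) (htri.isCell _ hK)

/-- The regret never exceeds the variation of the losses. -/
lemma fullSwapReg_le_of_lipschitz {d N T : ℕ} {K : Set (Pt d)} (hdiam : Metric.diam K = 1)
    {L : ℝ≥0} {pts : Fin N → Pt d} (hpts : ∀ i, pts i ∈ K) {l : ℕ → Pt d → ℝ}
    (hl : ∀ t < T, LipschitzOnWith L (l t) K) {x : ℕ → Fin N → ℝ}
    (hx : ∀ t < T, x t ∈ stdSimplex ℝ (Fin N)) :
    fullSwapReg K T (fun t => mixture pts (x t)) l ≤ ((L * T : ℝ) : EReal) := by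
  refine iSup_le fun φ => EReal.coe_le_coe_iff.2 ?_
  have key : ∀ t ∈ Finset.range T, expLoss (l t) (mixture pts (x t)) -
      expLoss (l t) (Finsupp.mapDomain φ.1 (mixture pts (x t))) ≤ L := by
    intro t ht
    have ht := Finset.mem_range.1 ht
    rw [mapDomain_mixture, expLoss_mixture, expLoss_mixture, ← Finset.sum_sub_distrib]
    calc ∑ i, (x t i * l t (pts i) - x t i * l t (φ.1 (pts i))) ≤ ∑ i, x t i * L := by
          refine Finset.sum_le_sum fun i _ => ?_
          rw [← mul_sub]
          refine mul_le_mul_of_nonneg_left ?_ ((hx t ht).1 i)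
          have := sub_le_of_lipschitz (hl t ht) (φ.2 (hpts i)) (hpts i)
            (dist_le_one_of_diam hdiam (φ.2 (hpts i)) (hpts i))
          linarith
      _ = L := by rw [← Finset.sum_mul, (hx t ht).2, one_mul]
  refine (Finset.sum_le_card_nsmul _ _ _ key).trans (le_of_eq ?_)
  rw [Finset.card_range, nsmul_eq_mul, mul_comm]

/-! ### Rates -/

lemma one_le_two_mul_log {T : ℕ} (hT : 2 ≤ T) : 1 ≤ 2 * Real.log T := by
  have h1 : Real.log 2 ≤ Real.log T := Real.log_le_log two_pos (by exact_mod_cast hT)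
  have h2 := Real.log_two_gt_d9
  linarith

/-- The constant in the regret bound of multiplicative weights on `A * T ^ s` points. -/
def mwuConst (A : ℝ) : ℝ := 2 * √(2 * A * (2 * Real.log A + 1)) + 2

/-- With `1 ≤ 2 * log T` the constant `log A` is absorbed into `log T`, and `log T` is at most `2 *
log T ^ 2`; this brings the square root to the full factor `log T` of the stated rates. -/
lemma sqrt_mul_log_le {T N : ℕ} {A s r : ℝ} (hT : 2 ≤ T) (hN : 0 < N) (hA : 1 ≤ A) (hs : s ≤ 1)
    (hr : r = (1 + s) / 2) (h : (N : ℝ) ≤ A * (T : ℝ) ^ s) :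
    √(T * (N * Real.log N)) ≤ √(2 * A * (2 * Real.log A + 1)) * ((T : ℝ) ^ r * Real.log T) := by
  have hT0 : (0 : ℝ) < T := by exact_mod_cast (by omega : 0 < T)
  have hN1 : (1 : ℝ) ≤ N := by exact_mod_cast hN
  have hlog := one_le_two_mul_log hT
  have hlogA : 0 ≤ Real.log A := Real.log_nonneg hA
  have hTs : 0 < (T : ℝ) ^ s := by positivity
  have hlogN : Real.log N ≤ (2 * Real.log A + 1) * Real.log T := by
    have h1 : Real.log N ≤ Real.log (A * (T : ℝ) ^ s) := Real.log_le_log (by linarith) h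
    rw [Real.log_mul (by positivity) hTs.ne', Real.log_rpow hT0] at h1
    nlinarith
  have hlogN0 : 0 ≤ Real.log N := Real.log_nonneg hN1
  have hsq : ((T : ℝ) ^ r) ^ 2 = T * (T : ℝ) ^ s := by
    rw [← Real.rpow_natCast, ← Real.rpow_mul hT0.le, hr]
    nth_rw 2 [← Real.rpow_one (T : ℝ)]
    rw [← Real.rpow_add hT0]
    congr 1
    push_cast
    ring
  have hlog' : Real.log T ≤ 2 * Real.log T ^ 2 := by nlinarith
  refine Real.sqrt_le_iff.2 ⟨by positivity, ?_⟩
  rw [mul_pow, mul_pow, hsq, Real.sq_sqrt (by positivity)]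
  calc T * (N * Real.log N)
      ≤ T * ((A * (T : ℝ) ^ s) * ((2 * Real.log A + 1) * (2 * Real.log T ^ 2))) := by
        gcongr
        exact hlogN.trans (by gcongr)
    _ = 2 * A * (2 * Real.log A + 1) * (T * (T : ℝ) ^ s * Real.log T ^ 2) := by ring

lemma mwu_rate_le {T N : ℕ} {A s r L M δ : ℝ} (hT : 2 ≤ T) (hN : 0 < N) (hA : 1 ≤ A) (hs : s ≤ 1)
    (hr : r = (1 + s) / 2) (h : (N : ℝ) ≤ A * (T : ℝ) ^ s) (hL : 0 ≤ L) (hLM : L ≤ M)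
    (hδ : δ * T ≤ M * (T : ℝ) ^ r) :
    2 * L * √(T * (N * Real.log N)) + δ * T ≤
      mwuConst A * (M * (T : ℝ) ^ r * Real.log T) := by
  have hlog := one_le_two_mul_log hT
  have h1 := sqrt_mul_log_le hT hN hA hs hr h
  have hM : 0 ≤ M := hL.trans hLM
  have hTr : 0 ≤ (T : ℝ) ^ r := by positivity
  have h2 : 2 * L * √(T * (N * Real.log N)) ≤
      2 * M * (√(2 * A * (2 * Real.log A + 1)) * ((T : ℝ) ^ r * Real.log T)) := by gcongr
  have h3 : M * (T : ℝ) ^ r * 1 ≤ M * (T : ℝ) ^ r * (2 * Real.log T) := by gcongr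
  rw [mwuConst]
  linarith

lemma rpow_neg_of_eq {T : ℕ} {ε r a : ℝ} (hε : ε = (T : ℝ) ^ (-(1 / r))) :
    ε ^ (-a) = (T : ℝ) ^ (a / r) := by
  rw [hε, ← Real.rpow_mul (Nat.cast_nonneg _)]
  congr 1
  ring

lemma pow_mul_of_eq {T : ℕ} (hT : 2 ≤ T) {ε r : ℝ} (n : ℕ)
    (hε : ε = (T : ℝ) ^ (-(1 / r))) : ε ^ n * T = (T : ℝ) ^ (1 - n / r) := by
  have hT0 : (0 : ℝ) < T := by exact_mod_cast (by omega : 0 < T)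
  rw [hε, ← Real.rpow_natCast, ← Real.rpow_mul hT0.le]
  nth_rw 2 [← Real.rpow_one (T : ℝ)]
  rw [← Real.rpow_add hT0]
  congr 1
  ring

lemma card_le_of_size {T N : ℕ} {c ε r a : ℝ} (hε : ε = (T : ℝ) ^ (-(1 / r)))
    (h : (N : ℝ) ≤ c * ε ^ (-a)) : (N : ℝ) ≤ max c 1 * (T : ℝ) ^ (a / r) := by
  rw [rpow_neg_of_eq hε] at h
  refine h.trans ?_
  gcongr
  exact le_max_left _ _

/-- This `ε` balances `√(T * N)` and `ε * T`: the exponents `(1 + d / (d + 2)) / 2` and `1 - 1 / (d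
+ 2)` coincide. -/
lemma mwu_net_guarantee {d k : ℕ} (hk : mwuProgram.timeConst ≤ k) {c : ℝ} {K : Set (Pt d)}
    (hdiam : Metric.diam K = 1) {T : ℕ} (hT : 2 ≤ T) {ε : ℝ}
    (hε : ε = (T : ℝ) ^ (-(1 / ((d : ℝ) + 2)))) {N : ℕ} {pts : Fin N → Pt d} (h : IsNet ε K pts)
    (hN : (N : ℝ) ≤ c * ε ^ (-(d : ℝ))) {L : ℝ≥0} (hL : 0 < L) :
    GuaranteeMWU mwuProgram k K L T pts {l | LipschitzOnWith L l K}
      (mwuConst (max c 1) * (L * (T : ℝ) ^ (((d : ℝ) + 1) / (d + 2)) * Real.log T)) := by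
  have hN0 := h.pos hdiam
  refine guaranteeMWU hk hdiam hL (by omega) hN0 h.mem (δ := L * ε) (fun l hl => hl)
    (fun u hu => ?_) ?_
  · obtain ⟨i, hi⟩ := h.near u hu
    refine ⟨Pi.single i 1, single_mem_stdSimplex ℝ i, fun l hl => ?_⟩
    rw [sum_single_mul]
    exact sub_le_of_lipschitz hl hu (h.mem i) hi
  · have hd : (0 : ℝ) < (d : ℝ) + 2 := by positivity
    refine mwu_rate_le hT hN0 (le_max_right _ _) ?_ ?_ (card_le_of_size hε hN) L.2 le_rfl ?_
    · rw [div_le_one hd]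
      linarith
    · field_simp
      ring
    · have := pow_mul_of_eq hT 1 hε
      rw [pow_one] at this
      rw [mul_assoc, this]
      refine le_of_eq ?_
      congr 2
      field_simp
      push_cast
      ring

/-- Now the error is `ε ^ 2 * T`, and `(1 + d / (d + 4)) / 2` equals `1 - 2 / (d + 4)`. -/
lemma mwu_triangulation_guarantee {d k : ℕ} (hk : mwuProgram.timeConst ≤ k) {c : ℝ}
    {K : Set (Pt d)} (hK : Convex ℝ K) (hdiam : Metric.diam K = 1) {T : ℕ} (hT : 2 ≤ T) {ε : ℝ}
    (hε : ε = (T : ℝ) ^ (-(1 / ((d : ℝ) + 4)))) {N : ℕ} {pts : Fin N → Pt d}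
    {perp : Pt d → Pt d} {cell : Pt d → Finset (Fin N)} (h : IsTriangulation ε K pts perp cell)
    (hN : (N : ℝ) ≤ c * ε ^ (-(d : ℝ))) {L : ℝ≥0} {β : ℝ} (hL : 0 < L) (hβ : 0 ≤ β) :
    GuaranteeMWU mwuProgram k K L T pts {l | LipschitzOnWith L l K ∧ IsSmoothOn K β l}
      (mwuConst (max c 1) * ((L + β) * (T : ℝ) ^ (((d : ℝ) + 2) / (d + 4)) * Real.log T)) := by
  obtain ⟨x₀, hx₀⟩ := nonempty_of_diam hdiam
  have hN0 := pos_of_mem_convexHull (h.perp_mem x₀ hx₀)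
  refine guaranteeMWU hk hdiam hL (by omega) hN0 h.mem (δ := (L + β / 2) * ε ^ 2)
    (fun l hl => hl.1) (fun u hu => ?_) ?_
  · obtain ⟨w, hw⟩ := h.exists_barycentricRounding hu
    exact ⟨w, hw.1, fun l hl => h.barycentricRounding_le hK hβ hl.1 hl.2 hu hw⟩
  · have hd : (0 : ℝ) < (d : ℝ) + 4 := by positivity
    have hL0 : (0 : ℝ) ≤ L := L.2
    refine mwu_rate_le hT hN0 (le_max_right _ _) ?_ ?_ (card_le_of_size hε hN) hL0
      (le_add_of_nonneg_right hβ) ?_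
    · rw [div_le_one hd]
      linarith
    · field_simp
      ring
    · rw [mul_assoc, pow_mul_of_eq hT 2 hε]
      have e : (1 : ℝ) - (2 : ℕ) / ((d : ℝ) + 4) = ((d : ℝ) + 2) / (d + 4) := by
        field_simp
        push_cast
        ring
      rw [e]
      gcongr
      linarith

/-- The error is `ε ^ 2 * T` with `d` replaced by `d - 1` in the size; `(1 + (d - 1) / (d + 3)) / 2`
equals `1 - 2 / (d + 3)`. -/
lemma mwu_polytope_guarantee {d k : ℕ} (hk : mwuProgram.timeConst ≤ k) {c : ℝ}
    {K : Set (Pt d)} (hdiam : Metric.diam K = 1) {T : ℕ} (hT : 2 ≤ T) {ε : ℝ}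
    (hε : ε = (T : ℝ) ^ (-(1 / ((d : ℝ) + 3)))) {N : ℕ} {pts : Fin N → Pt d}
    (h : IsPolytopeApprox (ε ^ 2) K pts) (hN : (N : ℝ) ≤ c * ε ^ (-((d : ℝ) - 1)))
    {L : ℝ≥0} (hL : 0 < L) :
    GuaranteeMWU mwuProgram k K L T pts {l | LipschitzOnWith L l K ∧ ConcaveOn ℝ K l}
      (mwuConst (max c 1) * (L * (T : ℝ) ^ (((d : ℝ) + 1) / (d + 3)) * Real.log T)) := by
  obtain ⟨x₀, hx₀⟩ := nonempty_of_diam hdiam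
  obtain ⟨y, hy, -⟩ := h.near x₀ hx₀
  have hN0 := pos_of_mem_convexHull hy
  refine guaranteeMWU hk hdiam hL (by omega) hN0 h.mem (δ := L * ε ^ 2)
    (fun l hl => hl.1) (fun u hu => ?_) ?_
  · obtain ⟨w, hw, hwl⟩ := h.exists_weights hu
    exact ⟨w, hw, fun l hl => hwl L l hl.1 hl.2⟩
  · have hd : (0 : ℝ) < (d : ℝ) + 3 := by positivity
    refine mwu_rate_le hT hN0 (le_max_right _ _) ?_ ?_ (card_le_of_size hε hN) L.2 le_rfl ?_
    · rw [div_le_one hd]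
      linarith
    · field_simp
      ring
    · rw [mul_assoc, pow_mul_of_eq hT 2 hε]
      refine le_of_eq ?_
      congr 2
      field_simp
      push_cast
      ring

/-- By `1 ≤ 2 * log T`, the factor `9 + log T` is at most `19 * log T`. -/
lemma ogd_rate_le {T : ℕ} (hT : 2 ≤ T) {A N V R Y D : ℝ} (hN : N * V ≤ A * Y)
    (hAY : 0 ≤ A * Y) (hD : R ≤ D * Y) (hDY : 0 ≤ D * Y) :
    N * (V * (9 + Real.log T)) + R ≤ (19 * A + 2 * D) * (Y * Real.log T) := by
  have hlog := one_le_two_mul_log hT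
  have h1 : N * V * (9 + Real.log T) ≤ A * Y * (19 * Real.log T) :=
    mul_le_mul hN (by linarith) (by linarith) hAY
  have h2 : D * Y * 1 ≤ D * Y * (2 * Real.log T) := by gcongr
  linarith

lemma ogd_net_guarantee {d k : ℕ} (hk : (ogdProgram nearestRow).timeConst ≤ k) {c : ℝ}
    {K : Set (Pt d)} (hK : Convex ℝ K) (hdiam : Metric.diam K = 1) (hcl : IsClosed K) {L : ℝ≥0}
    {α : ℝ} (hL : 0 < L) (hα : 0 < α) {T : ℕ} (hT : 2 ≤ T) {ε : ℝ}
    (hε : ε = ((L : ℝ) / α) ^ (1 / ((d : ℝ) + 1)) * (T : ℝ) ^ (-(1 / ((d : ℝ) + 1))))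
    {N : ℕ} {pts : Fin N → Pt d} (h : IsNet ε K pts)
    (hN : (N : ℝ) ≤ c * max 1 (ε ^ (-(d : ℝ)))) :
    GuaranteeOGD (ogdProgram nearestRow) k K L α T pts (NearestRounding pts) (noOracle d)
      {l | LipschitzOnWith L l K ∧ StrongConvexOn K α l}
      ((19 * max c 1 + 2) * (L * ((L : ℝ) / α) ^ (1 / ((d : ℝ) + 1)) *
        (T : ℝ) ^ ((d : ℝ) / (d + 1)) * Real.log T)) := by
  have hN0 := h.pos hdiam
  have hL0 : (0 : ℝ) < L := hL
  have hT0 : (0 : ℝ) < T := by exact_mod_cast (by omega : 0 < T)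
  have hd : (0 : ℝ) < (d : ℝ) + 1 := by positivity
  have hlog := one_le_two_mul_log hT
  set R : ℝ := (L : ℝ) / α with hR
  have hR0 : 0 < R := by positivity
  have hTT : (T : ℝ) ^ (1 / ((d : ℝ) + 1)) * (T : ℝ) ^ ((d : ℝ) / (d + 1)) = T := by
    rw [← Real.rpow_add hT0, ← add_div, add_comm 1, div_self hd.ne', Real.rpow_one]
  have hA : (1 : ℝ) ≤ max c 1 := le_max_right _ _
  refine guaranteeOGD_nearest hk (nonempty_of_diam hdiam) hcl hα hN0 (fun l hl => hl)
    fun l g q₁ hl hq₁ x hx => ?_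
  -- If `T ≤ R`, the claimed bound already exceeds the trivial bound `L * T`. Otherwise `ε ≤ 1`, the
  -- maximum in the size is `ε ^ (-d)`, and `ε ^ (d + 1) = R / T` makes `N * L ^ 2 / α` and `L * ε *
  -- T` comparable.
  rcases le_or_gt (T : ℝ) R with hRT | hRT
  · refine (fullSwapReg_le_of_lipschitz hdiam h.mem (fun t ht => (hl t ht).1.1)
      fun t ht => ?_).trans (EReal.coe_le_coe_iff.2 ?_)
    · obtain ⟨Q, -, hQ⟩ := hx t ht
      exact hQ.1
    · have h1 : (L : ℝ) * T ≤ L * R ^ (1 / ((d : ℝ) + 1)) * (T : ℝ) ^ ((d : ℝ) / (d + 1)) := by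
        nth_rw 1 [← hTT]
        rw [← mul_assoc]
        gcongr
      refine h1.trans ?_
      set Y : ℝ := L * R ^ (1 / ((d : ℝ) + 1)) * (T : ℝ) ^ ((d : ℝ) / (d + 1)) with hY
      have hY0 : 0 < Y := by positivity
      have h2 : Y * 1 ≤ Y * (2 * Real.log T) := by gcongr
      have h3 : 0 ≤ max c 1 * (Y * Real.log T) :=
        mul_nonneg (by positivity) (mul_nonneg hY0.le (by linarith))
      linarith
  · refine (fullSwapReg_ogd_le (δ := L * ε) hdiam hcl hK hα (by omega) h.mem
      (fun t ht => (hl t ht).1.1) (fun t ht => (hl t ht).1.2) (fun t ht => (hl t ht).2) hq₁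
      (fun q hq z hz t ht => h.nearestRounding_le (hl t ht).1.1 hq hz) hx).trans
      (EReal.coe_le_coe_iff.2 ?_)
    set Y : ℝ := L * R ^ (1 / ((d : ℝ) + 1)) * (T : ℝ) ^ ((d : ℝ) / (d + 1)) with hY
    have hY0 : 0 < Y := by positivity
    have hε0 : 0 < ε := by rw [hε]; positivity
    have hε1 : ε ≤ 1 := by
      rw [hε, Real.rpow_neg hT0.le, ← div_eq_mul_inv, div_le_one (by positivity)]
      exact Real.rpow_le_rpow hR0.le hRT.le (by positivity)
    have hεd : ε ^ (-(d : ℝ)) * R = R ^ (1 / ((d : ℝ) + 1)) * (T : ℝ) ^ ((d : ℝ) / (d + 1)) := by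
      rw [hε, Real.mul_rpow (by positivity) (by positivity), ← Real.rpow_mul hR0.le,
        ← Real.rpow_mul hT0.le, mul_right_comm]
      nth_rw 2 [← Real.rpow_one R]
      rw [← Real.rpow_add hR0]
      congr 2
      · field_simp
        ring
      · ring
    have hmax : max 1 (ε ^ (-(d : ℝ))) = ε ^ (-(d : ℝ)) :=
      max_eq_right (Real.one_le_rpow_of_pos_of_le_one_of_nonpos hε0 hε1 (by simp))
    rw [hmax] at hN
    have := ogd_rate_le hT (A := max c 1) (N := N) (V := L ^ 2 / α) (R := L * ε * T) (Y := Y)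
      (D := 1) ?_ (by positivity) (le_of_eq ?_) (by positivity)
    · rwa [mul_one] at this
    · have e : (L : ℝ) ^ 2 / α = L * R := by rw [hR]; ring
      calc (N : ℝ) * (L ^ 2 / α) ≤ max c 1 * ε ^ (-(d : ℝ)) * (L ^ 2 / α) := by
            gcongr
            refine hN.trans ?_
            gcongr
            exact le_max_left _ _
        _ = max c 1 * (L * (ε ^ (-(d : ℝ)) * R)) := by rw [e]; ring
        _ = max c 1 * Y := by rw [hεd, hY, mul_assoc (L : ℝ)]
    · rw [one_mul, hY, hε]
      have hTinv : (T : ℝ) ^ (-(1 / ((d : ℝ) + 1))) * T = (T : ℝ) ^ ((d : ℝ) / (d + 1)) := by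
        nth_rw 2 [← Real.rpow_one (T : ℝ)]
        rw [← Real.rpow_add hT0]
        congr 1
        field_simp
        ring
      rw [mul_assoc, mul_assoc, hTinv, mul_assoc]

lemma ogd_triangulation_guarantee {d k : ℕ} (hk : (ogdProgram barycentricRow).timeConst ≤ k)
    {c : ℝ} {K : Set (Pt d)} (hK : Convex ℝ K) (hdiam : Metric.diam K = 1) (hcl : IsClosed K)
    {T : ℕ} (hT : 2 ≤ T) {ε : ℝ} (hε : ε = (T : ℝ) ^ (-(1 / ((d : ℝ) + 2)))) {N : ℕ}
    {pts : Fin N → Pt d} {perp : Pt d → Pt d} {cell : Pt d → Finset (Fin N)}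
    (h : IsTriangulation ε K pts perp cell) (hN : (N : ℝ) ≤ c * ε ^ (-(d : ℝ))) {L : ℝ≥0}
    {α β : ℝ} (hL : 0 < L) (hα : 0 < α) (hβ : 0 ≤ β) :
    GuaranteeOGD (ogdProgram barycentricRow) k K L α T pts (BarycentricRounding pts perp cell)
      (cellOracle perp cell) {l | LipschitzOnWith L l K ∧ StrongConvexOn K α l ∧ IsSmoothOn K β l}
      ((19 * max c 1 + 2 * 4) * (L * (β / L + L / α) * (T : ℝ) ^ ((d : ℝ) / (d + 2)) *
        Real.log T)) := by
  have hne := nonempty_of_diam hdiam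
  obtain ⟨x₀, hx₀⟩ := hne
  have hN0 := pos_of_mem_convexHull (h.perp_mem x₀ hx₀)
  have hL0 : (0 : ℝ) < L := hL
  refine guaranteeOGD_barycentric hk ⟨x₀, hx₀⟩ hcl hα hN0 h (fun l hl => ⟨hl.1, hl.2.1⟩)
    fun l g q₁ hl hq₁ x hx => ?_
  refine (fullSwapReg_ogd_le (δ := (L + β / 2) * ε ^ 2) hdiam hcl hK hα (by omega) h.mem
    (fun t ht => (hl t ht).1.1) (fun t ht => (hl t ht).1.2.1) (fun t ht => (hl t ht).2) hq₁
    (fun q hq z hz t ht => h.barycentricRounding_le hK hβ (hl t ht).1.1 (hl t ht).1.2.2 hq hz)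
    hx).trans (EReal.coe_le_coe_iff.2 ?_)
  have hl0 := (hl 0 (by omega)).1
  have hαL := modulus_le_of_lipschitz hdiam hα hl0.1 hl0.2.1
  -- The Lipschitz part of the rounding error has to be absorbed, since the rate contains only `β +
  -- L ^ 2 / α`.
  have hLα : (L : ℝ) ≤ 4 * (L ^ 2 / α) := by
    rw [← mul_div_assoc, le_div_iff₀ hα]
    nlinarith
  have e : (L : ℝ) * (β / L + L / α) = β + L ^ 2 / α := by
    field_simp
  have hV : 0 ≤ (L : ℝ) ^ 2 / α := by positivity
  have hTd : 0 ≤ (T : ℝ) ^ ((d : ℝ) / (d + 2)) := by positivity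
  rw [e]
  refine ogd_rate_le hT ?_ (by positivity) ?_ (by positivity)
  · calc (N : ℝ) * (L ^ 2 / α)
        ≤ max c 1 * (T : ℝ) ^ ((d : ℝ) / (d + 2)) * (β + L ^ 2 / α) := by
          gcongr
          · exact card_le_of_size hε hN
          · linarith
      _ = max c 1 * ((β + L ^ 2 / α) * (T : ℝ) ^ ((d : ℝ) / (d + 2))) := by ring
  · rw [mul_assoc, pow_mul_of_eq hT 2 hε]
    have e' : (1 : ℝ) - (2 : ℕ) / ((d : ℝ) + 2) = (d : ℝ) / (d + 2) := by
      field_simp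
      push_cast
      ring
    rw [e', ← mul_assoc]
    gcongr
    linarith

end FullSwap

end

/-! ### The five rows together -/

open FullSwap in
theorem mainTheorem2 :
    ∃ (PM PN PT : OnlineProgram) (k : ℕ), ∀ d : ℕ,
    -- arbitrary Lipschitz losses: ε-net, multiplicative weights
    ((∃ c : ℝ, ∀ K : Set (Pt d), Convex ℝ K → Metric.diam K = 1 →
        ∀ T : ℕ, 2 ≤ T → ∀ ε : ℝ, ε = (T : ℝ) ^ (-(1 / ((d : ℝ) + 2))) →
        ∃ (N : ℕ) (pts : Fin N → Pt d), IsNet ε K pts ∧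
          (N : ℝ) ≤ c * ε ^ (-(d : ℝ)) ∧ N ≤ k * (d * T) ^ k) ∧
      (∀ c : ℝ, ∃ C : ℝ, ∀ K : Set (Pt d), Convex ℝ K → Metric.diam K = 1 →
        ∀ T : ℕ, 2 ≤ T → ∀ ε : ℝ, ε = (T : ℝ) ^ (-(1 / ((d : ℝ) + 2))) →
        ∀ (N : ℕ) (pts : Fin N → Pt d), IsNet ε K pts → (N : ℝ) ≤ c * ε ^ (-(d : ℝ)) →
        ∀ L : NNReal, 0 < L →
          GuaranteeMWU PM k K L T pts {l | LipschitzOnWith L l K}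
            (C * (L * (T : ℝ) ^ (((d : ℝ) + 1) / (d + 2)) * Real.log T)))) ∧
    -- smooth losses: ε-triangulation, multiplicative weights
    ((∃ c : ℝ, ∀ K : Set (Pt d), Convex ℝ K → Metric.diam K = 1 →
        ∀ T : ℕ, 2 ≤ T → ∀ ε : ℝ, ε = (T : ℝ) ^ (-(1 / ((d : ℝ) + 4))) →
        ∃ (N : ℕ) (pts : Fin N → Pt d) (perp : Pt d → Pt d) (cell : Pt d → Finset (Fin N)),
          IsTriangulation ε K pts perp cell ∧
          (N : ℝ) ≤ c * ε ^ (-(d : ℝ)) ∧ N ≤ k * (d * T) ^ k) ∧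
      (∀ c : ℝ, ∃ C : ℝ, ∀ K : Set (Pt d), Convex ℝ K → Metric.diam K = 1 →
        ∀ T : ℕ, 2 ≤ T → ∀ ε : ℝ, ε = (T : ℝ) ^ (-(1 / ((d : ℝ) + 4))) →
        ∀ (N : ℕ) (pts : Fin N → Pt d) (perp : Pt d → Pt d) (cell : Pt d → Finset (Fin N)),
        IsTriangulation ε K pts perp cell → (N : ℝ) ≤ c * ε ^ (-(d : ℝ)) →
        ∀ (L : NNReal) (β : ℝ), 0 < L → 0 ≤ β →
          GuaranteeMWU PM k K L T pts {l | LipschitzOnWith L l K ∧ IsSmoothOn K β l}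
            (C * ((L + β) * (T : ℝ) ^ (((d : ℝ) + 2) / (d + 4)) * Real.log T)))) ∧
    -- concave losses: polytope approximation, multiplicative weights
    ((∃ c : ℝ, ∀ K : Set (Pt d), Convex ℝ K → Metric.diam K = 1 →
        ∀ T : ℕ, 2 ≤ T → ∀ ε : ℝ, ε = (T : ℝ) ^ (-(1 / ((d : ℝ) + 3))) →
        ∃ (N : ℕ) (pts : Fin N → Pt d), IsPolytopeApprox (ε ^ 2) K pts ∧
          (N : ℝ) ≤ c * ε ^ (-((d : ℝ) - 1)) ∧ N ≤ k * (d * T) ^ k) ∧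
      (∀ c : ℝ, ∃ C : ℝ, ∀ K : Set (Pt d), Convex ℝ K → Metric.diam K = 1 →
        ∀ T : ℕ, 2 ≤ T → ∀ ε : ℝ, ε = (T : ℝ) ^ (-(1 / ((d : ℝ) + 3))) →
        ∀ (N : ℕ) (pts : Fin N → Pt d), IsPolytopeApprox (ε ^ 2) K pts →
        (N : ℝ) ≤ c * ε ^ (-((d : ℝ) - 1)) →
        ∀ L : NNReal, 0 < L →
          GuaranteeMWU PM k K L T pts {l | LipschitzOnWith L l K ∧ ConcaveOn ℝ K l}
            (C * (L * (T : ℝ) ^ (((d : ℝ) + 1) / (d + 3)) * Real.log T)))) ∧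
    -- strongly convex losses: ε-net, online gradient descent, rounding to a nearest point
    ((∃ c : ℝ, ∀ K : Set (Pt d), Convex ℝ K → Metric.diam K = 1 → IsClosed K →
        ∀ (L : NNReal) (α : ℝ), 0 < L → 0 < α →
        (∃ l, LipschitzOnWith L l K ∧ StrongConvexOn K α l) →
        ∀ T : ℕ, 2 ≤ T → ∀ ε : ℝ,
        ε = ((L : ℝ) / α) ^ (1 / ((d : ℝ) + 1)) * (T : ℝ) ^ (-(1 / ((d : ℝ) + 1))) →
        ∃ (N : ℕ) (pts : Fin N → Pt d), IsNet ε K pts ∧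
          (N : ℝ) ≤ c * max 1 (ε ^ (-(d : ℝ))) ∧ N ≤ k * (d * T) ^ k) ∧
      (∀ c : ℝ, ∃ C : ℝ, ∀ K : Set (Pt d), Convex ℝ K → Metric.diam K = 1 → IsClosed K →
        ∀ (L : NNReal) (α : ℝ), 0 < L → 0 < α →
        ∀ T : ℕ, 2 ≤ T → ∀ ε : ℝ,
        ε = ((L : ℝ) / α) ^ (1 / ((d : ℝ) + 1)) * (T : ℝ) ^ (-(1 / ((d : ℝ) + 1))) →
        ∀ (N : ℕ) (pts : Fin N → Pt d), IsNet ε K pts →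
        (N : ℝ) ≤ c * max 1 (ε ^ (-(d : ℝ))) →
          GuaranteeOGD PN k K L α T pts (NearestRounding pts) (noOracle d)
            {l | LipschitzOnWith L l K ∧ StrongConvexOn K α l}
            (C * (L * ((L : ℝ) / α) ^ (1 / ((d : ℝ) + 1)) *
              (T : ℝ) ^ ((d : ℝ) / (d + 1)) * Real.log T)))) ∧
    -- strongly convex and smooth losses: ε-triangulation, online gradient descent,
    -- barycentric rounding
    ((∃ c : ℝ, ∀ K : Set (Pt d), Convex ℝ K → Metric.diam K = 1 → IsClosed K →
        ∀ T : ℕ, 2 ≤ T → ∀ ε : ℝ, ε = (T : ℝ) ^ (-(1 / ((d : ℝ) + 2))) →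
        ∃ (N : ℕ) (pts : Fin N → Pt d) (perp : Pt d → Pt d) (cell : Pt d → Finset (Fin N)),
          IsTriangulation ε K pts perp cell ∧
          (N : ℝ) ≤ c * ε ^ (-(d : ℝ)) ∧ N ≤ k * (d * T) ^ k) ∧
      (∀ c : ℝ, ∃ C : ℝ, ∀ K : Set (Pt d), Convex ℝ K → Metric.diam K = 1 → IsClosed K →
        ∀ T : ℕ, 2 ≤ T → ∀ ε : ℝ, ε = (T : ℝ) ^ (-(1 / ((d : ℝ) + 2))) →
        ∀ (N : ℕ) (pts : Fin N → Pt d) (perp : Pt d → Pt d) (cell : Pt d → Finset (Fin N)),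
        IsTriangulation ε K pts perp cell → (N : ℝ) ≤ c * ε ^ (-(d : ℝ)) →
        ∀ (L : NNReal) (α β : ℝ), 0 < L → 0 < α → 0 ≤ β →
          GuaranteeOGD PT k K L α T pts (BarycentricRounding pts perp cell) (cellOracle perp cell)
            {l | LipschitzOnWith L l K ∧ StrongConvexOn K α l ∧ IsSmoothOn K β l}
            (C * (L * (β / L + L / α) * (T : ℝ) ^ ((d : ℝ) / (d + 2)) * Real.log T)))) := by
  -- One `k` serves as factor and exponent both in the size bounds, which need 81, and in the step
  -- counts of the three programs.
  refine ⟨mwuProgram, ogdProgram nearestRow, ogdProgram barycentricRow,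
    81 + (mwuProgram.timeConst + ((ogdProgram nearestRow).timeConst +
      (ogdProgram barycentricRow).timeConst)), fun d => ?_⟩
  set k := 81 + (mwuProgram.timeConst + ((ogdProgram nearestRow).timeConst +
    (ogdProgram barycentricRow).timeConst)) with hk
  have hM : mwuProgram.timeConst ≤ k := by omega
  have hN : (ogdProgram nearestRow).timeConst ≤ k := by omega
  have hB : (ogdProgram barycentricRow).timeConst ≤ k := by omega
  have hsize : ∀ {K : Set (Pt d)} {T N : ℕ}, Metric.diam K = 1 → 2 ≤ T →
      N ≤ 81 * (d * T) ^ 81 → N ≤ k * (d * T) ^ k := fun hdiam hT h =>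
    h.trans (mul_pow_self_mono (one_le_mul (dim_pos_of_diam hdiam) (by omega)) (by omega))
  refine ⟨⟨⟨40 ^ d, fun K hK hdiam T hT ε hε => ?_⟩,
      fun c => ⟨_, fun K _ hdiam T hT ε hε N pts h hc L hL =>
      mwu_net_guarantee hM hdiam hT hε h hc hL⟩⟩,
    ⟨⟨40 ^ d, fun K hK hdiam T hT ε hε => ?_⟩,
      fun c => ⟨_, fun K hK hdiam T hT ε hε N pts perp cell h hc L β hL hβ =>
      mwu_triangulation_guarantee hM hK hdiam hT hε h hc hL hβ⟩⟩,
    ⟨⟨2 * d * 40 ^ d, fun K hK hdiam T hT ε hε => ?_⟩,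
      fun c => ⟨_, fun K _ hdiam T hT ε hε N pts h hc L hL =>
      mwu_polytope_guarantee hM hdiam hT hε h hc hL⟩⟩,
    ⟨⟨40 ^ d, fun K hK hdiam _ L α _ hα hl T hT ε hε => ?_⟩,
      fun c => ⟨_, fun K hK hdiam hcl L α hL hα T hT ε hε N pts h hc =>
      ogd_net_guarantee hN hK hdiam hcl hL hα hT hε h hc⟩⟩,
    ⟨⟨40 ^ d, fun K hK hdiam _ T hT ε hε => ?_⟩,
      fun c => ⟨_, fun K hK hdiam hcl T hT ε hε N pts perp cell h hc L α β hL hα hβ =>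
      ogd_triangulation_guarantee hB hK hdiam hcl hT hε h hc hL hα hβ⟩⟩⟩
  · obtain ⟨N, pts, h, h1, h2⟩ := exists_isNet_size hK hdiam hT hε
    exact ⟨N, pts, h, h1, hsize hdiam hT h2⟩
  · obtain ⟨N, pts, perp, cell, h, h1, h2⟩ :=
      exists_isTriangulation_size (e := 4) hK hdiam hT (by norm_num) (by exact_mod_cast hε)
    exact ⟨N, pts, perp, cell, h, h1, hsize hdiam hT h2⟩
  · obtain ⟨N, pts, h, h1, h2⟩ := exists_isPolytopeApprox_size hK hdiam hT hε
    exact ⟨N, pts, h, h1, hsize hdiam hT h2⟩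
  · obtain ⟨N, pts, h, h1, h2⟩ := exists_isNet_size_of_strongConvex hK hdiam hα hl hT hε
    exact ⟨N, pts, h, h1, hsize hdiam hT h2⟩
  · obtain ⟨N, pts, perp, cell, h, h1, h2⟩ :=
      exists_isTriangulation_size (e := 2) hK hdiam hT (by norm_num) (by exact_mod_cast hε)
    exact ⟨N, pts, perp, cell, h, h1, hsize hdiam hT h2⟩
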